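/- Let $g\ge 0$ and let $\Sigma$ be a genus-$g$ surface with two holes, i.e. the space obtained from the closed connected orientable surface of genus $g$ by removing the interiors of two disjoint closed discs, and let $C_1,C_2$ be its two boundary circles. The arc complex $\mathcal A(\Sigma)$ is the simplicial complex whose vertices are the isotopy classes of properly embedded arcs in $\Sigma$ connecting $C_1$ and $C_2$ (endpoints may slide along $C_1$ and $C_2$ during an isotopy), and in which $k+1$ vertices span a $k$-simplex if they admit pairwise disjoint representative arcs. Then $\mathcal A(\Sigma)$ is connected (and in particular nonempty). Moreover, if $v$ and $w$ are vertices of $\mathcal A(\Sigma)$ that have representative arcs intersecting transversely (in particular, only in the interior of $\Sigma$) in exactly $k$ points, then the distance from $v$ to $w$ in the $1$-skeleton of $\mathcal A(\Sigma)$, with the path metric in which every edge has length $1$, is at most $k+1$. -/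

import Mathlib

/-- The standard genus-`g` surface with two holes, embedded in `ℝ³`.
Let `P` be the closed disc of radius `3g + 2` about the origin minus the `g` open unit discs about
the points `(3j, 0)`, `1 ≤ j ≤ g`.  The equation `z² = f(x, y)` below has solutions exactly over `P`
and cuts out the double of `P` along its `g + 1` boundary circles, that is, the closed orientable
surface of genus `g`.  The condition `1 ≤ x² + y²` removes two open discs from it: the part of the
upper sheet and the part of the lower sheet lying over the open unit disc about the origin. -/
def standardSurface (g : ℕ) : Set (ℝ × ℝ × ℝ) :=
  {p | 1 ≤ p.1 ^ 2 + p.2.1 ^ 2 ∧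
    p.2.2 ^ 2 = ((3 * (g : ℝ) + 2) ^ 2 - (p.1 ^ 2 + p.2.1 ^ 2)) *
      ∏ j ∈ Finset.Icc 1 g, ((p.1 - 3 * (j : ℝ)) ^ 2 + p.2.1 ^ 2 - 1)}

/-- The boundary circle of the standard surface in the upper sheet. -/
def upperCircle (g : ℕ) : Set (standardSurface g) :=
  {p | p.1.1 ^ 2 + p.1.2.1 ^ 2 = 1 ∧ 0 < p.1.2.2}

/-- The boundary circle of the standard surface in the lower sheet. -/
def lowerCircle (g : ℕ) : Set (standardSurface g) :=
  {p | p.1.1 ^ 2 + p.1.2.1 ^ 2 = 1 ∧ p.1.2.2 < 0}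

/-- `S` is a genus-`g` surface with two holes, whose boundary circles are `C₁` and `C₂`. -/
def IsTwoHoledSurface (g : ℕ) (S : Type*) [TopologicalSpace S] (C₁ C₂ : Set S) : Prop :=
  ∃ φ : S ≃ₜ standardSurface g, φ '' C₁ = upperCircle g ∧ φ '' C₂ = lowerCircle g

section Arcs

variable {S : Type*} [TopologicalSpace S]

/-- `A` is a properly embedded arc in the surface `S` (with boundary `C₁ ∪ C₂`) connecting `C₁` and
`C₂`: it is the image of an embedding of `[0, 1]` that takes `0` into `C₁`, `1` into `C₂` and
nothing else into the boundary, and it is a one-dimensional submanifold of `S`: around each of its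
points there is a chart of `S` to the half-plane `{x₀ ≥ 0}` in which the boundary of `S` is
`{x₀ = 0}` and `A` is `{x₁ = 0}`.  (A chart at an interior point may have its image in
`{x₀ > 0}`.) -/
def IsProperArc (C₁ C₂ A : Set S) : Prop :=
  (∃ γ : unitInterval → S, Topology.IsEmbedding γ ∧ Set.range γ = A ∧ γ 0 ∈ C₁ ∧ γ 1 ∈ C₂ ∧
    ∀ t, t ≠ 0 → t ≠ 1 → γ t ∉ C₁ ∪ C₂) ∧
  ∀ x ∈ A, ∃ e : OpenPartialHomeomorph S (EuclideanHalfSpace 2), x ∈ e.source ∧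
    ∀ y ∈ e.source, (y ∈ C₁ ∪ C₂ ↔ (e y).1 0 = 0) ∧ (y ∈ A ↔ (e y).1 1 = 0)

/-- The properly embedded arcs in `S` connecting `C₁` and `C₂`. -/
def ProperArc (C₁ C₂ : Set S) : Type _ := {A : Set S // IsProperArc C₁ C₂ A}

/-- Two subsets of `S` are isotopic if there is an isotopy of `S` (a level-preserving homeomorphism
of `[0, 1] × S` that is the identity at time `0`) which takes the first to the second at time `1`.
The isotopy need not fix the boundary of `S` pointwise. -/
def AreIsotopic (A B : Set S) : Prop :=
  ∃ Φ : (unitInterval × S) ≃ₜ (unitInterval × S),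
    (∀ p, (Φ p).1 = p.1) ∧ (∀ x, Φ (0, x) = (0, x)) ∧ (fun x => (Φ (1, x)).2) '' A = B

theorem AreIsotopic.refl (A : Set S) : AreIsotopic A A :=
  ⟨Homeomorph.refl _, fun _ => rfl, fun _ => rfl, by simp⟩

theorem AreIsotopic.symm {A B : Set S} (h : AreIsotopic A B) : AreIsotopic B A := by
  obtain ⟨Φ, h1, h2, rfl⟩ := h
  have h3 : ∀ p, (Φ.symm p).1 = p.1 := fun p => by
    have := h1 (Φ.symm p)
    simpa using this.symm
  refine ⟨Φ.symm, h3, fun x => ?_, ?_⟩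
  · rw [Homeomorph.symm_apply_eq, h2]
  · rw [Set.image_image]
    have h4 : ∀ x, (Φ.symm (1, (Φ (1, x)).2)).2 = x := fun x => by
      have : ((1 : unitInterval), (Φ (1, x)).2) = Φ (1, x) := Prod.ext (h1 (1, x)).symm rfl
      rw [this, Homeomorph.symm_apply_apply]
    simp [h4]

theorem AreIsotopic.trans {A B C : Set S} (h : AreIsotopic A B) (h' : AreIsotopic B C) :
    AreIsotopic A C := by
  obtain ⟨Φ, h1, h2, rfl⟩ := h
  obtain ⟨Ψ, h1', h2', rfl⟩ := h'
  refine ⟨Φ.trans Ψ, fun p => ?_, fun x => ?_, ?_⟩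
  · simp [h1, h1']
  · simp [h2, h2']
  · rw [Set.image_image]
    have h4 : ∀ x, Φ (1, x) = (1, (Φ (1, x)).2) := fun x => Prod.ext (h1 (1, x)) rfl
    refine Set.image_congr fun x _ => ?_
    rw [Homeomorph.trans_apply, ← h4]

/-- The relation of isotopy on properly embedded arcs. -/
def isotopySetoid (C₁ C₂ : Set S) : Setoid (ProperArc C₁ C₂) where
  r l m := AreIsotopic l.1 m.1
  iseqv := ⟨fun l => AreIsotopic.refl l.1, AreIsotopic.symm, AreIsotopic.trans⟩

/-- Isotopy classes of properly embedded arcs connecting `C₁` and `C₂`. -/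
def ArcClass (C₁ C₂ : Set S) : Type _ := Quotient (isotopySetoid C₁ C₂)

/-- The isotopy class represented by an arc. -/
def ProperArc.toClass {C₁ C₂ : Set S} (l : ProperArc C₁ C₂) : ArcClass C₁ C₂ :=
  Quotient.mk (isotopySetoid C₁ C₂) l

/-- The arc complex: its vertices are the isotopy classes of properly embedded arcs connecting `C₁`
and `C₂`, and finitely many vertices span a simplex if they have pairwise disjoint
representatives. -/
def arcComplex (C₁ C₂ : Set S) : AbstractSimplicialComplex (ArcClass C₁ C₂) where
  faces := {s | s.Nonempty ∧ ∃ r : ArcClass C₁ C₂ → ProperArc C₁ C₂,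
    (∀ v ∈ s, (r v).toClass = v) ∧ ∀ v ∈ s, ∀ w ∈ s, v ≠ w → Disjoint (r v).1 (r w).1}
  isRelLowerSet_faces := by
    rintro s ⟨hs, r, h1, h2⟩
    exact ⟨hs, fun t hts ht => ⟨ht, r, fun v hv => h1 v (hts hv),
      fun v hv w hw => h2 v (hts hv) w (hts hw)⟩⟩
  singleton_mem := by
    intro v
    refine ⟨Finset.singleton_nonempty v, Quotient.out, fun w _ => Quotient.out_eq w, ?_⟩
    intro a ha b hb hab
    rw [Finset.mem_singleton] at ha hb
    exact absurd (ha.trans hb.symm) hab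

/-- Two arcs intersect transversely: every common point is an interior point of `S`, and around it
there is a chart of `S` to the plane in which the two arcs are the two coordinate axes. -/
def IntersectTransversely {C₁ C₂ : Set S} (l m : ProperArc C₁ C₂) : Prop :=
  ∀ x ∈ l.1 ∩ m.1, x ∉ C₁ ∪ C₂ ∧
    ∃ e : OpenPartialHomeomorph S (EuclideanSpace ℝ (Fin 2)), x ∈ e.source ∧
      ∀ y ∈ e.source, (y ∈ l.1 ↔ e y 0 = 0) ∧ (y ∈ m.1 ↔ e y 1 = 0)

end Arcs

/-- The 1-skeleton of an abstract simplicial complex, as a graph. -/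
def AbstractSimplicialComplex.oneSkeleton {V : Type*} (K : AbstractSimplicialComplex V) :
    SimpleGraph V where
  Adj v w := v ≠ w ∧ ∃ s ∈ K.faces, ∀ x, x ∈ s ↔ x = v ∨ x = w
  symm := ⟨fun _ _ h => ⟨h.1.symm, h.2.imp fun _ hs => ⟨hs.1, fun x => (hs.2 x).trans or_comm⟩⟩⟩
  loopless := ⟨fun _ h => h.1 rfl⟩

/-! The distance bound is a surgery argument. Let `l` and `m` be transverse with at least one common
point, and let `x` be the last point of `m`, going from `C₁` to `C₂`, that lies on `l`. Follow `l`
from `C₁` to `x` and then `m` from `x` to `C₂`. This is a simple arc with a corner at `x`.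
Straighten the corner and push the arc off itself, towards the side that at `x` is the quadrant
inside the corner. The result is disjoint from `l`, because the final piece of `m` misses `l`, and
it meets `m` at most once for each crossing on `l` before `x`, hence in fewer points than `l` does.
Disjoint arcs are at distance at most `1`, and induction on the number of crossings gives `k + 1`
(`exists_surgery`, `edist_toClass_le`).

Connectedness needs more, since arcs that are only locally flat may meet in infinitely many points.
Instead of putting two arcs in general position, every arc `l` is compared with one fixed arc, the
`meridian`: it suffices to find an arc disjoint from `l` and transverse to the meridian. Pushing `l`
off itself gives a connected set that avoids `l` and joins the two circles. It is replaced by an arc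
composed of pieces of curves `x = c` and `y = d` on the surface (`IsGrid.exists_properArc`): being
reachable from `C₁` by such pieces off `l` is a locally constant property along the connected set,
because the grid of these curves is dense and locally connected.

The grid is chosen by arithmetic. The numbers `c` are rational but not integral, the numbers `d`
have irrational square, while the fold circles and the boundary circles lie over circles with
integral centres and radii, and the meridian lies over `y = 0`. Hence no grid curve is tangent to
any of these, and two grid curves never cross on a fold (`isGridSurface_standard`).

The pushes are composed of finitely many homeomorphisms supported in charts (`exists_isPush`); they
need a consistent choice of side along the arc (`exists_isSideAt`). -/

open Set Filter Topology

/-! ### The half-plane -/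

/-- The Euclidean plane. -/
abbrev Plane := EuclideanSpace ℝ (Fin 2)

/-- The closed half-plane. -/
abbrev HalfPlane := EuclideanHalfSpace 2

theorem Plane.ext {x y : Plane} (h0 : x 0 = y 0) (h1 : x 1 = y 1) : x = y := by
  ext i; fin_cases i <;> assumption

theorem HalfPlane.ext {x y : HalfPlane} (h0 : x.1 0 = y.1 0) (h1 : x.1 1 = y.1 1) : x = y :=
  Subtype.ext (Plane.ext h0 h1)

theorem Plane.exists_box {x : Plane} {U : Set Plane} (hU : U ∈ 𝓝 x) :
    ∃ r > 0, ∀ y : Plane, |y 0 - x 0| ≤ r → |y 1 - x 1| ≤ r → y ∈ U := by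
  obtain ⟨ε, hε, h⟩ := Metric.mem_nhds_iff.1 hU
  refine ⟨ε / 3, by positivity, fun y h0 h1 => h ?_⟩
  rw [Metric.mem_ball, EuclideanSpace.dist_eq, Fin.sum_univ_two, Real.dist_eq, Real.dist_eq,
    Real.sqrt_lt' hε]
  have := pow_le_pow_left₀ (abs_nonneg _) h0 2
  have := pow_le_pow_left₀ (abs_nonneg _) h1 2
  nlinarith

theorem HalfPlane.exists_box {x : HalfPlane} {U : Set HalfPlane} (hU : U ∈ 𝓝 x) :
    ∃ r > 0, ∀ y : HalfPlane, |y.1 0 - x.1 0| ≤ r → |y.1 1 - x.1 1| ≤ r → y ∈ U := by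
  obtain ⟨V, hV, hVU⟩ := mem_nhds_subtype _ _ _ |>.1 hU
  obtain ⟨r, hr, h⟩ := Plane.exists_box hV
  exact ⟨r, hr, fun y h0 h1 => hVU (h y.1 h0 h1)⟩

theorem HalfPlane.isCompact_box (a b r : ℝ) :
    IsCompact {x : HalfPlane | |x.1 0 - a| ≤ r ∧ |x.1 1 - b| ≤ r} := by
  have h1 : IsClosed {x : Plane | 0 ≤ x 0} := isClosed_le (by fun_prop) (by fun_prop)
  have h2 : IsCompact {x : Plane | |x 0 - a| ≤ r ∧ |x 1 - b| ≤ r} := by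
    refine Metric.isCompact_of_isClosed_isBounded ?_ ?_
    · have h3 : IsClosed {x : Plane | |x 0 - a| ≤ r} := isClosed_le (by fun_prop) (by fun_prop)
      have h4 : IsClosed {x : Plane | |x 1 - b| ≤ r} := isClosed_le (by fun_prop) (by fun_prop)
      exact h3.inter h4
    · refine (Metric.isBounded_closedBall (x := (!₂[a, b] : Plane)) (r := 2 * |r|)).subset ?_
      rintro x ⟨h0, h1⟩
      rw [Metric.mem_closedBall, EuclideanSpace.dist_eq, Fin.sum_univ_two, Real.dist_eq,
        Real.dist_eq]
      apply Real.sqrt_le_iff.2 ⟨by positivity, ?_⟩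
      have h0' := pow_le_pow_left₀ (abs_nonneg _) (h0.trans (le_abs_self r)) 2
      have h1' := pow_le_pow_left₀ (abs_nonneg _) (h1.trans (le_abs_self r)) 2
      simp only [Matrix.cons_val_zero, Matrix.cons_val_one] at *
      nlinarith [abs_nonneg r]
  exact (h1.isClosedEmbedding_subtypeVal).isCompact_preimage h2

/-! ### Extension of compactly supported homeomorphisms from a chart -/

/-- By injectivity `ψ` maps `K` into itself, so it can be extended by the identity. The extension is
continuous because the copy of `K` in `S` is compact, hence closed, and a continuous bijection of a
compact Hausdorff space is a homeomorphism. -/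
theorem OpenPartialHomeomorph.exists_homeomorph_extending {S X : Type*} [TopologicalSpace S]
    [TopologicalSpace X] [CompactSpace S] [T2Space S] (e : OpenPartialHomeomorph S X)
    {ψ : X → X} (hψ : Continuous ψ) (hb : Function.Bijective ψ) {K : Set X} (hK : IsCompact K)
    (hKe : K ⊆ e.target) (hid : ∀ x ∉ K, ψ x = x) :
    ∃ h : S ≃ₜ S, (∀ q ∈ e.source, h q ∈ e.source ∧ e (h q) = ψ (e q)) ∧
      ∃ L ⊆ e.source, IsClosed L ∧ ∀ q ∉ L, h q = q := by
  classical
  have hKK : ∀ x ∈ K, ψ x ∈ K := by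
    intro x hx
    by_contra hcon
    have := hb.1 (hid _ hcon)
    exact hcon (by rwa [this])
  have htgt : ∀ x ∈ e.target, ψ x ∈ e.target := by
    intro x hx
    by_cases hxK : x ∈ K
    · exact hKe (hKK x hxK)
    · rwa [hid x hxK]
  let f : S → S := fun q => if q ∈ e.source then e.symm (ψ (e q)) else q
  have hf1 : ∀ q ∈ e.source, f q = e.symm (ψ (e q)) := fun q hq => if_pos hq
  have hf2 : ∀ q ∉ e.source, f q = q := fun q hq => if_neg hq
  have hfs : ∀ q ∈ e.source, f q ∈ e.source ∧ e (f q) = ψ (e q) := by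
    intro q hq
    rw [hf1 q hq]
    have := htgt _ (e.map_source hq)
    exact ⟨e.map_target this, e.right_inv this⟩
  have hLc : IsCompact (e.symm '' K) := hK.image_of_continuousOn (e.continuousOn_symm.mono hKe)
  have hLs : e.symm '' K ⊆ e.source := by
    rintro _ ⟨x, hx, rfl⟩
    exact e.map_target (hKe hx)
  have hfL : ∀ q ∉ e.symm '' K, f q = q := by
    intro q hq
    by_cases hqs : q ∈ e.source
    · rw [hf1 q hqs, hid, e.left_inv hqs]
      exact fun h => hq ⟨_, h, e.left_inv hqs⟩
    · exact hf2 q hqs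
  have hcont : Continuous f := by
    rw [continuous_iff_continuousAt]
    intro q
    by_cases hqs : q ∈ e.source
    · have h1 : ContinuousAt (fun q => e.symm (ψ (e q))) q := by
        refine ContinuousAt.comp (g := e.symm) ?_ (hψ.continuousAt.comp (e.continuousAt hqs))
        exact e.symm.continuousAt (htgt _ (e.map_source hqs))
      refine h1.congr ?_
      filter_upwards [e.open_source.mem_nhds hqs] with y hy
      exact (hf1 y hy).symm
    · refine continuousAt_id.congr ?_
      filter_upwards [hLc.isClosed.isOpen_compl.mem_nhds (fun h => hqs (hLs h))] with y hy
      exact (hfL y hy).symm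
  have hbij : Function.Bijective f := by
    constructor
    · intro p q hpq
      by_cases hp : p ∈ e.source <;> by_cases hq : q ∈ e.source
      · have h1 := (hfs p hp).2
        rw [hpq, (hfs q hq).2] at h1
        exact e.injOn hp hq (hb.1 h1.symm)
      · exact absurd (hpq ▸ (hfs p hp).1) (by rwa [hf2 q hq])
      · exact absurd (hpq ▸ (hfs q hq).1) (by rwa [hf2 p hp])
      · rwa [hf2 p hp, hf2 q hq] at hpq
    · intro q
      by_cases hq : q ∈ e.source
      · obtain ⟨x, hx⟩ := hb.2 (e q)
        have hxt : x ∈ e.target := by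
          by_cases hxK : x ∈ K
          · exact hKe hxK
          · rw [hid x hxK] at hx
            exact hx ▸ e.map_source hq
        refine ⟨e.symm x, ?_⟩
        rw [hf1 _ (e.map_target hxt), e.right_inv hxt, hx, e.left_inv hq]
      · exact ⟨q, hf2 q hq⟩
  refine ⟨Continuous.homeoOfEquivCompactToT2 (f := Equiv.ofBijective f hbij) hcont, hfs, _, hLs,
    hLc.isClosed, hfL⟩

/-! ### The vertical push in a chart -/

/-- The tent function `max 0 (r - |y|)` is 1-Lipschitz, so adding at most half of it cannot reverse
the order. -/
theorem bump_add_strictMono {κ r : ℝ} (h0 : 0 ≤ κ) (h1 : κ ≤ 1 / 2) :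
    StrictMono fun y : ℝ => y + κ * max 0 (r - |y|) := by
  intro x y hxy
  have h2 : max 0 (r - |x|) ≤ max 0 (r - |y|) + (y - x) := by
    have := abs_sub_abs_le_abs_sub y x
    rw [abs_of_pos (sub_pos.2 hxy)] at this
    rcases max_cases 0 (r - |x|) with ⟨h, _⟩ | ⟨h, _⟩ <;> rw [h]
    · have := le_max_left 0 (r - |y|); linarith
    · have := le_max_right 0 (r - |y|); linarith
  have h3 := mul_le_mul_of_nonneg_left h2 h0
  show x + κ * _ < y + κ * _
  nlinarith

theorem bump_add_surjective (κ r : ℝ) :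
    Function.Surjective fun y : ℝ => y + κ * max 0 (r - |y|) := by
  refine Continuous.surjective (by fun_prop) ?_ ?_
  · refine tendsto_id.congr' ?_
    filter_upwards [eventually_ge_atTop |r|] with y hy
    have : r - |y| ≤ 0 := by linarith [le_abs_self r, le_abs_self y]
    simp [max_eq_left this]
  · refine tendsto_id.congr' ?_
    filter_upwards [eventually_le_atBot (-|r|)] with y hy
    have : r - |y| ≤ 0 := by linarith [le_abs_self r, neg_le_abs y]
    simp [max_eq_left this]

/-- The map of the half-plane that moves the points near `(a, 0)` upwards. -/
noncomputable def halfPlanePush (a r : ℝ) (x : HalfPlane) : HalfPlane :=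
  ⟨!₂[x.1 0, x.1 1 + min (max 0 (r - |x.1 0 - a|)) (1 / 2) * max 0 (r - |x.1 1|)], by
    simpa using x.2⟩

@[simp] theorem halfPlanePush_zero (a r : ℝ) (x : HalfPlane) :
    (halfPlanePush a r x).1 0 = x.1 0 := by simp [halfPlanePush]

@[simp] theorem halfPlanePush_one (a r : ℝ) (x : HalfPlane) : (halfPlanePush a r x).1 1 =
    x.1 1 + min (max 0 (r - |x.1 0 - a|)) (1 / 2) * max 0 (r - |x.1 1|) := by
  simp [halfPlanePush]

theorem halfPlanePush_continuous (a r : ℝ) : Continuous (halfPlanePush a r) := by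
  refine Continuous.subtype_mk ?_ _
  refine (PiLp.continuous_toLp 2 _).comp (continuous_pi fun i => ?_)
  fin_cases i <;> simp <;> fun_prop

/-- Each vertical line is mapped to itself, and the cap `1 / 2` on the horizontal factor makes the
map on it strictly increasing. -/
theorem halfPlanePush_bijective (a r : ℝ) : Function.Bijective (halfPlanePush a r) := by
  have h0 : ∀ t : ℝ, 0 ≤ min (max 0 (r - |t - a|)) (1 / 2) := fun t => by positivity
  constructor
  · intro x y hxy
    have e0 : x.1 0 = y.1 0 := by
      rw [← halfPlanePush_zero a r x, hxy, halfPlanePush_zero]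
    refine HalfPlane.ext e0 ?_
    have e1 := halfPlanePush_one a r x
    rw [hxy, halfPlanePush_one, e0] at e1
    exact ((bump_add_strictMono (r := r) (h0 (y.1 0)) (min_le_right _ _)).injective e1).symm
  · intro y
    obtain ⟨t, ht⟩ := bump_add_surjective (min (max 0 (r - |y.1 0 - a|)) (1 / 2)) r (y.1 1)
    refine ⟨⟨!₂[y.1 0, t], by simpa using y.2⟩, HalfPlane.ext (by simp) ?_⟩
    rw [halfPlanePush_one]
    simpa using ht

/-- The basic local move: vertical lines of the chart are preserved, nothing goes down, and the
horizontal axis near `p` goes strictly up. Preserving vertical lines is what keeps the boundary and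
the crossing arcs invariant. -/
theorem OpenPartialHomeomorph.exists_push {S : Type*} [TopologicalSpace S] [CompactSpace S]
    [T2Space S] (e : OpenPartialHomeomorph S HalfPlane) {p : S} (hp : p ∈ e.source)
    (hp1 : (e p).1 1 = 0) :
    ∃ h : S ≃ₜ S, (∀ q ∈ e.source, h q ∈ e.source ∧ (e (h q)).1 0 = (e q).1 0 ∧
        (e q).1 1 ≤ (e (h q)).1 1) ∧
      (∃ L ⊆ e.source, IsClosed L ∧ ∀ q ∉ L, h q = q) ∧
      ∀ᶠ q in 𝓝 p, (e q).1 1 = 0 → 0 < (e (h q)).1 1 := by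
  obtain ⟨r, hr, hbox⟩ := HalfPlane.exists_box (e.open_target.mem_nhds (e.map_source hp))
  obtain ⟨h, h1, h2⟩ := e.exists_homeomorph_extending (halfPlanePush_continuous ((e p).1 0) r)
    (halfPlanePush_bijective _ r) (HalfPlane.isCompact_box ((e p).1 0) ((e p).1 1) r)
    (fun x hx => hbox x hx.1 hx.2) (by
      intro x hx
      refine HalfPlane.ext (by simp) ?_
      rw [halfPlanePush_one]
      rw [mem_ofPred_eq, not_and_or, not_le, not_le, hp1, sub_zero] at hx
      rcases hx with hx | hx
      · rw [max_eq_left (by linarith : r - |x.1 0 - (e p).1 0| ≤ 0)]; simp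
      · rw [max_eq_left (by linarith : r - |x.1 1| ≤ 0)]; simp)
  refine ⟨h, fun q hq => ⟨(h1 q hq).1, ?_, ?_⟩, h2, ?_⟩
  · rw [(h1 q hq).2, halfPlanePush_zero]
  · rw [(h1 q hq).2, halfPlanePush_one]
    have : 0 ≤ min (max 0 (r - |(e q).1 0 - (e p).1 0|)) (1 / 2) * max 0 (r - |(e q).1 1|) := by
      positivity
    linarith
  · have hc : ContinuousAt (fun q => |(e q).1 0 - (e p).1 0|) p := by
      have h3 : Continuous fun x : HalfPlane => |x.1 0 - (e p).1 0| := by fun_prop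
      exact h3.continuousAt.comp (e.continuousAt hp)
    have h4 : ∀ᶠ q in 𝓝 p, |(e q).1 0 - (e p).1 0| < r :=
      hc.eventually (gt_mem_nhds (by simpa using hr))
    filter_upwards [h4, e.open_source.mem_nhds hp] with q hq hqs hq0
    rw [(h1 q hqs).2, halfPlanePush_one, hq0]
    have h5 : 0 < r - |(e q).1 0 - (e p).1 0| := by linarith
    have h6 : 0 < r - |(0 : ℝ)| := by simpa using hr
    rw [max_eq_right h5.le, max_eq_right h6.le, zero_add]
    positivity

/-! ### Pushing a whole arc to one side -/

section Push

variable {S : Type*} [TopologicalSpace S]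

/-- A homeomorphism that moves the set `n` towards its side `P` and is compatible with the set `m`,
which may cross `n` at the points of `F` only, and with the sets `C₁` and `C₂`. -/
structure IsPush (n P m F C₁ C₂ : Set S) (h : S ≃ₜ S) : Prop where
  side : ∀ q ∈ P, h q ∈ P
  fixed_or_side : ∀ q ∈ n, h q = q ∨ h q ∈ P
  reflects : ∀ q, q ∈ n ∨ q ∈ P → h q ∈ m → q ∈ m
  crossing : ∀ q, q ∈ F ∨ q ∈ m ∧ q ∈ P →
    (h q ∈ F ∨ h q ∈ m ∧ h q ∈ P) ∧ ∀ᶠ q' in 𝓝 q, (h q' ∈ m ↔ q' ∈ m)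
  off : ∀ q ∈ n, q ∈ m → q ∉ F → h q = q ∨ h q ∉ m
  left : ∀ q, h q ∈ C₁ ↔ q ∈ C₁
  right : ∀ q, h q ∈ C₂ ↔ q ∈ C₂

theorem IsPush.refl (n P m F C₁ C₂ : Set S) : IsPush n P m F C₁ C₂ (Homeomorph.refl S) where
  side _ h := h
  fixed_or_side _ _ := Or.inl rfl
  reflects _ _ h := h
  crossing _ h := ⟨h, Eventually.of_forall fun _ => Iff.rfl⟩
  off _ _ _ _ := Or.inl rfl
  left _ := Iff.rfl
  right _ := Iff.rfl

/-- The conditions of `IsPush` are made to survive composition. After one push a point of `n` is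
either unmoved or in `P`, which is why `reflects` and `crossing` also speak of points of `P`: a
later push must not carry them onto `m`, and a crossing that has left `n` along `m` must still be
followed. -/
theorem IsPush.trans {n P m F C₁ C₂ : Set S} {h k : S ≃ₜ S} (hh : IsPush n P m F C₁ C₂ h)
    (hk : IsPush n P m F C₁ C₂ k) : IsPush n P m F C₁ C₂ (h.trans k) where
  side q hq := hk.side _ (hh.side q hq)
  fixed_or_side q hq := by
    rcases hh.fixed_or_side q hq with h1 | h1
    · simpa [h1] using hk.fixed_or_side q hq
    · exact Or.inr (hk.side _ h1)
  reflects q hq hm := by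
    refine hh.reflects q hq (hk.reflects _ ?_ hm)
    rcases hq with hq | hq
    · rcases hh.fixed_or_side q hq with h1 | h1
      · exact Or.inl (h1.symm ▸ hq)
      · exact Or.inr h1
    · exact Or.inr (hh.side q hq)
  crossing q hq := by
    obtain ⟨h1, h2⟩ := hh.crossing q hq
    obtain ⟨h3, h4⟩ := hk.crossing _ h1
    refine ⟨h3, ?_⟩
    filter_upwards [h2, h.continuous.continuousAt.eventually h4] with q' h5 h6
    exact h6.trans h5
  off q hq hqm hqF := by
    rcases hh.off q hq hqm hqF with h1 | h1
    · simpa [h1] using hk.off q hq hqm hqF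
    · refine Or.inr fun hcon => h1 (hk.reflects _ ?_ hcon)
      rcases hh.fixed_or_side q hq with h2 | h2
      · exact Or.inl (h2.symm ▸ hq)
      · exact Or.inr h2
  left q := (hk.left _).trans (hh.left q)
  right q := (hk.right _).trans (hh.right q)

/-- A chart around `p ∈ n` in which `n` is horizontal, the side `P` is the upper side, `C₁`, `C₂`
are vertical, and `m` either stays below `n` or is the vertical line through `p`. -/
structure IsPushChart (n P m F C₁ C₂ : Set S) (e : OpenPartialHomeomorph S HalfPlane) (p : S) :
    Prop where
  mem : p ∈ e.source
  arc : ∀ q ∈ e.source, q ∈ n ↔ (e q).1 1 = 0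
  side : ∀ q ∈ e.source, q ∈ P ↔ 0 < (e q).1 1
  left : ∀ q ∈ e.source, ∀ q' ∈ e.source, (e q).1 0 = (e q').1 0 → (q ∈ C₁ ↔ q' ∈ C₁)
  right : ∀ q ∈ e.source, ∀ q' ∈ e.source, (e q).1 0 = (e q').1 0 → (q ∈ C₂ ↔ q' ∈ C₂)
  cross : (Disjoint e.source F ∧ ∀ q ∈ e.source, q ∈ m → (e q).1 1 ≤ 0) ∨
    (p ∈ F ∧ ∀ q ∈ e.source, q ∈ m ↔ (e q).1 0 = (e p).1 0)

variable [CompactSpace S] [T2Space S]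

/-- The push moves points up along vertical lines of the chart. If `m` stays below `n`, a point of
`n` that moves leaves `m`; if `m` is a vertical line, it is preserved. Membership in `C₁` and `C₂`
depends only on the horizontal coordinate, which does not change. -/
theorem IsPushChart.exists_isPush {n P m F C₁ C₂ : Set S}
    {e : OpenPartialHomeomorph S HalfPlane} {p : S} (he : IsPushChart n P m F C₁ C₂ e p)
    (hp : p ∈ n) (hF : F ⊆ n) (hFm : F ⊆ m) :
    ∃ h, IsPush n P m F C₁ C₂ h ∧ ∀ᶠ q in 𝓝 p, q ∈ n → h q ∈ P := by
  have hp1 := (he.arc p he.mem).1 hp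
  obtain ⟨h, h1, ⟨L, hLe, hL, hid⟩, h2⟩ := e.exists_push he.mem hp1
  have hfix : ∀ q ∉ e.source, h q = q := fun q hq => hid q fun h => hq (hLe h)
  have hside : ∀ q ∈ P, h q ∈ P := by
    intro q hq
    by_cases hs : q ∈ e.source
    · exact (he.side _ (h1 q hs).1).2 (((he.side q hs).1 hq).trans_le (h1 q hs).2.2)
    · rwa [hfix q hs]
  have hlevel : ∀ q ∈ e.source, (e (h q)).1 1 ≤ (e q).1 1 → h q = q := by
    intro q hs hle
    exact e.injOn (h1 q hs).1 hs (HalfPlane.ext (h1 q hs).2.1 (le_antisymm hle (h1 q hs).2.2))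
  have hfs : ∀ q ∈ n, h q = q ∨ h q ∈ P := by
    intro q hq
    by_cases hs : q ∈ e.source
    · by_cases hle : (e (h q)).1 1 ≤ (e q).1 1
      · exact Or.inl (hlevel q hs hle)
      · refine Or.inr ((he.side _ (h1 q hs).1).2 ?_)
        rw [(he.arc q hs).1 hq] at hle
        exact not_le.1 hle
    · exact Or.inl (hfix q hs)
  refine ⟨h, ⟨hside, hfs, ?_, ?_, ?_, ?_, ?_⟩, ?_⟩
  · intro q hq hm
    by_cases hs : q ∈ e.source
    · rcases he.cross with ⟨_, h3⟩ | ⟨_, h3⟩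
      · have h4 := h3 _ (h1 q hs).1 hm
        have h5 : 0 ≤ (e q).1 1 := hq.elim (fun hq => ((he.arc q hs).1 hq).ge)
          fun hq => ((he.side q hs).1 hq).le
        rwa [hlevel q hs (h4.trans h5)] at hm
      · rwa [h3 q hs, ← (h1 q hs).2.1, ← h3 _ (h1 q hs).1]
    · rwa [hfix q hs] at hm
  · intro q hq
    by_cases hs : q ∈ e.source
    · rcases he.cross with ⟨h4, h3⟩ | ⟨_, h3⟩
      · rcases hq with hq | hq
        · exact absurd hq (disjoint_left.1 h4 hs)
        · exact absurd ((he.side q hs).1 hq.2) (not_lt.2 (h3 q hs hq.1))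
      · have h5 : ∀ q ∈ e.source, h q ∈ m ↔ q ∈ m := fun q hs => by
          rw [h3 q hs, ← (h1 q hs).2.1, ← h3 _ (h1 q hs).1]
        refine ⟨?_, ?_⟩
        · rcases hq with hq | hq
          · rcases hfs q (hF hq) with h6 | h6
            · exact Or.inl (h6.symm ▸ hq)
            · exact Or.inr ⟨(h5 q hs).2 (hFm hq), h6⟩
          · exact Or.inr ⟨(h5 q hs).2 hq.1, hside q hq.2⟩
        · filter_upwards [e.open_source.mem_nhds hs] with q' hq'
          exact h5 q' hq'
    · rw [hfix q hs]
      refine ⟨hq, ?_⟩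
      filter_upwards [hL.isOpen_compl.mem_nhds (fun h => hs (hLe h))] with q' hq'
      rw [hid q' hq']
  · intro q hq hqm hqF
    by_cases hs : q ∈ e.source
    · rcases he.cross with ⟨_, h3⟩ | ⟨h4, h3⟩
      · refine (hfs q hq).imp_right fun h5 h6 => ?_
        exact absurd ((he.side _ (h1 q hs).1).1 h5) (not_lt.2 (h3 _ (h1 q hs).1 h6))
      · have : q = p := e.injOn hs he.mem
          (HalfPlane.ext ((h3 q hs).1 hqm) (((he.arc q hs).1 hq).trans hp1.symm))
        exact absurd h4 (this ▸ hqF)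
    · exact Or.inl (hfix q hs)
  · intro q
    by_cases hs : q ∈ e.source
    · exact he.left _ (h1 q hs).1 _ hs (h1 q hs).2.1
    · rw [hfix q hs]
  · intro q
    by_cases hs : q ∈ e.source
    · exact he.right _ (h1 q hs).1 _ hs (h1 q hs).2.1
    · rw [hfix q hs]
  · filter_upwards [h2, e.open_source.mem_nhds he.mem] with q hq hs hn
    exact (he.side _ (h1 q hs).1).2 (hq ((he.arc q hs).1 hn))

/-- A compact set with push charts at all of its points can be pushed off itself. -/
theorem exists_isPush {n P m F C₁ C₂ : Set S} (hn : IsCompact n) (hF : F ⊆ n)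
    (hFm : F ⊆ m)
    (hch : ∀ p ∈ n, ∃ e, IsPushChart n P m F C₁ C₂ e p) :
    ∃ h, IsPush n P m F C₁ C₂ h ∧ ∀ q ∈ n, h q ∈ P := by
  -- Compactness induction: local pushes are composed, and points that have reached `P` stay there
  -- by `side`.
  refine hn.induction_on (p := fun s => ∃ h, IsPush n P m F C₁ C₂ h ∧ ∀ q ∈ s, q ∈ n → h q ∈ P)
    ⟨_, IsPush.refl _ _ _ _ _ _, fun q hq => hq.elim⟩ ?_ ?_ ?_ |>.imp fun h hh =>
      ⟨hh.1, fun q hq => hh.2 q hq hq⟩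
  · rintro s t hst ⟨h, h1, h2⟩
    exact ⟨h, h1, fun q hq => h2 q (hst hq)⟩
  · rintro s t ⟨h, h1, h2⟩ ⟨k, k1, k2⟩
    refine ⟨h.trans k, h1.trans k1, ?_⟩
    rintro q (hq | hq) hqn
    · exact k1.side _ (h2 q hq hqn)
    · rcases h1.fixed_or_side q hqn with h3 | h3
      · simpa [h3] using k2 q hq hqn
      · exact k1.side _ h3
  · intro p hp
    obtain ⟨e, he⟩ := hch p hp
    obtain ⟨h, h1, h2⟩ := he.exists_isPush hp hF hFm
    exact ⟨_, mem_nhdsWithin_of_mem_nhds h2, h, h1, fun q hq => hq⟩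

end Push

/-! ### Sides of an arc -/

section Sides

variable {S : Type*} [TopologicalSpace S]

/-- Near `p`, the set `P` is one of the two sides of `n`. -/
def IsSideAt (n P : Set S) (p : S) : Prop :=
  ∃ e : OpenPartialHomeomorph S HalfPlane, p ∈ e.source ∧
    ∀ q ∈ e.source, (q ∈ n ↔ (e q).1 1 = 0) ∧ (q ∈ P ↔ 0 < (e q).1 1)

/-- The reflection of the half-plane in the horizontal axis. -/
noncomputable def HalfPlane.flip : HalfPlane ≃ₜ HalfPlane where
  toFun x := ⟨!₂[x.1 0, -x.1 1], by simpa using x.2⟩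
  invFun x := ⟨!₂[x.1 0, -x.1 1], by simpa using x.2⟩
  left_inv x := HalfPlane.ext (by simp) (by simp)
  right_inv x := HalfPlane.ext (by simp) (by simp)
  continuous_toFun := by
    refine Continuous.subtype_mk ((PiLp.continuous_toLp 2 _).comp (continuous_pi fun i => ?_)) _
    fin_cases i <;> simp <;> fun_prop
  continuous_invFun := by
    refine Continuous.subtype_mk ((PiLp.continuous_toLp 2 _).comp (continuous_pi fun i => ?_)) _
    fin_cases i <;> simp <;> fun_prop

@[simp] theorem HalfPlane.flip_zero (x : HalfPlane) : (HalfPlane.flip x).1 0 = x.1 0 := by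
  simp [HalfPlane.flip]

@[simp] theorem HalfPlane.flip_one (x : HalfPlane) : (HalfPlane.flip x).1 1 = -x.1 1 := by
  simp [HalfPlane.flip]

/-- The box is convex, and the sign of `b` selects its upper or its lower half. -/
theorem HalfPlane.isPreconnected_upper (a b r : ℝ) :
    IsPreconnected {x : HalfPlane | |x.1 0 - a| ≤ r ∧ |x.1 1| ≤ r ∧ 0 < b * x.1 1} := by
  have hc : Convex ℝ {x : Plane | 0 ≤ x 0 ∧ |x 0 - a| ≤ r ∧ |x 1| ≤ r ∧ 0 < b * x 1} := by
    rintro x ⟨h0, h1, h2, h3⟩ y ⟨k0, k1, k2, k3⟩ s t hs ht hst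
    rw [abs_le] at h1 h2 k1 k2
    simp only [mem_ofPred_eq, PiLp.add_apply, PiLp.smul_apply, smul_eq_mul, abs_le]
    obtain rfl : s = 1 - t := by linarith
    refine ⟨by positivity, ⟨by nlinarith, by nlinarith⟩, ⟨by nlinarith, by nlinarith⟩, ?_⟩
    rcases ht.eq_or_lt with rfl | ht
    · simpa using h3
    · nlinarith [mul_pos ht k3, mul_nonneg hs h3.le]
  rw [← IsInducing.isPreconnected_image (f := fun x : HalfPlane => x.1) IsInducing.subtypeVal]
  convert hc.isPreconnected using 1
  ext x
  constructor
  · rintro ⟨y, hy, rfl⟩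
    exact ⟨y.2, hy⟩
  · rintro ⟨h0, hx⟩
    exact ⟨⟨x, h0⟩, hx, rfl⟩

theorem IsSideAt.congr {n P P' : Set S} {p : S} (h : IsSideAt n P p)
    (h' : ∀ᶠ q in 𝓝 p, (q ∈ P' ↔ q ∈ P)) : IsSideAt n P' p := by
  obtain ⟨e, hp, he⟩ := h
  obtain ⟨U, hU, hUo, hpU⟩ := eventually_nhds_iff.1 h'
  refine ⟨e.restrOpen U hUo, ⟨hp, hpU⟩, fun q hq =>
    ⟨(he q hq.1).1, (hU q hq.2).trans (he q hq.1).2⟩⟩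

theorem IsSideAt.compl {n P : Set S} {p : S} (h : IsSideAt n P p) : IsSideAt n (P ∪ n)ᶜ p := by
  obtain ⟨e, hp, he⟩ := h
  refine ⟨e.trans HalfPlane.flip.toOpenPartialHomeomorph, by simpa using hp, fun q hq => ?_⟩
  have hq : q ∈ e.source := by simpa using hq
  obtain ⟨h1, h2⟩ := he q hq
  simp only [mem_compl_iff, mem_union, h1, h2, OpenPartialHomeomorph.coe_trans,
    Function.comp_apply, Homeomorph.toOpenPartialHomeomorph_apply, HalfPlane.flip_one, neg_eq_zero,
    neg_pos, true_and]
  grind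

theorem IsSideAt.exists_mem {n P : Set S} {p : S} (h : IsSideAt n P p) (hp : p ∈ n)
    {W : Set S} (hW : W ∈ 𝓝 p) : ∃ q ∈ W, q ∈ P := by
  obtain ⟨e, hpe, he⟩ := h
  have h1 : Tendsto e.symm (𝓝 (e p)) (𝓝 p) := by
    simpa [ContinuousAt, e.left_inv hpe] using e.symm.continuousAt (e.map_source hpe)
  obtain ⟨r, hr, hbox⟩ := HalfPlane.exists_box
    (inter_mem (h1 hW) (e.open_target.mem_nhds (e.map_source hpe)))
  have h0 := (he p hpe).1.1 hp
  obtain ⟨h2, h3⟩ := hbox ⟨!₂[(e p).1 0, r], by simpa using (e p).2⟩ (by simpa using hr.le)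
    (by simp [h0, abs_of_pos hr])
  exact ⟨_, h2, (he _ (e.map_target h3)).2.2 (by rw [e.right_inv h3]; simpa using hr)⟩

theorem IsSideAt.subset_or_disjoint {n P A : Set S} {e : OpenPartialHomeomorph S HalfPlane}
    (he : ∀ q ∈ e.source, (q ∈ n ↔ (e q).1 1 = 0) ∧ (q ∈ P ↔ 0 < (e q).1 1))
    (hA : IsPreconnected A) (hAe : A ⊆ e.source) (hAn : ∀ q ∈ A, q ∉ n) :
    (∀ q ∈ A, q ∈ P) ∨ (∀ q ∈ A, q ∉ P) := by
  have hopen : ∀ V : Set ℝ, IsOpen V → IsOpen (e.source ∩ e ⁻¹' {x | x.1 1 ∈ V}) := fun V hV =>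
    e.isOpen_inter_preimage (hV.preimage (by fun_prop : Continuous fun x : HalfPlane => x.1 1))
  refine (hA.subset_or_subset (hopen (Ioi 0) isOpen_Ioi)
    (hopen (Iio 0) isOpen_Iio) ?_ ?_).imp ?_ ?_
  · rw [disjoint_left]
    rintro q ⟨_, h1⟩ ⟨_, h2⟩
    exact lt_asymm (show 0 < (e q).1 1 from h1) h2
  · intro q hq
    rcases lt_trichotomy ((e q).1 1) 0 with h | h | h
    · exact Or.inr ⟨hAe hq, h⟩
    · exact absurd ((he q (hAe hq)).1.2 h) (hAn q hq)
    · exact Or.inl ⟨hAe hq, h⟩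
  · exact fun h q hq => (he q (hAe hq)).2.2 (h hq).2
  · exact fun h q hq hP => lt_asymm ((he q (hAe hq)).2.1 hP) (h hq).2

/-- Compares a side with the two sides given by a chart. -/
theorem IsSideAt.align {n P : Set S} {p : S} (h : IsSideAt n P p) (hp : p ∈ n)
    {e : OpenPartialHomeomorph S HalfPlane} (hpe : p ∈ e.source)
    (he : ∀ q ∈ e.source, q ∈ n ↔ (e q).1 1 = 0) :
    (∀ᶠ q in 𝓝 p, q ∈ P ↔ 0 < (e q).1 1) ∨ (∀ᶠ q in 𝓝 p, q ∈ P ↔ (e q).1 1 < 0) := by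
  have hin := fun {W : Set S} => h.exists_mem hp (W := W)
  have hout := fun {W : Set S} => h.compl.exists_mem hp (W := W)
  obtain ⟨f, hpf, hf⟩ := h
  have h1 : Tendsto e.symm (𝓝 (e p)) (𝓝 p) := by
    simpa [ContinuousAt, e.left_inv hpe] using e.symm.continuousAt (e.map_source hpe)
  obtain ⟨r, hr, hbox⟩ := HalfPlane.exists_box
    (inter_mem (h1 (f.open_source.mem_nhds hpf)) (e.open_target.mem_nhds (e.map_source hpe)))
  have hp1 := (he p hpe).1 hp
  rw [hp1] at hbox
  simp only [sub_zero] at hbox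
  have hnear : ∀ᶠ q in 𝓝 p, q ∈ e.source ∧ |(e q).1 0 - (e p).1 0| ≤ r ∧ |(e q).1 1| ≤ r := by
    have hc : ∀ i, ContinuousAt (fun q => (e q).1 i) p := fun i =>
      (by fun_prop : Continuous fun x : HalfPlane => x.1 i).continuousAt.comp (e.continuousAt hpe)
    have h2 := ((hc 0).sub_const ((e p).1 0)).abs.eventually (gt_mem_nhds (by simpa using hr))
    have h3 := (hc 1).abs.eventually (gt_mem_nhds (by simpa [hp1] using hr))
    filter_upwards [h2, h3, e.open_source.mem_nhds hpe] with q h4 h5 h6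
    exact ⟨h6, h4.le, h5.le⟩
  have hside : ∀ b : ℝ, b ≠ 0 →
      (∀ q ∈ e.source, |(e q).1 0 - (e p).1 0| ≤ r → |(e q).1 1| ≤ r → 0 < b * (e q).1 1 → q ∈ P) ∨
      (∀ q ∈ e.source, |(e q).1 0 - (e p).1 0| ≤ r → |(e q).1 1| ≤ r → 0 < b * (e q).1 1 →
        q ∉ P) := by
    intro b hb
    have h2 : ∀ x ∈ {x : HalfPlane | |x.1 0 - (e p).1 0| ≤ r ∧ |x.1 1| ≤ r ∧ 0 < b * x.1 1},
        e.symm x ∈ f.source ∧ x ∈ e.target := fun x hx => hbox x hx.1 hx.2.1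
    have h3 := (HalfPlane.isPreconnected_upper ((e p).1 0) b r).image e.symm
      (e.continuousOn_symm.mono fun x hx => (h2 x hx).2)
    refine (IsSideAt.subset_or_disjoint hf h3 ?_ ?_).imp ?_ ?_
    · rintro _ ⟨x, hx, rfl⟩
      exact (h2 x hx).1
    · rintro _ ⟨x, hx, rfl⟩ hn
      rw [he _ (e.map_target (h2 x hx).2), e.right_inv (h2 x hx).2] at hn
      have := hx.2.2
      simp [hn] at this
    · exact fun h4 q hq k1 k2 k3 => h4 q ⟨e q, ⟨k1, k2, k3⟩, e.left_inv hq⟩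
    · exact fun h4 q hq k1 k2 k3 => h4 q ⟨e q, ⟨k1, k2, k3⟩, e.left_inv hq⟩
  have hnP : ∀ q ∈ f.source, q ∈ n → q ∉ P := fun q hq hn hP =>
    ((hf q hq).2.1 hP).ne' ((hf q hq).1.1 hn)
  have hnear' := hnear.and (f.open_source.mem_nhds hpf)
  -- The first and the last of the four combinations are impossible: both halves cannot lie in `P`,
  -- because the opposite side also accumulates at `p`, and both cannot miss `P`, because `P`
  -- accumulates at `p`.
  rcases hside 1 one_ne_zero with hu | hu <;> rcases hside (-1) (by norm_num) with hl | hl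
  · obtain ⟨q, ⟨⟨hqs, hq0, hq1⟩, hqf⟩, hq⟩ := hout hnear'
    exfalso
    refine hq (or_iff_not_imp_right.2 fun hn => ?_)
    rcases lt_trichotomy ((e q).1 1) 0 with h | h | h
    · exact hl q hqs hq0 hq1 (by linarith)
    · exact absurd ((he q hqs).2 h) hn
    · exact hu q hqs hq0 hq1 (by linarith)
  · left
    filter_upwards [hnear'] with q hq
    obtain ⟨⟨hqs, hq0, hq1⟩, hqf⟩ := hq
    refine ⟨fun hP => ?_, fun h => hu q hqs hq0 hq1 (by linarith)⟩
    rcases lt_trichotomy ((e q).1 1) 0 with h | h | h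
    · exact absurd hP (hl q hqs hq0 hq1 (by linarith))
    · exact absurd hP (hnP q hqf ((he q hqs).2 h))
    · exact h
  · right
    filter_upwards [hnear'] with q hq
    obtain ⟨⟨hqs, hq0, hq1⟩, hqf⟩ := hq
    refine ⟨fun hP => ?_, fun h => hl q hqs hq0 hq1 (by linarith)⟩
    rcases lt_trichotomy ((e q).1 1) 0 with h | h | h
    · exact h
    · exact absurd hP (hnP q hqf ((he q hqs).2 h))
    · exact absurd hP (hu q hqs hq0 hq1 (by linarith))
  · obtain ⟨q, ⟨⟨hqs, hq0, hq1⟩, hqf⟩, hq⟩ := hin hnear'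
    exfalso
    rcases lt_trichotomy ((e q).1 1) 0 with h | h | h
    · exact hl q hqs hq0 hq1 (by linarith) hq
    · exact hnP q hqf ((he q hqs).2 h) hq
    · exact hu q hqs hq0 hq1 (by linarith) hq

/-- The two sides of an arc can be told apart all along the arc. -/
theorem exists_isSideAt [T2Space S] {γ : unitInterval → S} (hγ : Continuous γ)
    (hinj : Function.Injective γ)
    (hflat : ∀ p ∈ range γ, ∃ e : OpenPartialHomeomorph S HalfPlane, p ∈ e.source ∧
      ∀ q ∈ e.source, q ∈ range γ ↔ (e q).1 1 = 0) :
    ∃ P, ∀ p ∈ range γ, IsSideAt (range γ) P p := by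
  choose e hpe he using fun s => hflat (γ s) (mem_range_self s)
  obtain ⟨t, ht0, htm, ⟨N, hN⟩, hcov⟩ := exists_monotone_Icc_subset_open_cover_unitInterval
    (ι := unitInterval) (c := fun s => γ ⁻¹' (e s).source)
    (fun s => (e s).open_source.preimage hγ)
    (fun s _ => mem_iUnion.2 ⟨s, hpe s⟩)
  -- The side is built along the initial segments `[0, t k]` of a subdivision each step of which
  -- lies in one chart.
  suffices H : ∀ k, ∃ P, ∀ s ≤ t k, IsSideAt (range γ) P (γ s) by
    obtain ⟨P, hP⟩ := H N
    refine ⟨P, ?_⟩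
    rintro _ ⟨s, rfl⟩
    exact hP s (by rw [hN N le_rfl]; exact s.2.2)
  have hchart : ∀ k, ∃ f : OpenPartialHomeomorph S HalfPlane,
      (∀ s ∈ Icc (t k) (t (k + 1)), γ s ∈ f.source) ∧
      ∀ q ∈ f.source, q ∈ range γ ↔ (f q).1 1 = 0 := fun k => by
    obtain ⟨i, hi⟩ := hcov k
    exact ⟨e i, fun s hs => hi hs, he i⟩
  intro k
  induction k with
  | zero =>
    obtain ⟨f, hf1, hf2⟩ := hchart 0
    refine ⟨{q | 0 < (f q).1 1}, fun s hs => ⟨f, hf1 s ?_, fun q hq => ⟨hf2 q hq, Iff.rfl⟩⟩⟩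
    have : s = t 0 := le_antisymm hs (by rw [ht0]; exact s.2.1)
    rw [this]
    exact ⟨le_rfl, htm (Nat.zero_le 1)⟩
  | succ k ih =>
    obtain ⟨P, hP⟩ := ih
    -- The next chart is reflected if necessary, so that its upper side agrees with `P` at the joint
    -- `γ (t k)`.
    obtain ⟨f, hf1, hf2⟩ : ∃ f : OpenPartialHomeomorph S HalfPlane,
        ((∀ s ∈ Icc (t k) (t (k + 1)), γ s ∈ f.source) ∧
        ∀ q ∈ f.source, q ∈ range γ ↔ (f q).1 1 = 0) ∧
        ∀ᶠ q in 𝓝 (γ (t k)), q ∈ P ↔ 0 < (f q).1 1 := by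
      obtain ⟨f, hf1, hf2⟩ := hchart k
      rcases (hP (t k) le_rfl).align (mem_range_self _) (hf1 _ ⟨le_rfl, htm k.le_succ⟩) hf2
        with h | h
      · exact ⟨f, ⟨hf1, hf2⟩, h⟩
      · refine ⟨f.trans HalfPlane.flip.toOpenPartialHomeomorph,
          ⟨by simpa using hf1, by simpa using hf2⟩, by simpa using h⟩
    obtain ⟨hf1, hf3⟩ := hf1
    obtain ⟨W, hW, hWo, hpW⟩ := eventually_nhds_iff.1 hf2
    have hcl : ∀ a b : unitInterval, IsCompact (γ '' Icc a b \ W) := fun a b =>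
      (isCompact_Icc.image hγ).diff hWo
    -- Outside the neighbourhood `W` of the joint, on which both choices agree, the old and the new
    -- stretch of the arc are disjoint compact sets and can be separated.
    obtain ⟨V₁, V₂, hV₁, hV₂, h1, h2, hV⟩ := SeparatedNhds.of_isCompact_isCompact
      (hcl 0 (t k)) (hcl (t k) (t (k + 1))) (by
        rw [disjoint_left]
        rintro _ ⟨⟨a, ha, rfl⟩, haW⟩ ⟨⟨b, hb, hab⟩, -⟩
        have : a = t k := le_antisymm ha.2 (hinj hab ▸ hb.1)
        exact haW (this ▸ hpW))
    -- The chart decides near the new stretch, the old side decides elsewhere.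
    refine ⟨{q | (q ∈ (V₂ ∪ W) ∩ f.source ∧ 0 < (f q).1 1) ∨
      (q ∉ (V₂ ∪ W) ∩ f.source ∧ q ∈ P)}, fun s hs => ?_⟩
    rcases le_total s (t k) with hsk | hsk
    · refine (hP s hsk).congr ?_
      have hmem : γ s ∈ V₁ ∪ W := or_iff_not_imp_right.2 fun h => h1 ⟨⟨s, ⟨s.2.1, hsk⟩, rfl⟩, h⟩
      filter_upwards [(hV₁.union hWo).mem_nhds hmem] with q hq
      by_cases hq2 : q ∈ (V₂ ∪ W) ∩ f.source
      · have hqW : q ∈ W := by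
          rcases hq with hq | hq
          · rcases hq2.1 with hq' | hq'
            · exact absurd hq' (disjoint_left.1 hV hq)
            · exact hq'
          · exact hq
        simp [hq2, hW q hqW]
      · simp [hq2]
    · have hmem : γ s ∈ (V₂ ∪ W) ∩ f.source :=
        ⟨or_iff_not_imp_right.2 fun h => h2 ⟨⟨s, ⟨hsk, hs⟩, rfl⟩, h⟩, hf1 s ⟨hsk, hs⟩⟩
      refine ⟨f.restrOpen _ (hV₂.union hWo), ⟨hmem.2, hmem.1⟩, fun q hq => ⟨hf3 q hq.1, ?_⟩⟩
      have hq' : q ∈ (V₂ ∪ W) ∩ f.source := ⟨hq.2, hq.1⟩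
      simp only [mem_ofPred_eq, hq', true_and, not_true, false_and, or_false]
      rfl

/-- The side of an arc that is the upper side in a given chart. -/
theorem exists_isSideAt_of_chart [T2Space S] {γ : unitInterval → S} (hγ : Continuous γ)
    (hinj : Function.Injective γ)
    (hflat : ∀ p ∈ range γ, ∃ e : OpenPartialHomeomorph S HalfPlane, p ∈ e.source ∧
      ∀ q ∈ e.source, q ∈ range γ ↔ (e q).1 1 = 0)
    {p : S} (hp : p ∈ range γ) {e : OpenPartialHomeomorph S HalfPlane} (hpe : p ∈ e.source)
    (he : ∀ q ∈ e.source, q ∈ range γ ↔ (e q).1 1 = 0) :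
    ∃ P, (∀ p ∈ range γ, IsSideAt (range γ) P p) ∧ ∀ᶠ q in 𝓝 p, q ∈ P ↔ 0 < (e q).1 1 := by
  obtain ⟨P, hP⟩ := exists_isSideAt hγ hinj hflat
  rcases (hP p hp).align hp hpe he with h | h
  · exact ⟨P, hP, h⟩
  · refine ⟨(P ∪ range γ)ᶜ, fun q hq => (hP q hq).compl, ?_⟩
    filter_upwards [h, e.open_source.mem_nhds hpe] with q hq hqe
    rw [mem_compl_iff, mem_union, hq, he q hqe]
    grind

end Sides

/-! ### Branches of arcs -/

section Branch

variable {S : Type*} [TopologicalSpace S] [T2Space S]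

/-- An arc that leaves the point `α t` inside the curve `L` with coordinate `w` covers one of the
two half-branches of `L`. -/
theorem exists_branch_right {α : ℝ → S} {t b : ℝ} (htb : t < b) (hc : ContinuousOn α (Icc t b))
    (hi : InjOn α (Icc t b)) {L O : Set S} {w : S → ℝ} (hO : IsOpen O) (hp : α t ∈ O)
    (hw : ContinuousOn w O) (hwi : InjOn w (L ∩ O)) (hw0 : w (α t) = 0)
    (hL : ∀ᶠ s in 𝓝[≥] t, α s ∈ L) :
    ∃ σ : ℝ, (σ = 1 ∨ σ = -1) ∧
      ∀ᶠ q in 𝓝 (α t), q ∈ α '' Icc t b ↔ q ∈ L ∧ 0 ≤ σ * w q := by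
  have hαO : ∀ᶠ s in 𝓝[≥] t, α s ∈ O := by
    have h1 := (hc t (left_mem_Icc.2 htb.le)).eventually (hO.mem_nhds hp)
    rwa [nhdsWithin_Icc_eq_nhdsGE htb] at h1
  obtain ⟨u, htu, hu⟩ := mem_nhdsGE_iff_exists_Icc_subset.1 (hL.and hαO)
  set v := min u b with hv
  have htv : t < v := lt_min htu htb
  have hvb : v ≤ b := min_le_right _ _
  have hsub : Icc t v ⊆ Icc t b := Icc_subset_Icc_right hvb
  have hLO : ∀ s ∈ Icc t v, α s ∈ L ∧ α s ∈ O := fun s hs => hu ⟨hs.1, hs.2.trans (min_le_left _ _)⟩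
  have hgc : ContinuousOn (fun s => w (α s)) (Icc t v) :=
    hw.comp (hc.mono hsub) fun s hs => (hLO s hs).2
  have hgi : InjOn (fun s => w (α s)) (Icc t v) := fun x hx y hy hxy =>
    hi (hsub hx) (hsub hy) (hwi (hLO x hx) (hLO y hy) hxy)
  -- The coordinate `w` is injective along `α` near `t`, hence strictly monotone; `σ` records the
  -- direction.
  obtain ⟨σ, hσ, hmono⟩ : ∃ σ : ℝ, (σ = 1 ∨ σ = -1) ∧
      StrictMonoOn (fun s => σ * w (α s)) (Icc t v) := by
    rcases hgc.strictMonoOn_of_injOn_Icc' htv.le hgi with h | h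
    · exact ⟨1, Or.inl rfl, by simpa using h⟩
    · exact ⟨-1, Or.inr rfl, by simpa using h.neg⟩
  have hσ0 : σ ≠ 0 := by rcases hσ with rfl | rfl <;> norm_num
  have htv' : t ∈ Icc t v := left_mem_Icc.2 htv.le
  have hvv' : v ∈ Icc t v := right_mem_Icc.2 htv.le
  have hpos : 0 < σ * w (α v) := by
    simpa [hw0] using hmono htv' hvv' htv
  refine ⟨σ, hσ, ?_⟩
  -- The rest of the arc is compact and misses `α t`, so it does not come back near this point.
  have hcl : IsClosed (α '' Icc v b) :=
    (isCompact_Icc.image_of_continuousOn (hc.mono (Icc_subset_Icc_left htv.le))).isClosed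
  have hpn : α t ∉ α '' Icc v b := by
    rintro ⟨s, hs, hst⟩
    have := hi ⟨htv.le.trans hs.1, hs.2⟩ (left_mem_Icc.2 htb.le) hst
    linarith [hs.1]
  have hwlt : ∀ᶠ q in 𝓝 (α t), σ * w q < σ * w (α v) := by
    have h1 : ContinuousAt (fun q => σ * w q) (α t) :=
      continuousAt_const.mul (hw.continuousAt (hO.mem_nhds hp))
    exact h1.eventually (gt_mem_nhds (by simpa [hw0] using hpos))
  filter_upwards [hO.mem_nhds hp, hcl.isOpen_compl.mem_nhds hpn, hwlt] with q hqO hqn hqw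
  constructor
  · rintro ⟨s, hs, rfl⟩
    have hsv : s < v := by
      by_contra hcon
      exact hqn ⟨s, ⟨not_lt.1 hcon, hs.2⟩, rfl⟩
    have hs' : s ∈ Icc t v := ⟨hs.1, hsv.le⟩
    refine ⟨(hLO s hs').1, ?_⟩
    simpa [hw0] using hmono.monotoneOn htv' hs' hs.1
  · rintro ⟨hqL, hq0⟩
    -- The intermediate value theorem shows that the whole half-branch near `α t` is covered.
    obtain ⟨s, hs, hsq⟩ := intermediate_value_Icc htv.le (continuousOn_const.mul hgc)
      (show σ * w q ∈ Icc (σ * w (α t)) (σ * w (α v)) from ⟨by simpa [hw0] using hq0, hqw.le⟩)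
    exact ⟨s, hsub hs, hwi (hLO s hs) ⟨hqL, hqO⟩ (mul_left_cancel₀ hσ0 hsq)⟩

/-- `exists_branch_right` with time reversed. -/
theorem exists_branch_left {α : ℝ → S} {a t : ℝ} (hat : a < t) (hc : ContinuousOn α (Icc a t))
    (hi : InjOn α (Icc a t)) {L O : Set S} {w : S → ℝ} (hO : IsOpen O) (hp : α t ∈ O)
    (hw : ContinuousOn w O) (hwi : InjOn w (L ∩ O)) (hw0 : w (α t) = 0)
    (hL : ∀ᶠ s in 𝓝[≤] t, α s ∈ L) :
    ∃ σ : ℝ, (σ = 1 ∨ σ = -1) ∧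
      ∀ᶠ q in 𝓝 (α t), q ∈ α '' Icc a t ↔ q ∈ L ∧ 0 ≤ σ * w q := by
  have hmaps : MapsTo (fun s : ℝ => -s) (Icc (-t) (-a)) (Icc a t) := fun s hs =>
    ⟨by linarith [hs.2], by linarith [hs.1]⟩
  have h := exists_branch_right (α := fun s => α (-s)) (t := -t) (b := -a) (by linarith)
    (hc.comp continuousOn_neg hmaps) (hi.comp neg_injective.injOn hmaps) hO (by simpa using hp)
    hw hwi (by simpa using hw0) (L := L) (by
      have : Tendsto (fun s : ℝ => -s) (𝓝[≥] (-t)) (𝓝[≤] t) := by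
        refine tendsto_nhdsWithin_of_tendsto_nhds_of_eventually_within _ ?_ ?_
        · simpa using ((continuous_neg (G := ℝ)).tendsto (-t)).mono_left nhdsWithin_le_nhds
        · filter_upwards [self_mem_nhdsWithin] with s hs
          exact neg_le.1 (mem_Ici.1 hs)
      exact this.eventually hL)
  have himg : (fun s => α (-s)) '' Icc (-t) (-a) = α '' Icc a t := by
    rw [← Function.comp_def, image_comp, image_neg_Icc]; simp
  simpa only [himg, neg_neg] using h

/-- Around an interior point, an arc made of pieces of two curves is the union of two
half-branches. -/
theorem exists_two_branches {α : ℝ → S} {a t b : ℝ} (hat : a < t) (htb : t < b)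
    (hc : ContinuousOn α (Icc a b)) (hi : InjOn α (Icc a b)) {L M O : Set S} {w u : S → ℝ}
    (hO : IsOpen O) (hp : α t ∈ O) (hw : ContinuousOn w O) (hwi : InjOn w (L ∩ O))
    (hw0 : w (α t) = 0) (hu : ContinuousOn u O) (hui : InjOn u (M ∩ O)) (hu0 : u (α t) = 0)
    (hL : ∀ᶠ s in 𝓝[≤] t, α s ∈ L) (hM : ∀ᶠ s in 𝓝[≥] t, α s ∈ M) :
    ∃ σ τ : ℝ, (σ = 1 ∨ σ = -1) ∧ (τ = 1 ∨ τ = -1) ∧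
      ∀ᶠ q in 𝓝 (α t), q ∈ α '' Icc a b ↔ (q ∈ L ∧ 0 ≤ σ * w q) ∨ (q ∈ M ∧ 0 ≤ τ * u q) := by
  obtain ⟨σ, hσ, h1⟩ := exists_branch_left hat (hc.mono (Icc_subset_Icc_right htb.le))
    (hi.mono (Icc_subset_Icc_right htb.le)) hO hp hw hwi hw0 hL
  obtain ⟨τ, hτ, h2⟩ := exists_branch_right htb (hc.mono (Icc_subset_Icc_left hat.le))
    (hi.mono (Icc_subset_Icc_left hat.le)) hO hp hu hui hu0 hM
  refine ⟨σ, τ, hσ, hτ, ?_⟩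
  filter_upwards [h1, h2] with q h1 h2
  rw [← h1, ← h2, ← mem_union, ← image_union, Icc_union_Icc_eq_Icc hat.le htb.le]

/-- An arc that stays on one curve near a point coincides with this curve there. -/
theorem eventually_mem_iff_of_same_curve {α : ℝ → S} {a t b : ℝ} (hat : a < t) (htb : t < b)
    (hc : ContinuousOn α (Icc a b)) (hi : InjOn α (Icc a b)) {L O : Set S} {w : S → ℝ}
    (hO : IsOpen O) (hp : α t ∈ O) (hw : ContinuousOn w O) (hwi : InjOn w (L ∩ O))
    (hw0 : w (α t) = 0)
    (hL : ∀ᶠ s in 𝓝[≤] t, α s ∈ L) (hM : ∀ᶠ s in 𝓝[≥] t, α s ∈ L) :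
    ∀ᶠ q in 𝓝 (α t), q ∈ α '' Icc a b ↔ q ∈ L := by
  have hic1 := hi.mono (Icc_subset_Icc_right htb.le)
  have hic2 := hi.mono (Icc_subset_Icc_left hat.le)
  obtain ⟨σ, hσ, h1⟩ := exists_branch_left hat (hc.mono (Icc_subset_Icc_right htb.le))
    hic1 hO hp hw hwi hw0 hL
  obtain ⟨τ, hτ, h2⟩ := exists_branch_right htb (hc.mono (Icc_subset_Icc_left hat.le))
    hic2 hO hp hw hwi hw0 hM
  -- If both pieces covered the same half-branch, the arc would run back over itself, against
  -- injectivity.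
  have hne : σ ≠ τ := by
    intro hστ
    have hαt : ContinuousWithinAt α (Ioc t b) t := (hc t ⟨hat.le, htb.le⟩).mono fun s hs =>
      ⟨hat.le.trans hs.1.le, hs.2⟩
    have h3 : ∀ᶠ s in 𝓝[Ioc t b] t, α s ∈ α '' Icc a t := by
      filter_upwards [hαt.eventually h1, hαt.eventually h2, self_mem_nhdsWithin] with s h4 h5 hs
      rw [h4, hστ, ← h5]
      exact ⟨s, ⟨hs.1.le, hs.2⟩, rfl⟩
    have : (𝓝[Ioc t b] t).NeBot := by
      rw [nhdsWithin_Ioc_eq_nhdsGT htb]; infer_instance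
    obtain ⟨s, ⟨s', hs', hss'⟩, hs⟩ := (h3.and self_mem_nhdsWithin).exists
    have := hi ⟨hs'.1, hs'.2.trans htb.le⟩ ⟨hat.le.trans hs.1.le, hs.2⟩ hss'
    linarith [hs.1, hs'.2]
  filter_upwards [h1, h2] with q h1 h2
  rw [← Icc_union_Icc_eq_Icc hat.le htb.le, image_union, mem_union, h1, h2, ← and_or_left]
  refine ⟨fun h => h.1, fun h => ⟨h, ?_⟩⟩
  rcases hσ with rfl | rfl <;> rcases hτ with rfl | rfl
  · exact absurd rfl hne
  · rcases le_total 0 (w q) with h | h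
    · left; linarith
    · right; linarith
  · rcases le_total 0 (w q) with h | h
    · right; linarith
    · left; linarith
  · exact absurd rfl hne

end Branch

/-! ### Joining arcs -/

section Join

variable {S : Type*}

/-- Follow `α` up to time `s`, and then `β` from time `t` on. -/
noncomputable def arcJoin (α β : ℝ → S) (s t : ℝ) (x : ℝ) : S :=
  if x ≤ s then α x else β (x - s + t)

theorem arcJoin_of_le {α β : ℝ → S} {s t x : ℝ} (h : x ≤ s) : arcJoin α β s t x = α x := if_pos h

theorem arcJoin_of_ge {α β : ℝ → S} {s t x : ℝ} (hst : α s = β t) (h : s ≤ x) :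
    arcJoin α β s t x = β (x - s + t) := by
  rcases h.eq_or_lt with rfl | h
  · simp [arcJoin, hst]
  · exact if_neg (not_le.2 h)

theorem arcJoin_continuousOn [TopologicalSpace S] {α β : ℝ → S} {a s t b : ℝ} (has : a ≤ s)
    (htb : t ≤ b)
    (hst : α s = β t) (hα : ContinuousOn α (Icc a s)) (hβ : ContinuousOn β (Icc t b)) :
    ContinuousOn (arcJoin α β s t) (Icc a (s + (b - t))) := by
  rw [← Icc_union_Icc_eq_Icc has (by linarith : s ≤ s + (b - t))]
  refine ContinuousOn.union_of_isClosed (hα.congr fun x hx => arcJoin_of_le hx.2) ?_ isClosed_Icc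
    isClosed_Icc
  refine ContinuousOn.congr (f := fun x => β (x - s + t)) ?_ fun x hx => arcJoin_of_ge hst hx.1
  exact hβ.comp (by fun_prop) fun x hx => ⟨by linarith [hx.1], by linarith [hx.2]⟩

theorem arcJoin_image {α β : ℝ → S} {a s t b : ℝ} (has : a ≤ s) (htb : t ≤ b) (hst : α s = β t) :
    arcJoin α β s t '' Icc a (s + (b - t)) = α '' Icc a s ∪ β '' Icc t b := by
  rw [← Icc_union_Icc_eq_Icc has (by linarith : s ≤ s + (b - t)), image_union]
  congr 1
  · exact image_congr fun x hx => arcJoin_of_le hx.2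
  · ext q
    constructor
    · rintro ⟨x, hx, rfl⟩
      exact ⟨x - s + t, ⟨by linarith [hx.1], by linarith [hx.2]⟩, (arcJoin_of_ge hst hx.1).symm⟩
    · rintro ⟨x, hx, rfl⟩
      refine ⟨x - t + s, ⟨by linarith [hx.1], by linarith [hx.2]⟩, ?_⟩
      rw [arcJoin_of_ge hst (by linarith [hx.1])]
      congr 1; ring

/-- The half-open interval leaves out the time `t`, at which `β` takes over from `α`; there the two
may agree. -/
theorem arcJoin_injOn {α β : ℝ → S} {a s t b : ℝ} (hα : InjOn α (Icc a s))
    (hβ : InjOn β (Icc t b)) (hαβ : ∀ x ∈ Icc a s, ∀ y ∈ Ioc t b, α x ≠ β y) :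
    InjOn (arcJoin α β s t) (Icc a (s + (b - t))) := by
  intro x hx y hy hxy
  rcases le_or_gt x s with hxs | hxs <;> rcases le_or_gt y s with hys | hys
  · rw [arcJoin_of_le hxs, arcJoin_of_le hys] at hxy
    exact hα ⟨hx.1, hxs⟩ ⟨hy.1, hys⟩ hxy
  · rw [arcJoin_of_le hxs, arcJoin, if_neg (not_le.2 hys)] at hxy
    exact absurd hxy (hαβ x ⟨hx.1, hxs⟩ _ ⟨by linarith, by linarith [hy.2]⟩)
  · rw [arcJoin_of_le hys, arcJoin, if_neg (not_le.2 hxs)] at hxy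
    exact absurd hxy.symm (hαβ y ⟨hy.1, hys⟩ _ ⟨by linarith, by linarith [hx.2]⟩)
  · rw [arcJoin, arcJoin, if_neg (not_le.2 hxs), if_neg (not_le.2 hys)] at hxy
    have := hβ ⟨by linarith, by linarith [hx.2]⟩ ⟨by linarith, by linarith [hy.2]⟩ hxy
    linarith

end Join

/-! ### Charts in the plane and in the half-plane -/

/-- The open half-plane as a chart of the plane. -/
noncomputable def Plane.toHalfPlane (c : ℝ) : OpenPartialHomeomorph Plane HalfPlane where
  -- The shift sends the level `c` to `1`, inside the open half-plane. On the source the truncation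
  -- by `max` does nothing; it only provides values in the half-plane elsewhere.
  toFun x := ⟨!₂[max (x 0 - c + 1) 0, x 1], by simp⟩
  invFun x := !₂[x.1 0 + c - 1, x.1 1]
  source := {x | c - 1 < x 0}
  target := {x | 0 < x.1 0}
  map_source' x hx := by
    rw [mem_ofPred_eq] at hx ⊢
    simpa using (by linarith : 0 < x 0 - c + 1)
  map_target' x hx := by
    rw [mem_ofPred_eq] at hx ⊢
    simpa using hx
  left_inv' x hx := by
    rw [mem_ofPred_eq] at hx
    refine Plane.ext ?_ ?_
    · simp [max_eq_left (by linarith : 0 ≤ x 0 - c + 1)]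
      ring
    · simp
  right_inv' x hx := by
    refine HalfPlane.ext ?_ ?_
    · have : x.1 0 + c - 1 - c + 1 = x.1 0 := by ring
      simpa [this] using x.2
    · simp
  open_source := isOpen_lt (by fun_prop) (by fun_prop)
  open_target := isOpen_lt (by fun_prop) (by fun_prop)
  continuousOn_toFun := by
    refine Continuous.continuousOn (Continuous.subtype_mk
      ((PiLp.continuous_toLp 2 _).comp (continuous_pi fun i => ?_)) _)
    fin_cases i <;> simp <;> fun_prop
  continuousOn_invFun := by
    refine Continuous.continuousOn ((PiLp.continuous_toLp 2 _).comp (continuous_pi fun i => ?_))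
    fin_cases i <;> simp <;> fun_prop

/-- The exchange of the coordinates of the plane. -/
noncomputable def Plane.swap : Plane ≃ₜ Plane where
  toFun x := !₂[x 1, x 0]
  invFun x := !₂[x 1, x 0]
  left_inv x := Plane.ext (by simp) (by simp)
  right_inv x := Plane.ext (by simp) (by simp)
  continuous_toFun := by
    refine (PiLp.continuous_toLp 2 _).comp (continuous_pi fun i => ?_)
    fin_cases i <;> simp <;> fun_prop
  continuous_invFun := by
    refine (PiLp.continuous_toLp 2 _).comp (continuous_pi fun i => ?_)
    fin_cases i <;> simp <;> fun_prop

@[simp] theorem Plane.swap_zero (x : Plane) : Plane.swap x 0 = x 1 := by simp [Plane.swap]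

@[simp] theorem Plane.swap_one (x : Plane) : Plane.swap x 1 = x 0 := by simp [Plane.swap]

/-- The homeomorphism of the plane that straightens the boundary of a quadrant. -/
noncomputable def Plane.corner (σ τ : ℝ) (hσ : σ * σ = 1) (hτ : τ * τ = 1) : Plane ≃ₜ Plane where
  -- The minimum vanishes exactly on the two half-axes that bound the quadrant `τ x₀ ≥ 0`, `σ x₁ ≥
  -- 0`, and is positive inside it. Together with the difference it determines `τ x₀` and `σ x₁`.
  toFun x := !₂[τ * x 0 - σ * x 1, min (τ * x 0) (σ * x 1)]
  invFun x := !₂[τ * (x 1 + max (x 0) 0), σ * (x 1 + max (-x 0) 0)]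
  left_inv x := by
    refine Plane.ext ?_ ?_
    · have : min (τ * x 0) (σ * x 1) + max (τ * x 0 - σ * x 1) 0 = τ * x 0 := by grind
      simp [this, ← mul_assoc, hτ]
    · have : min (τ * x 0) (σ * x 1) + max (-(τ * x 0 - σ * x 1)) 0 = σ * x 1 := by grind
      simp only [neg_sub] at this
      simp [this, ← mul_assoc, hσ]
  right_inv x := by
    refine Plane.ext ?_ ?_
    · simp [← mul_assoc, hσ, hτ]
    · simp [← mul_assoc, hσ, hτ]
      grind
  continuous_toFun := by
    refine (PiLp.continuous_toLp 2 _).comp (continuous_pi fun i => ?_)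
    fin_cases i <;> simp <;> fun_prop
  continuous_invFun := by
    refine (PiLp.continuous_toLp 2 _).comp (continuous_pi fun i => ?_)
    fin_cases i <;> simp <;> fun_prop

@[simp] theorem Plane.corner_one {σ τ : ℝ} (hσ : σ * σ = 1) (hτ : τ * τ = 1) (x : Plane) :
    Plane.corner σ τ hσ hτ x 1 = min (τ * x 0) (σ * x 1) := by simp [Plane.corner]

/-! ### Locally flat arcs and the straightening of corners -/

section Flat

variable {S : Type*} [TopologicalSpace S]

/-- A plane chart, followed by a homeomorphism of the plane, gives a chart in the half-plane. -/
theorem OpenPartialHomeomorph.exists_halfPlane_chart (e : OpenPartialHomeomorph S Plane) {p : S}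
    (hp : p ∈ e.source) (θ : Plane ≃ₜ Plane) {O : Set S} (hO : O ∈ 𝓝 p) :
    ∃ f : OpenPartialHomeomorph S HalfPlane, p ∈ f.source ∧ ∀ q ∈ f.source, q ∈ e.source ∧ q ∈ O ∧
      0 < (f q).1 0 ∧ (f q).1 0 = θ (e q) 0 - θ (e p) 0 + 1 ∧ (f q).1 1 = θ (e q) 1 := by
  obtain ⟨U, hUO, hU, hpU⟩ := mem_nhds_iff.1 hO
  refine ⟨((e.trans θ.toOpenPartialHomeomorph).trans
    (Plane.toHalfPlane (θ (e p) 0))).restrOpen U hU, ⟨?_, hpU⟩, ?_⟩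
  · simp [Plane.toHalfPlane, hp]
  · rintro q ⟨hq, hqU⟩
    have h1 : q ∈ e.source ∧ θ (e p) 0 - 1 < θ (e q) 0 := by simpa [Plane.toHalfPlane] using hq
    have h2 : (((Plane.toHalfPlane (θ (e p) 0)) (θ (e q))).1 0 : ℝ) = θ (e q) 0 - θ (e p) 0 + 1 := by
      simp [Plane.toHalfPlane]
      linarith [h1.2]
    refine ⟨h1.1, hUO hqU, ?_, h2, by simp [Plane.toHalfPlane]⟩
    exact h2.trans_gt (by linarith [h1.2])

/-- Around `p` there is a chart of the surface with boundary `D` in which `A` is horizontal. -/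
def IsFlatAt (D A : Set S) (p : S) : Prop :=
  ∃ e : OpenPartialHomeomorph S HalfPlane, p ∈ e.source ∧
    ∀ q ∈ e.source, (q ∈ D ↔ (e q).1 0 = 0) ∧ (q ∈ A ↔ (e q).1 1 = 0)

theorem IsFlatAt.congr {D A A' : Set S} {p : S} (h : IsFlatAt D A p)
    (h' : ∀ᶠ q in 𝓝 p, (q ∈ A' ↔ q ∈ A)) : IsFlatAt D A' p := by
  obtain ⟨e, hp, he⟩ := h
  obtain ⟨U, hU, hUo, hpU⟩ := eventually_nhds_iff.1 h'
  exact ⟨e.restrOpen U hUo, ⟨hp, hpU⟩,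
    fun q hq => ⟨(he q hq.1).1, (hU q hq.2).trans (he q hq.1).2⟩⟩

/-- The plane chart has `A` as `{x₀ = 0}`, while flatness asks for the second coordinate; hence the
exchange of coordinates. The boundary plays no part near `p`. -/
theorem isFlatAt_of_line {D A : Set S} (hD : IsClosed D) {p : S} (hpD : p ∉ D)
    {e : OpenPartialHomeomorph S Plane} (hp : p ∈ e.source)
    (h : ∀ᶠ q in 𝓝 p, q ∈ A ↔ e q 0 = 0) : IsFlatAt D A p := by
  obtain ⟨f, hpf, hf⟩ := e.exists_halfPlane_chart hp Plane.swap
    (inter_mem h (hD.isOpen_compl.mem_nhds hpD))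
  refine ⟨f, hpf, fun q hq => ?_⟩
  obtain ⟨_, ⟨h1, h2⟩, h3, _, h5⟩ := hf q hq
  refine ⟨iff_of_false h2 h3.ne', ?_⟩
  rw [h5, Plane.swap_one]
  exact h1

theorem min_eq_zero_iff_corner {a b : ℝ} : min a b = 0 ↔ (a = 0 ∧ 0 ≤ b) ∨ (b = 0 ∧ 0 ≤ a) := by
  grind

theorem mul_eq_zero_of_sign {σ a : ℝ} (hσ : σ = 1 ∨ σ = -1) : σ * a = 0 ↔ a = 0 := by
  rcases hσ with rfl | rfl <;> simp

theorem mul_self_of_sign {σ : ℝ} (hσ : σ = 1 ∨ σ = -1) : σ * σ = 1 := by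
  rcases hσ with rfl | rfl <;> simp

/-- A corner at an interior point can be straightened. -/
theorem exists_chart_of_corner {A O : Set S} {p : S} (hO : O ∈ 𝓝 p)
    {e : OpenPartialHomeomorph S Plane} (hp : p ∈ e.source) {σ τ : ℝ} (hσ : σ = 1 ∨ σ = -1)
    (hτ : τ = 1 ∨ τ = -1)
    (h : ∀ᶠ q in 𝓝 p, q ∈ A ↔ (e q 0 = 0 ∧ 0 ≤ σ * e q 1) ∨ (e q 1 = 0 ∧ 0 ≤ τ * e q 0)) :
    ∃ f : OpenPartialHomeomorph S HalfPlane, p ∈ f.source ∧ ∀ q ∈ f.source, q ∈ e.source ∧ q ∈ O ∧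
      0 < (f q).1 0 ∧ (f q).1 1 = min (τ * e q 0) (σ * e q 1) ∧ (q ∈ A ↔ (f q).1 1 = 0) := by
  obtain ⟨f, hpf, hf⟩ := e.exists_halfPlane_chart hp
    (Plane.corner σ τ (mul_self_of_sign hσ) (mul_self_of_sign hτ)) (inter_mem h hO)
  refine ⟨f, hpf, fun q hq => ?_⟩
  obtain ⟨h0, ⟨h1, h2⟩, h3, _, h5⟩ := hf q hq
  rw [Plane.corner_one] at h5
  refine ⟨h0, h2, h3, h5, ?_⟩
  rw [h5, min_eq_zero_iff_corner, mul_eq_zero_of_sign hσ, mul_eq_zero_of_sign hτ]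
  exact h1

theorem isFlatAt_of_corner {D A : Set S} (hD : IsClosed D) {p : S} (hpD : p ∉ D)
    {e : OpenPartialHomeomorph S Plane} (hp : p ∈ e.source) {σ τ : ℝ} (hσ : σ = 1 ∨ σ = -1)
    (hτ : τ = 1 ∨ τ = -1)
    (h : ∀ᶠ q in 𝓝 p, q ∈ A ↔ (e q 0 = 0 ∧ 0 ≤ σ * e q 1) ∨ (e q 1 = 0 ∧ 0 ≤ τ * e q 0)) :
    IsFlatAt D A p := by
  obtain ⟨f, hpf, hf⟩ := exists_chart_of_corner (hD.isOpen_compl.mem_nhds hpD) hp hσ hτ h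
  exact ⟨f, hpf, fun q hq => ⟨iff_of_false (hf q hq).2.1 (hf q hq).2.2.1.ne', (hf q hq).2.2.2.2⟩⟩

/-! ### Parametrized proper arcs -/

/-- Composition with the projection to `[0, 1]` gives a path that is continuous on all of `ℝ`, so
that pieces of arcs can be cut and joined at real times. -/
theorem IsProperArc.exists_param {C₁ C₂ A : Set S} (h : IsProperArc C₁ C₂ A) :
    ∃ α : ℝ → S, Continuous α ∧ InjOn α (Icc 0 1) ∧ α '' Icc 0 1 = A ∧ α 0 ∈ C₁ ∧ α 1 ∈ C₂ ∧
      ∀ t ∈ Ioo (0 : ℝ) 1, α t ∉ C₁ ∪ C₂ := by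
  obtain ⟨⟨γ, hγ, rfl, h0, h1, h2⟩, -⟩ := h
  refine ⟨fun t => γ (projIcc 0 1 zero_le_one t), hγ.continuous.comp continuous_projIcc, ?_, ?_,
    ?_, ?_, ?_⟩
  · intro s hs t ht hst
    have := hγ.injective hst
    rw [projIcc_of_mem _ hs, projIcc_of_mem _ ht] at this
    exact congrArg Subtype.val this
  · ext q
    constructor
    · rintro ⟨t, -, rfl⟩
      exact mem_range_self _
    · rintro ⟨t, rfl⟩
      exact ⟨t.1, t.2, by simp⟩
  · simpa using h0
  · simpa using h1
  · intro t ht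
    show γ (projIcc 0 1 zero_le_one t) ∉ _
    rw [projIcc_of_mem _ (Ioo_subset_Icc_self ht)]
    refine h2 _ (fun h => ht.1.ne' ?_) (fun h => ht.2.ne ?_)
    · exact congrArg Subtype.val h
    · exact congrArg Subtype.val h

theorem IsProperArc.isFlatAt {C₁ C₂ A : Set S} (h : IsProperArc C₁ C₂ A) {p : S} (hp : p ∈ A) :
    IsFlatAt (C₁ ∪ C₂) A p := h.2 p hp

theorem IsProperArc.isCompact {C₁ C₂ A : Set S} (h : IsProperArc C₁ C₂ A) : IsCompact A := by
  obtain ⟨α, h1, -, rfl, -⟩ := h.exists_param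
  exact isCompact_Icc.image h1

/-- The affine parametrization of `[a, b]` by the unit interval. -/
theorem exists_unitInterval_param [T2Space S] {α : ℝ → S} {a b : ℝ} (hab : a < b)
    (hc : ContinuousOn α (Icc a b)) (hi : InjOn α (Icc a b)) :
    ∃ γ : unitInterval → S, Topology.IsEmbedding γ ∧ range γ = α '' Icc a b ∧
      ∀ t : unitInterval, γ t = α (a + t * (b - a)) := by
  have hmem : ∀ t : unitInterval, a + t * (b - a) ∈ Icc a b := fun t =>
    ⟨by nlinarith [t.2.1], by nlinarith [t.2.2]⟩
  have hcont : Continuous fun t : unitInterval => α (a + t * (b - a)) :=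
    hc.comp_continuous (by fun_prop) hmem
  refine ⟨_, (hcont.isClosedEmbedding ?_).isEmbedding, ?_, fun _ => rfl⟩
  · intro s t hst
    have := hi (hmem s) (hmem t) hst
    exact Subtype.ext (mul_right_cancel₀ (sub_pos.2 hab).ne' (add_left_cancel this))
  · ext q
    constructor
    · rintro ⟨t, rfl⟩
      exact ⟨_, hmem t, rfl⟩
    · rintro ⟨x, hx, rfl⟩
      have hb := sub_pos.2 hab
      refine ⟨⟨(x - a) / (b - a), by have := hx.1; apply div_nonneg <;> linarith,
        (div_le_one hb).2 (by linarith [hx.2])⟩, ?_⟩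
      show α (a + (x - a) / (b - a) * (b - a)) = α x
      rw [div_mul_cancel₀ _ hb.ne', add_sub_cancel]

theorem isProperArc_of_param [T2Space S] {C₁ C₂ : Set S} {α : ℝ → S} {a b : ℝ} (hab : a < b)
    (hc : ContinuousOn α (Icc a b)) (hi : InjOn α (Icc a b)) (ha : α a ∈ C₁) (hb : α b ∈ C₂)
    (hint : ∀ t ∈ Ioo a b, α t ∉ C₁ ∪ C₂)
    (hflat : ∀ p ∈ α '' Icc a b, IsFlatAt (C₁ ∪ C₂) (α '' Icc a b) p) :
    IsProperArc C₁ C₂ (α '' Icc a b) := by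
  obtain ⟨γ, h1, h2, h3⟩ := exists_unitInterval_param hab hc hi
  refine ⟨⟨γ, h1, h2, ?_, ?_, ?_⟩, hflat⟩
  · simpa [h3] using ha
  · simpa [h3] using hb
  · intro t ht0 ht1
    rw [h3]
    have h4 : 0 < (t : ℝ) := unitInterval.pos_iff_ne_zero.2 ht0
    have h5 : (t : ℝ) < 1 := unitInterval.lt_one_iff_ne_one.2 ht1
    exact hint _ ⟨by nlinarith, by nlinarith⟩

/-- The image of a proper arc under a homeomorphism that preserves the boundary circles. -/
theorem IsProperArc.image {T : Type*} [TopologicalSpace T] {C₁ C₂ A : Set S} {D₁ D₂ : Set T}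
    (hA : IsProperArc C₁ C₂ A) (h : S ≃ₜ T) (h1 : ∀ q, h q ∈ D₁ ↔ q ∈ C₁)
    (h2 : ∀ q, h q ∈ D₂ ↔ q ∈ C₂) : IsProperArc D₁ D₂ (h '' A) := by
  obtain ⟨⟨γ, hγ, rfl, g0, g1, g2⟩, hA⟩ := hA
  refine ⟨⟨h ∘ γ, h.isEmbedding.comp hγ, range_comp _ _, (h1 _).2 g0, (h2 _).2 g1, ?_⟩, ?_⟩
  · intro t h3 h4
    simpa [h1, h2] using g2 t h3 h4
  · rintro _ ⟨x, hx, rfl⟩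
    obtain ⟨e, hxe, he⟩ := hA x hx
    refine ⟨h.symm.toOpenPartialHomeomorph.trans e, by simpa using hxe, fun y hy => ?_⟩
    obtain ⟨y, rfl⟩ := h.surjective y
    have hy : y ∈ e.source := by simpa using hy
    obtain ⟨h3, h4⟩ := he y hy
    refine ⟨?_, ?_⟩
    · simpa [h1, h2] using h3
    · rw [h.injective.mem_set_image]
      simpa using h4

end Flat

/-! ### Charts adapted to a push -/

section PushCharts

variable {S : Type*} [TopologicalSpace S] {n P m F C₁ C₂ : Set S} {p : S}

/-- Only one of the disjoint closed sets `C₁`, `C₂` comes near `p`, so in a smaller chart lying on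
that one means that the horizontal coordinate vanishes. -/
theorem exists_isPushChart (h1 : IsClosed C₁) (h2 : IsClosed C₂) (hd : Disjoint C₁ C₂)
    {e : OpenPartialHomeomorph S HalfPlane} (hp : p ∈ e.source)
    (hD : ∀ q ∈ e.source, q ∈ C₁ ∪ C₂ ↔ (e q).1 0 = 0)
    (hn : ∀ q ∈ e.source, q ∈ n ↔ (e q).1 1 = 0)
    (hP : ∀ᶠ q in 𝓝 p, q ∈ P ↔ 0 < (e q).1 1)
    (hm : (∀ᶠ q in 𝓝 p, q ∉ F ∧ (q ∈ m → (e q).1 1 ≤ 0)) ∨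
      (p ∈ F ∧ ∀ᶠ q in 𝓝 p, q ∈ m ↔ (e q).1 0 = (e p).1 0)) :
    ∃ f, IsPushChart n P m F C₁ C₂ f p := by
  have hC : (∀ᶠ q in 𝓝 p, q ∉ C₁) ∨ (∀ᶠ q in 𝓝 p, q ∉ C₂) := by
    by_cases hp1 : p ∈ C₁
    · exact Or.inr (h2.isOpen_compl.mem_nhds (disjoint_left.1 hd hp1))
    · exact Or.inl (h1.isOpen_compl.mem_nhds hp1)
  obtain ⟨U, hU, hUo, hpU⟩ : ∃ U : Set S, (∀ q ∈ U, (q ∈ P ↔ 0 < (e q).1 1)) ∧ IsOpen U ∧ p ∈ U :=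
    eventually_nhds_iff.1 hP
  obtain ⟨V, hV, hVo, hpV⟩ : ∃ V : Set S, ((∀ q ∈ V, q ∉ C₁) ∨ (∀ q ∈ V, q ∉ C₂)) ∧
      IsOpen V ∧ p ∈ V := by
    rcases hC with h | h <;> obtain ⟨V, hV, hVo, hpV⟩ := eventually_nhds_iff.1 h
    · exact ⟨V, Or.inl hV, hVo, hpV⟩
    · exact ⟨V, Or.inr hV, hVo, hpV⟩
  obtain ⟨W, hW, hWo, hpW⟩ : ∃ W : Set S, ((∀ q ∈ W, q ∉ F ∧ (q ∈ m → (e q).1 1 ≤ 0)) ∨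
      (p ∈ F ∧ ∀ q ∈ W, q ∈ m ↔ (e q).1 0 = (e p).1 0)) ∧ IsOpen W ∧ p ∈ W := by
    rcases hm with h | ⟨hpF, h⟩ <;> obtain ⟨W, hW, hWo, hpW⟩ := eventually_nhds_iff.1 h
    · exact ⟨W, Or.inl hW, hWo, hpW⟩
    · exact ⟨W, Or.inr ⟨hpF, hW⟩, hWo, hpW⟩
  have hmem : ∀ q ∈ (e.restrOpen (U ∩ (V ∩ W)) (hUo.inter (hVo.inter hWo))).source,
      q ∈ e.source ∧ q ∈ U ∧ q ∈ V ∧ q ∈ W := fun q hq => hq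
  refine ⟨e.restrOpen (U ∩ (V ∩ W)) (hUo.inter (hVo.inter hWo)), ⟨⟨hp, hpU, hpV, hpW⟩,
    fun q hq => hn q (hmem q hq).1, fun q hq => hU q (hmem q hq).2.1, ?_, ?_, ?_⟩⟩
  · intro q hq q' hq' hqq'
    obtain ⟨h3, -, h4, -⟩ := hmem q hq
    obtain ⟨h3', -, h4', -⟩ := hmem q' hq'
    rcases hV with hV | hV
    · exact iff_of_false (hV q h4) (hV q' h4')
    · have h5 := hD q h3
      have h5' := hD q' h3'
      rw [mem_union, or_iff_left (hV q h4)] at h5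
      rw [mem_union, or_iff_left (hV q' h4')] at h5'
      rw [h5, h5']
      exact hqq' ▸ Iff.rfl
  · intro q hq q' hq' hqq'
    obtain ⟨h3, -, h4, -⟩ := hmem q hq
    obtain ⟨h3', -, h4', -⟩ := hmem q' hq'
    rcases hV with hV | hV
    · have h5 := hD q h3
      have h5' := hD q' h3'
      rw [mem_union, or_iff_right (hV q h4)] at h5
      rw [mem_union, or_iff_right (hV q' h4')] at h5'
      rw [h5, h5']
      exact hqq' ▸ Iff.rfl
    · exact iff_of_false (hV q h4) (hV q' h4')
  · rcases hW with hW | ⟨hpF, hW⟩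
    · refine Or.inl ⟨disjoint_left.2 fun q hq => (hW q (hmem q hq).2.2.2).1,
        fun q hq => (hW q (hmem q hq).2.2.2).2⟩
    · exact Or.inr ⟨hpF, fun q hq => hW q (hmem q hq).2.2.2⟩

/-- The chart is flipped if `P` lies below `n`. Therefore, apart from crossings, `m` has to stay in
`n` here and not merely below it. -/
theorem exists_isPushChart_of_isSideAt (h1 : IsClosed C₁) (h2 : IsClosed C₂) (hd : Disjoint C₁ C₂)
    {e : OpenPartialHomeomorph S HalfPlane} (hp : p ∈ e.source) (hpn : p ∈ n)
    (hD : ∀ q ∈ e.source, q ∈ C₁ ∪ C₂ ↔ (e q).1 0 = 0)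
    (hn : ∀ q ∈ e.source, q ∈ n ↔ (e q).1 1 = 0)
    (hP : IsSideAt n P p)
    (hm : (∀ᶠ q in 𝓝 p, q ∉ F ∧ (q ∈ m → (e q).1 1 = 0)) ∨
      (p ∈ F ∧ ∀ᶠ q in 𝓝 p, q ∈ m ↔ (e q).1 0 = (e p).1 0)) :
    ∃ f, IsPushChart n P m F C₁ C₂ f p := by
  rcases hP.align hpn hp hn with h | h
  · exact exists_isPushChart h1 h2 hd hp hD hn h (hm.imp_left fun h => h.mono fun q hq =>
      ⟨hq.1, fun hqm => (hq.2 hqm).le⟩)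
  · refine exists_isPushChart h1 h2 hd (e := e.trans HalfPlane.flip.toOpenPartialHomeomorph)
      (by simpa using hp) (by simpa using hD) (by simpa using hn) (by simpa using h)
      (hm.imp (fun h => h.mono fun q hq => ⟨hq.1, fun hqm => by simp [hq.2 hqm]⟩)
        fun h => by simpa using h)

end PushCharts

/-- An arc can be pushed off itself. -/
theorem IsProperArc.exists_disjoint {S : Type*} [TopologicalSpace S] [CompactSpace S] [T2Space S]
    {C₁ C₂ A : Set S} (h1 : IsClosed C₁) (h2 : IsClosed C₂) (hd : Disjoint C₁ C₂)
    (hA : IsProperArc C₁ C₂ A) : ∃ B, IsProperArc C₁ C₂ B ∧ Disjoint B A := by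
  obtain ⟨γ, hγ, hr, -⟩ := hA.1
  obtain ⟨P, hP⟩ := exists_isSideAt hγ.continuous hγ.injective (by
    rw [hr]
    intro p hp
    obtain ⟨e, hpe, he⟩ := hA.isFlatAt hp
    exact ⟨e, hpe, fun q hq => (he q hq).2⟩)
  rw [hr] at hP
  -- No other arc has to be respected, hence the empty sets for `m` and `F`.
  obtain ⟨h, hh, hn⟩ := exists_isPush (m := ∅) (F := ∅) (C₁ := C₁) (C₂ := C₂) (P := P) hA.isCompact
    (empty_subset _) (empty_subset _) (fun p hp => by
      obtain ⟨e, hpe, he⟩ := hA.isFlatAt hp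
      exact exists_isPushChart_of_isSideAt h1 h2 hd hpe hp (fun q hq => (he q hq).1)
        (fun q hq => (he q hq).2) (hP p hp) (Or.inl (Eventually.of_forall fun q => by simp)))
  refine ⟨h '' A, hA.image h hh.left hh.right, ?_⟩
  rw [disjoint_left]
  rintro _ ⟨q, hq, rfl⟩ hcon
  obtain ⟨e, hpe, he⟩ := hP _ hcon
  exact ((he _ hpe).2.1 (hn q hq)).ne' ((he _ hpe).1.1 hcon)

/-! ### Surgery at the last crossing -/

section Surgery

variable {S : Type*} [TopologicalSpace S] [CompactSpace S] [T2Space S] {C₁ C₂ : Set S}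

/-- The new arc runs along `l` to the last point `x` of `m` on `l`, then along `m`, and is pushed to
the side that is the quadrant inside the corner at `x`. This open quadrant misses both `l` and `m`.
Along its first piece the pushed arc crosses `m` only where `l` did, along the second piece it
leaves `m`, and the crossing `x` is lost. -/
theorem exists_surgery (h1 : IsClosed C₁) (h2 : IsClosed C₂) (hd : Disjoint C₁ C₂)
    (l m : ProperArc C₁ C₂) (ht : IntersectTransversely l m) (hfin : (l.1 ∩ m.1).Finite)
    (hne : (l.1 ∩ m.1).Nonempty) :
    ∃ n : ProperArc C₁ C₂, Disjoint n.1 l.1 ∧ IntersectTransversely n m ∧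
      (n.1 ∩ m.1).Finite ∧ (n.1 ∩ m.1).ncard < (l.1 ∩ m.1).ncard := by
  obtain ⟨l, hl⟩ := l
  obtain ⟨m, hm⟩ := m
  simp only [IntersectTransversely] at ht hfin hne ⊢
  obtain ⟨α, hαc, hαi, hαl, hα0, hα1, hαD⟩ := hl.exists_param
  obtain ⟨β, hβc, hβi, hβm, hβ0, hβ1, hβD⟩ := hm.exists_param
  have hlc := hl.isCompact.isClosed
  have hmc := hm.isCompact.isClosed
  have hDc : IsClosed (C₁ ∪ C₂) := h1.union h2
  -- The last time at which `m` meets `l`; afterwards `m` misses `l`, so the joined arc is simple.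
  obtain ⟨t₀, ⟨ht₀, hβt₀⟩, hmax⟩ : ∃ t, IsGreatest (Icc (0 : ℝ) 1 ∩ β ⁻¹' l) t := by
    refine (isCompact_Icc.inter_right (hlc.preimage hβc)).exists_isGreatest ?_
    obtain ⟨y, hy⟩ := hne
    obtain ⟨t, ht, rfl⟩ := hβm ▸ hy.2
    exact ⟨t, ht, hy.1⟩
  have hβm' : ∀ t ∈ Icc (0 : ℝ) 1, β t ∈ m := fun t ht => hβm ▸ mem_image_of_mem β ht
  have hαl' : ∀ t ∈ Icc (0 : ℝ) 1, α t ∈ l := fun t ht => hαl ▸ mem_image_of_mem α ht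
  set x := β t₀ with hx
  have hxm : x ∈ m := hβm' t₀ ht₀
  obtain ⟨s₀, hs₀, hαs₀⟩ : x ∈ α '' Icc 0 1 := hαl ▸ hβt₀
  obtain ⟨hxD, e, hxe, he⟩ := ht x ⟨hβt₀, hxm⟩
  have hs₀' : s₀ ∈ Ioo (0 : ℝ) 1 := by
    refine ⟨hs₀.1.lt_of_ne ?_, hs₀.2.lt_of_ne ?_⟩
    · rintro rfl; exact hxD (Or.inl (hαs₀ ▸ hα0))
    · rintro rfl; exact hxD (Or.inr (hαs₀ ▸ hα1))
  have ht₀' : t₀ ∈ Ioo (0 : ℝ) 1 := by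
    refine ⟨ht₀.1.lt_of_ne ?_, ht₀.2.lt_of_ne ?_⟩
    · rintro rfl; exact hxD (Or.inl hβ0)
    · rintro rfl; exact hxD (Or.inr hβ1)
  have hβl : ∀ t ∈ Ioc t₀ 1, β t ∉ l := fun t ht hcon =>
    absurd (hmax ⟨⟨ht₀.1.trans ht.1.le, ht.2⟩, hcon⟩) (not_le.2 ht.1)
  have hIs : Icc 0 s₀ ⊆ Icc (0 : ℝ) 1 := Icc_subset_Icc_right hs₀.2
  have hIt : Icc t₀ 1 ⊆ Icc (0 : ℝ) 1 := Icc_subset_Icc_left ht₀.1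
  -- the arc that follows `l` up to `x` and then `m`
  set ν := arcJoin α β s₀ t₀ with hν
  set b := s₀ + (1 - t₀) with hb
  have hsb : s₀ < b := by linarith [ht₀'.2]
  have hνc : ContinuousOn ν (Icc 0 b) := arcJoin_continuousOn hs₀.1 ht₀.2 hαs₀
    hαc.continuousOn hβc.continuousOn
  have hνi : InjOn ν (Icc 0 b) := arcJoin_injOn (hαi.mono hIs) (hβi.mono hIt)
    fun s hs t ht hst => hβl t ht (hst ▸ hαl' s (hIs hs))
  set n := ν '' Icc 0 b with hn
  have hnun : n = α '' Icc 0 s₀ ∪ β '' Icc t₀ 1 := arcJoin_image hs₀.1 ht₀.2 hαs₀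
  have hνs : ν s₀ = x := by rw [hν, arcJoin_of_le le_rfl, hαs₀]
  have hxn : x ∈ n := hνs ▸ mem_image_of_mem ν ⟨hs₀.1, hsb.le⟩
  have hclA : ∀ a b : ℝ, IsClosed (α '' Icc a b) := fun a b => (isCompact_Icc.image hαc).isClosed
  have hclB : ∀ a b : ℝ, IsClosed (β '' Icc a b) := fun a b => (isCompact_Icc.image hβc).isClosed
  -- the three kinds of points
  have hnear_l : ∀ s ∈ Ico 0 s₀, ∀ᶠ q in 𝓝 (α s), q ∈ n ↔ q ∈ l := by
    intro s hs
    have hs1 : s ∈ Icc (0 : ℝ) 1 := ⟨hs.1, hs.2.le.trans hs₀.2⟩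
    have k1 : α s ∉ α '' Icc s₀ 1 := by
      rintro ⟨s', hs', hss'⟩
      have := hαi ⟨hs₀.1.trans hs'.1, hs'.2⟩ hs1 hss'
      linarith [hs'.1, hs.2]
    have k2 : α s ∉ β '' Icc t₀ 1 := by
      rintro ⟨t, ht, hst⟩
      rcases ht.1.eq_or_lt with rfl | htt
      · exact hs.2.ne (hαi hs1 hs₀ (hst.symm.trans hαs₀.symm))
      · exact hβl t ⟨htt, ht.2⟩ (hst ▸ hαl' s hs1)
    filter_upwards [(hclA s₀ 1).isOpen_compl.mem_nhds k1, (hclB t₀ 1).isOpen_compl.mem_nhds k2]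
      with q hq1 hq2
    rw [hnun, ← hαl, ← Icc_union_Icc_eq_Icc hs₀.1 hs₀.2, image_union, mem_union, mem_union,
      or_iff_left hq1, or_iff_left hq2]
  have hnear_m : ∀ t ∈ Ioc t₀ 1, ∀ᶠ q in 𝓝 (β t), q ∉ l ∧ (q ∈ n ↔ q ∈ m) := by
    intro t ht
    have ht1 : t ∈ Icc (0 : ℝ) 1 := ⟨ht₀.1.trans ht.1.le, ht.2⟩
    have k1 : β t ∉ β '' Icc 0 t₀ := by
      rintro ⟨t', ht', htt'⟩
      have := hβi ⟨ht'.1, ht'.2.trans ht₀.2⟩ ht1 htt'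
      linarith [ht'.2, ht.1]
    filter_upwards [(hclB 0 t₀).isOpen_compl.mem_nhds k1,
      hlc.isOpen_compl.mem_nhds (hβl t ht)] with q hq1 hq2
    refine ⟨hq2, ?_⟩
    have hq3 : q ∉ α '' Icc 0 s₀ := fun h => hq2 (hαl ▸ image_mono hIs h)
    rw [hnun, ← hβm, ← Icc_union_Icc_eq_Icc ht₀.1 ht₀.2, image_union, mem_union, mem_union,
      or_iff_right hq1, or_iff_right hq3]
  have hcases : ∀ p ∈ n, (∃ s ∈ Ico 0 s₀, α s = p) ∨ p = x ∨ ∃ t ∈ Ioc t₀ 1, β t = p := by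
    intro p hp
    rw [hnun] at hp
    rcases hp with ⟨s, hs, rfl⟩ | ⟨t, ht, rfl⟩
    · rcases hs.2.eq_or_lt with rfl | h
      · exact Or.inr (Or.inl hαs₀)
      · exact Or.inl ⟨s, ⟨hs.1, h⟩, rfl⟩
    · rcases ht.1.eq_or_lt with rfl | h
      · exact Or.inr (Or.inl rfl)
      · exact Or.inr (Or.inr ⟨t, ⟨h, ht.2⟩, rfl⟩)
  have he0 : ∀ i, ContinuousOn (fun q => e q i) e.source := fun i =>
    (by fun_prop : Continuous fun y : Plane => y i).comp_continuousOn e.continuousOn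
  -- On `l` the second coordinate of `e` is a parameter, on `m` the first one; `σ` and `τ` tell
  -- along which half-axes the joined arc runs.
  obtain ⟨σ, τ, hσ, hτ, hcorner⟩ := exists_two_branches (L := l) (M := m) hs₀'.1 hsb hνc hνi
    e.open_source (hνs.symm ▸ hxe) (he0 1)
    (fun y hy z hz hyz => e.injOn hy.2 hz.2
      (Plane.ext (((he y hy.2).1.1 hy.1).trans ((he z hz.2).1.1 hz.1).symm) hyz))
    (by rw [hνs]; exact (he x hxe).2.1 hxm) (he0 0)
    (fun y hy z hz hyz => e.injOn hy.2 hz.2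
      (Plane.ext hyz (((he y hy.2).2.1 hy.1).trans ((he z hz.2).2.1 hz.1).symm)))
    (by rw [hνs]; exact (he x hxe).1.1 hβt₀)
    (by
      filter_upwards [self_mem_nhdsWithin, mem_nhdsWithin_of_mem_nhds (lt_mem_nhds hs₀'.1)]
        with s hs hs'
      rw [hν, arcJoin_of_le hs]
      exact hαl' s ⟨hs'.le, (mem_Iic.1 hs).trans hs₀.2⟩)
    (by
      filter_upwards [self_mem_nhdsWithin, mem_nhdsWithin_of_mem_nhds (gt_mem_nhds hsb)]
        with s hs hs'
      have hs := mem_Ici.1 hs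
      rw [hν, arcJoin_of_ge hαs₀ hs]
      exact hβm' _ ⟨by linarith [ht₀.1], by linarith⟩)
  rw [hνs] at hcorner
  have hcorner' : ∀ᶠ q in 𝓝 x, q ∈ n ↔
      (e q 0 = 0 ∧ 0 ≤ σ * e q 1) ∨ (e q 1 = 0 ∧ 0 ≤ τ * e q 0) := by
    filter_upwards [hcorner, e.open_source.mem_nhds hxe] with q hq hqe
    rw [hn, hq, (he q hqe).1, (he q hqe).2]
  have hflat : ∀ p ∈ n, IsFlatAt (C₁ ∪ C₂) n p := by
    intro p hp
    rcases hcases p hp with ⟨s, hs, rfl⟩ | rfl | ⟨t, ht, rfl⟩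
    · exact (hl.isFlatAt (hαl' s ⟨hs.1, hs.2.le.trans hs₀.2⟩)).congr (hnear_l s hs)
    · exact isFlatAt_of_corner hDc hxD hxe hσ hτ hcorner'
    · exact (hm.isFlatAt (hβm' t ⟨ht₀.1.trans ht.1.le, ht.2⟩)).congr
        ((hnear_m t ht).mono fun q hq => hq.2)
  have hνb : ν b = β 1 := by rw [hν, arcJoin_of_ge hαs₀ hsb.le]; congr 1; ring
  have hnP : IsProperArc C₁ C₂ n := by
    refine isProperArc_of_param (hs₀'.1.trans hsb) hνc hνi ?_ (hνb ▸ hβ1) ?_ hflat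
    · rwa [hν, arcJoin_of_le hs₀.1]
    · intro t ht
      rcases le_or_gt t s₀ with hts | hts
      · rw [hν, arcJoin_of_le hts]
        exact hαD t ⟨ht.1, hts.trans_lt hs₀'.2⟩
      · rw [hν, arcJoin_of_ge hαs₀ hts.le]
        exact hβD _ ⟨by linarith [ht₀.1], by linarith [ht.2]⟩
  -- the inner side of the corner
  obtain ⟨f, hxf, hf⟩ := exists_chart_of_corner (hDc.isOpen_compl.mem_nhds hxD) hxe hσ hτ hcorner'
  obtain ⟨γ, hγ, hγr, -⟩ := exists_unitInterval_param (hs₀'.1.trans hsb) hνc hνi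
  obtain ⟨P₀, hP₀, hP₀x⟩ := exists_isSideAt_of_chart hγ.continuous hγ.injective (by
    rw [hγr]
    intro p hp
    obtain ⟨e, hpe, he⟩ := hflat p hp
    exact ⟨e, hpe, fun q hq => (he q hq).2⟩) (p := x) (e := f) (by rwa [hγr]) hxf (by
    rw [hγr]
    exact fun q hq => (hf q hq).2.2.2.2)
  rw [hγr] at hP₀
  -- Removing `l` makes disjointness from `l` part of the push. By `hPP₀` this changes nothing near
  -- `n`.
  set P := P₀ \ l with hP
  -- The crossings that survive. The time `s₀` is excluded, so `x` is not among them; this gives the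
  -- strict inequality in the end.
  set F := α '' Ico 0 s₀ ∩ m with hF
  have hPP₀ : ∀ p ∈ n, ∀ᶠ q in 𝓝 p, q ∈ P ↔ q ∈ P₀ := by
    intro p hp
    suffices H : ∀ᶠ q in 𝓝 p, q ∈ P₀ → q ∉ l from H.mono fun q hq =>
      ⟨fun h => h.1, fun h => ⟨h, hq h⟩⟩
    rcases hcases p hp with ⟨s, hs, rfl⟩ | rfl | ⟨t, ht, rfl⟩
    · obtain ⟨c, hpc, hc⟩ := hP₀ _ hp
      filter_upwards [hnear_l s hs, c.open_source.mem_nhds hpc] with q hq hqc hqP hql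
      exact ((hc q hqc).2.1 hqP).ne' ((hc q hqc).1.1 (hq.2 hql))
    -- At the corner the side is the open quadrant, where `τ * e q 0` is positive, whereas `e q 0`
    -- vanishes on `l`.
    · filter_upwards [hP₀x, f.open_source.mem_nhds hxf] with q hq hqf hqP hql
      have hqP := hq.1 hqP
      rw [(hf q hqf).2.2.2.1, (he q (hf q hqf).1).1.1 hql, mul_zero] at hqP
      exact absurd hqP (not_lt.2 (min_le_left _ _))
    · filter_upwards [hnear_m t ht] with q hq _
      exact hq.1
  have hPside : ∀ p ∈ n, IsSideAt n P p := fun p hp => (hP₀ p hp).congr (hPP₀ p hp)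
  have hFlm : F ⊆ l ∩ m := by
    rintro _ ⟨⟨s, hs, rfl⟩, hsm⟩
    exact ⟨hαl' s ⟨hs.1, hs.2.le.trans hs₀.2⟩, hsm⟩
  have hFfin : F.Finite := hfin.subset hFlm
  have hxF : x ∉ F := by
    rintro ⟨⟨s, hs, hsx⟩, -⟩
    exact hs.2.ne (hαi ⟨hs.1, hs.2.le.trans hs₀.2⟩ hs₀ (hsx.trans hαs₀.symm))
  have hFn : F ⊆ n := by
    rintro _ ⟨⟨s, hs, rfl⟩, -⟩
    rw [hnun]
    exact Or.inl ⟨s, ⟨hs.1, hs.2.le⟩, rfl⟩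
  have hFnear : ∀ p ∈ F, ∀ᶠ q in 𝓝 p, q ∈ n ↔ q ∈ l := by
    rintro _ ⟨⟨s, hs, rfl⟩, -⟩
    exact hnear_l s hs
  obtain ⟨h, hh, hhn⟩ := exists_isPush (m := m) (F := F) (C₁ := C₁) (C₂ := C₂) (P := P)
    hnP.isCompact hFn (fun q hq => hq.2) (fun p hp => by
      rcases hcases p hp with ⟨s, hs, hsp⟩ | rfl | ⟨t, ht, rfl⟩
      · by_cases hpm : p ∈ m
        · have hpF : p ∈ F := ⟨⟨s, hs, hsp⟩, hpm⟩
          obtain ⟨hpD, c, hpc, hc⟩ := ht p (hFlm hpF)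
          -- At a surviving crossing the transversality chart with exchanged coordinates makes `l`
          -- horizontal and `m` the vertical line through `p`.
          obtain ⟨d, hpd, hd'⟩ := c.exists_halfPlane_chart hpc Plane.swap
            (inter_mem (hFnear p hpF) (hDc.isOpen_compl.mem_nhds hpD))
          have hc1 : c p 1 = 0 := (hc p hpc).2.1 hpm
          refine exists_isPushChart_of_isSideAt h1 h2 hd hpd hp ?_ ?_ (hPside p hp)
            (Or.inr ⟨hpF, ?_⟩)
          · intro q hq
            obtain ⟨_, ⟨_, k2⟩, k3, _⟩ := hd' q hq
            exact iff_of_false k2 k3.ne'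
          · intro q hq
            obtain ⟨k0, ⟨k1, _⟩, _, _, k5⟩ := hd' q hq
            rw [k5, Plane.swap_one, ← (hc q k0).1]
            exact k1
          · filter_upwards [d.open_source.mem_nhds hpd] with q hq
            obtain ⟨k0, _, _, k4, _⟩ := hd' q hq
            rw [k4, (hd' p hpd).2.2.2.1, Plane.swap_zero, Plane.swap_zero, hc1, (hc q k0).2]
            simp
        · obtain ⟨c, hpc, hc⟩ := hflat p hp
          refine exists_isPushChart_of_isSideAt h1 h2 hd hpc hp (fun q hq => (hc q hq).1)
            (fun q hq => (hc q hq).2) (hPside p hp) (Or.inl ?_)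
          filter_upwards [hmc.isOpen_compl.mem_nhds hpm] with q hq
          exact ⟨fun hqF => hq hqF.2, fun hqm => absurd hqm hq⟩
      -- In the straightened chart at the corner all of `m` lies in the closed lower side.
      · refine exists_isPushChart h1 h2 hd hxf (fun q hq => iff_of_false (hf q hq).2.1
          (hf q hq).2.2.1.ne') (fun q hq => (hf q hq).2.2.2.2) ?_ (Or.inl ?_)
        · filter_upwards [hPP₀ x hxn, hP₀x] with q k1 k2
          exact k1.trans k2
        · filter_upwards [hFfin.isClosed.isOpen_compl.mem_nhds hxF, f.open_source.mem_nhds hxf]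
            with q hq hqf
          refine ⟨hq, fun hqm => ?_⟩
          rw [(hf q hqf).2.2.2.1, (he q (hf q hqf).1).2.1 hqm, mul_zero]
          exact min_le_right _ _
      · obtain ⟨c, hpc, hc⟩ := hflat _ hp
        refine exists_isPushChart_of_isSideAt h1 h2 hd hpc hp (fun q hq => (hc q hq).1)
          (fun q hq => (hc q hq).2) (hPside _ hp) (Or.inl ?_)
        filter_upwards [hnear_m t ht, c.open_source.mem_nhds hpc] with q hq hqc
        exact ⟨fun hqF => hq.1 (hFlm hqF).1, fun hqm => (hc q hqc).2.1 (hq.2.2 hqm)⟩)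
  -- A point of `n` that lands on `m` was on `m` before. Outside `F` it would have to be fixed, but
  -- every point of `n` moves into `P`.
  have hnm : ∀ q ∈ n, h q ∈ m → q ∈ F := by
    intro q hq hqm
    by_contra hqF
    rcases hh.off q hq (hh.reflects q (Or.inl hq) hqm) hqF with k | k
    · obtain ⟨c, hpc, hc⟩ := hPside q hq
      exact ((hc q hpc).2.1 (k ▸ hhn q hq)).ne' ((hc q hpc).1.1 hq)
    · exact k hqm
  have hsub : h '' n ∩ m ⊆ h '' F := by
    rintro _ ⟨⟨q, hq, rfl⟩, hqm⟩
    exact ⟨q, hnm q hq hqm, rfl⟩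
  refine ⟨⟨h '' n, hnP.image h hh.left hh.right⟩, ?_, ?_, (hFfin.image h).subset hsub, ?_⟩
  · rw [disjoint_left]
    rintro _ ⟨q, hq, rfl⟩
    exact (hhn q hq).2
  · rintro _ ⟨⟨q, hq, rfl⟩, hqm⟩
    have hqF := hnm q hq hqm
    obtain ⟨hqD, c, hqc, hc⟩ := ht q (hFlm hqF)
    refine ⟨by simpa [hh.left, hh.right] using hqD, ?_⟩
    -- Near `q` the arc `n` is `l`, and `h` preserves `m` there, so the transversality chart of `l`
    -- and `m` at `q`, carried along by `h`, serves at `h q`.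
    obtain ⟨U, hU, hUo, hqU⟩ := eventually_nhds_iff.1
      ((hFnear q hqF).and (hh.crossing q (Or.inl hqF)).2)
    refine ⟨h.symm.toOpenPartialHomeomorph.trans (c.restrOpen U hUo),
      by simpa using ⟨hqc, hqU⟩, fun y hy => ?_⟩
    obtain ⟨y, rfl⟩ := h.surjective y
    have hy : y ∈ c.source ∧ y ∈ U := by simpa using hy
    have k1 := hc y hy.1
    have k2 := hU y hy.2
    rw [h.injective.mem_set_image, k2.1, k2.2]
    simpa using k1
  · calc (h '' n ∩ m).ncard ≤ (h '' F).ncard := ncard_le_ncard hsub (hFfin.image h)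
      _ ≤ F.ncard := ncard_image_le hFfin
      _ < (l ∩ m).ncard := ncard_lt_ncard ⟨hFlm, fun hcon => hxF (hcon ⟨hβt₀, hxm⟩)⟩ hfin

end Surgery

/-! ### Distances in the 1-skeleton -/

section Distance

variable {S : Type*} [TopologicalSpace S] {C₁ C₂ : Set S}

/-- Disjoint arcs may be isotopic; then there is no edge and the distance is `0`, hence the
inequality. -/
theorem edist_toClass_le_one_of_disjoint {l m : ProperArc C₁ C₂} (h : Disjoint l.1 m.1) :
    (arcComplex C₁ C₂).oneSkeleton.edist l.toClass m.toClass ≤ 1 := by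
  classical
  by_cases hlm : l.toClass = m.toClass
  · rw [hlm, SimpleGraph.edist_self]
    exact zero_le
  · have hadj : (arcComplex C₁ C₂).oneSkeleton.Adj l.toClass m.toClass := by
      refine ⟨hlm, {l.toClass, m.toClass}, ⟨?_, ?_⟩, ?_⟩
      · simp
      · refine ⟨fun v => if v = l.toClass then l else m, ?_, ?_⟩
        · intro v hv
          rcases Finset.mem_insert.1 hv with rfl | hv
          · simp
          · rw [Finset.mem_singleton] at hv
            subst hv
            simp [Ne.symm hlm]
        · intro v hv w hw hvw
          rcases Finset.mem_insert.1 hv with rfl | hv <;> rcases Finset.mem_insert.1 hw with rfl | hw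
          · exact absurd rfl hvw
          · rw [Finset.mem_singleton] at hw
            subst hw
            simpa [Ne.symm hlm] using h
          · rw [Finset.mem_singleton] at hv
            subst hv
            simpa [Ne.symm hlm] using h.symm
          · rw [Finset.mem_singleton] at hv hw
            exact absurd (hv.trans hw.symm) hvw
      · simp
    exact (SimpleGraph.edist_eq_one_iff_adj.2 hadj).le

/-- Each surgery costs one step, from `l` to an arc disjoint from it, and lowers the number of
crossings with `m`. -/
theorem edist_toClass_le [CompactSpace S] [T2Space S] (h1 : IsClosed C₁) (h2 : IsClosed C₂)
    (hd : Disjoint C₁ C₂) (k : ℕ) (l m : ProperArc C₁ C₂) (ht : IntersectTransversely l m)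
    (hfin : (l.1 ∩ m.1).Finite) (hk : (l.1 ∩ m.1).ncard ≤ k) :
    (arcComplex C₁ C₂).oneSkeleton.edist l.toClass m.toClass ≤ k + 1 := by
  induction k generalizing l with
  | zero =>
    have := (ncard_eq_zero hfin).1 (Nat.le_zero.1 hk)
    simpa using edist_toClass_le_one_of_disjoint (disjoint_iff_inter_eq_empty.2 this)
  | succ k ih =>
    rcases (l.1 ∩ m.1).eq_empty_or_nonempty with h | h
    · exact (edist_toClass_le_one_of_disjoint (disjoint_iff_inter_eq_empty.2 h)).trans
        le_add_self
    · obtain ⟨n, hnl, hnm, hnfin, hcard⟩ := exists_surgery h1 h2 hd l m ht hfin h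
      have h3 := ih n hnm hnfin (by omega)
      have h4 := edist_toClass_le_one_of_disjoint hnl.symm
      calc _ ≤ _ := SimpleGraph.edist_triangle (v := n.toClass)
        _ ≤ 1 + (k + 1 : ℕ∞) := add_le_add h4 (by exact_mod_cast h3)
        _ = _ := by push_cast; ring


/-- Arcs can be connected in the arc complex if they can be connected through a fixed arc. -/
theorem oneSkeleton_connected [CompactSpace S] [T2Space S] (h1 : IsClosed C₁) (h2 : IsClosed C₂)
    (hd : Disjoint C₁ C₂) (m : ProperArc C₁ C₂)
    (hm : ∀ l : ProperArc C₁ C₂, ∃ a : ProperArc C₁ C₂, Disjoint l.1 a.1 ∧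
      IntersectTransversely a m ∧ (a.1 ∩ m.1).Finite) :
    (arcComplex C₁ C₂).oneSkeleton.Connected := by
  have hreach : ∀ v, (arcComplex C₁ C₂).oneSkeleton.Reachable v m.toClass := by
    intro v
    obtain ⟨l, rfl⟩ : ∃ l : ProperArc C₁ C₂, l.toClass = v := Quotient.exists_rep v
    obtain ⟨a, h3, h4, h5⟩ := hm l
    have h6 := edist_toClass_le_one_of_disjoint h3
    have h7 := edist_toClass_le h1 h2 hd _ a m h4 h5 le_rfl
    refine SimpleGraph.Reachable.trans (v := a.toClass) ?_ ?_
    · exact SimpleGraph.reachable_of_edist_ne_top (h6.trans_lt (by decide)).ne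
    · refine SimpleGraph.reachable_of_edist_ne_top (h7.trans_lt ?_).ne
      exact_mod_cast ENat.natCast_lt_top _
  have : Nonempty (ArcClass C₁ C₂) := ⟨m.toClass⟩
  exact ⟨fun v w => (hreach v).trans (hreach w).symm⟩

end Distance

/-! ### Arcs made of pieces of curves from a given family -/

section Grid

variable {S : Type*} [TopologicalSpace S]

/-- A family of curves in the surface with boundary `D` any two of which cross in the interior, and
all of which are transverse to the boundary. -/
structure IsGrid (𝓑 : Set (Set S)) (D : Set S) : Prop where
  isClosed : IsClosed D
  line : ∀ L ∈ 𝓑, ∀ p ∈ L, p ∉ D → ∃ e : OpenPartialHomeomorph S Plane, p ∈ e.source ∧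
    e p 1 = 0 ∧ ∀ q ∈ e.source, q ∈ L ↔ e q 0 = 0
  cross : ∀ L ∈ 𝓑, ∀ M ∈ 𝓑, L ≠ M → ∀ p ∈ L, p ∈ M → p ∉ D →
    ∃ e : OpenPartialHomeomorph S Plane, p ∈ e.source ∧
      ∀ q ∈ e.source, (q ∈ L ↔ e q 0 = 0) ∧ (q ∈ M ↔ e q 1 = 0)
  boundary : ∀ L ∈ 𝓑, ∀ p ∈ L, p ∈ D → IsFlatAt D L p

/-- The path `α` consists of pieces of the curves in `𝓑`. -/
def IsPiecewise (𝓑 : Set (Set S)) (α : ℝ → S) (a b : ℝ) : Prop :=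
  (∀ t ∈ Ico a b, ∃ L ∈ 𝓑, ∀ᶠ s in 𝓝[≥] t, α s ∈ L) ∧
    ∀ t ∈ Ioc a b, ∃ L ∈ 𝓑, ∀ᶠ s in 𝓝[≤] t, α s ∈ L

omit [TopologicalSpace S] in
theorem IsPiecewise.mono {𝓑 : Set (Set S)} {α : ℝ → S} {a b a' b' : ℝ} (h : IsPiecewise 𝓑 α a b)
    (ha : a ≤ a') (hb : b' ≤ b) : IsPiecewise 𝓑 α a' b' :=
  ⟨fun t ht => h.1 t ⟨ha.trans ht.1, ht.2.trans_le hb⟩,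
    fun t ht => h.2 t ⟨ha.trans_lt ht.1, ht.2.trans hb⟩⟩

omit [TopologicalSpace S] in
theorem IsPiecewise.of_subset {𝓑 : Set (Set S)} {α : ℝ → S} {a b : ℝ} {L : Set S} (hL : L ∈ 𝓑)
    (h : ∀ t ∈ Icc a b, α t ∈ L) : IsPiecewise 𝓑 α a b := by
  constructor
  · intro t ht
    refine ⟨L, hL, ?_⟩
    filter_upwards [self_mem_nhdsWithin, mem_nhdsWithin_of_mem_nhds (gt_mem_nhds ht.2)]
      with s hs hs'
    exact h s ⟨ht.1.trans hs, hs'.le⟩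
  · intro t ht
    refine ⟨L, hL, ?_⟩
    filter_upwards [self_mem_nhdsWithin, mem_nhdsWithin_of_mem_nhds (lt_mem_nhds ht.1)]
      with s hs hs'
    exact h s ⟨hs'.le, (mem_Iic.1 hs).trans ht.2⟩

omit [TopologicalSpace S] in
theorem IsPiecewise.arcJoin {𝓑 : Set (Set S)} {α β : ℝ → S} {a s t b : ℝ} (hst : α s = β t)
    (hα : IsPiecewise 𝓑 α a s) (hβ : IsPiecewise 𝓑 β t b) :
    IsPiecewise 𝓑 (arcJoin α β s t) a (s + (b - t)) := by
  constructor
  · intro x hx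
    rcases lt_or_ge x s with hxs | hxs
    · obtain ⟨L, hL, h⟩ := hα.1 x ⟨hx.1, hxs⟩
      refine ⟨L, hL, ?_⟩
      filter_upwards [h, mem_nhdsWithin_of_mem_nhds (gt_mem_nhds hxs)] with y hy hys
      rwa [arcJoin_of_le hys.le]
    · obtain ⟨L, hL, h⟩ := hβ.1 (x - s + t) ⟨by linarith, by linarith [hx.2]⟩
      refine ⟨L, hL, ?_⟩
      have htend : Tendsto (fun y => y - s + t) (𝓝[≥] x) (𝓝[≥] (x - s + t)) := by
        refine tendsto_nhdsWithin_of_tendsto_nhds_of_eventually_within _ ?_ ?_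
        · exact ((by fun_prop : Continuous fun y : ℝ => y - s + t).tendsto x).mono_left
            nhdsWithin_le_nhds
        · filter_upwards [self_mem_nhdsWithin] with y hy
          have := mem_Ici.1 hy
          exact mem_Ici.2 (by linarith)
      filter_upwards [htend.eventually h, self_mem_nhdsWithin] with y hy hxy
      rwa [arcJoin_of_ge hst (hxs.trans hxy)]
  · intro x hx
    rcases le_or_gt x s with hxs | hxs
    · obtain ⟨L, hL, h⟩ := hα.2 x ⟨hx.1, hxs⟩
      refine ⟨L, hL, ?_⟩
      filter_upwards [h, self_mem_nhdsWithin] with y hy hyx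
      rwa [arcJoin_of_le ((mem_Iic.1 hyx).trans hxs)]
    · obtain ⟨L, hL, h⟩ := hβ.2 (x - s + t) ⟨by linarith, by linarith [hx.2]⟩
      refine ⟨L, hL, ?_⟩
      have htend : Tendsto (fun y => y - s + t) (𝓝[≤] x) (𝓝[≤] (x - s + t)) := by
        refine tendsto_nhdsWithin_of_tendsto_nhds_of_eventually_within _ ?_ ?_
        · exact ((by fun_prop : Continuous fun y : ℝ => y - s + t).tendsto x).mono_left
            nhdsWithin_le_nhds
        · filter_upwards [self_mem_nhdsWithin] with y hy
          have := mem_Iic.1 hy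
          exact mem_Iic.2 (by linarith)
      filter_upwards [htend.eventually h, mem_nhdsWithin_of_mem_nhds (lt_mem_nhds hxs)]
        with y hy hys
      rwa [arcJoin_of_ge hst (le_of_lt hys)]

/-- The first coordinate of a half-plane chart is never negative. So the half-branch with `σ = 1` is
the whole curve near `p`, while the one with `σ = -1` would lie in the boundary, which is excluded
for a set that leaves `D`. -/
theorem isFlatAt_of_half_branch {D A L : Set S} {p : S} {e : OpenPartialHomeomorph S HalfPlane}
    (hp : p ∈ e.source) (he : ∀ q ∈ e.source, (q ∈ D ↔ (e q).1 0 = 0) ∧ (q ∈ L ↔ (e q).1 1 = 0))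
    {σ : ℝ} (hσ : σ = 1 ∨ σ = -1) (hA : ∀ᶠ q in 𝓝 p, q ∈ A ↔ q ∈ L ∧ 0 ≤ σ * (e q).1 0)
    (hAD : ∃ᶠ q in 𝓝 p, q ∈ A ∧ q ∉ D) : IsFlatAt D A p := by
  rcases hσ with rfl | rfl
  · refine IsFlatAt.congr (A := L) ⟨e, hp, he⟩ (hA.mono fun q hq => hq.trans (and_iff_left ?_))
    rw [one_mul]
    exact (e q).2
  · exfalso
    obtain ⟨q, ⟨hqA, hqD⟩, hq, hqe⟩ :=
      (hAD.and_eventually (hA.and (e.open_source.mem_nhds hp))).exists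
    have h1 := (hq.1 hqA).2
    have h2 : 0 ≤ (e q).1 0 := (e q).2
    exact hqD ((he q hqe).1.2 (by linarith))

variable [T2Space S] {𝓑 : Set (Set S)} {D : Set S} {α : ℝ → S} {a b : ℝ}

omit [T2Space S] in
theorem IsGrid.exists_coordinate (hG : IsGrid 𝓑 D) {L : Set S} (hL : L ∈ 𝓑) {p : S} (hp : p ∈ L)
    (hpD : p ∉ D) : ∃ e : OpenPartialHomeomorph S Plane, p ∈ e.source ∧ e p 1 = 0 ∧
      (∀ q ∈ e.source, q ∈ L ↔ e q 0 = 0) ∧ ContinuousOn (fun q => e q 1) e.source ∧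
      InjOn (fun q => e q 1) (L ∩ e.source) := by
  obtain ⟨e, h1, h2, h3⟩ := hG.line L hL p hp hpD
  refine ⟨e, h1, h2, h3, (by fun_prop : Continuous fun y : Plane => y 1).comp_continuousOn
    e.continuousOn, fun y hy z hz hyz => e.injOn hy.2 hz.2 (Plane.ext ?_ hyz)⟩
  rw [(h3 y hy.2).1 hy.1, (h3 z hz.2).1 hz.1]

/-- Where only one curve of the grid passes, the path arrives and leaves along it, and injectivity
keeps it from turning back. This is the source of transversality to the meridian. -/
theorem IsGrid.eventually_mem_iff (hG : IsGrid 𝓑 D) (hc : ContinuousOn α (Icc a b))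
    (hi : InjOn α (Icc a b)) (hpw : IsPiecewise 𝓑 α a b) {t : ℝ} (ht : t ∈ Ioo a b)
    (htD : α t ∉ D) {L : Set S} (hL : L ∈ 𝓑) (hu : ∀ M ∈ 𝓑, α t ∈ M → M = L) :
    ∀ᶠ q in 𝓝 (α t), q ∈ α '' Icc a b ↔ q ∈ L := by
  obtain ⟨M, hM, hMt⟩ := hpw.1 t ⟨ht.1.le, ht.2⟩
  obtain ⟨N, hN, hNt⟩ := hpw.2 t ⟨ht.1, ht.2.le⟩
  obtain rfl := hu M hM (hMt.self_of_nhdsWithin self_mem_Ici)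
  obtain rfl := hu N hN (hNt.self_of_nhdsWithin self_mem_Iic)
  obtain ⟨e, h1, h2, h3, h4, h5⟩ :=
    hG.exists_coordinate hN (hMt.self_of_nhdsWithin self_mem_Ici) htD
  exact eventually_mem_iff_of_same_curve ht.1 ht.2 hc hi e.open_source h1 h4 h5 h2 hNt hMt

/-- At an interior point the path continues along one grid curve or turns from one to another; a
turn is a corner in the chart where the two curves are the axes, and can be straightened. At an end
point the path is a half-branch that leaves the boundary. -/
theorem IsGrid.isFlatAt (hG : IsGrid 𝓑 D) (hab : a < b) (hc : ContinuousOn α (Icc a b))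
    (hi : InjOn α (Icc a b)) (hpw : IsPiecewise 𝓑 α a b) (ha : α a ∈ D) (hb : α b ∈ D)
    (hD : ∀ t ∈ Ioo a b, α t ∉ D) {p : S} (hp : p ∈ α '' Icc a b) :
    IsFlatAt D (α '' Icc a b) p := by
  obtain ⟨t, ht, rfl⟩ := hp
  have hcoord : ∀ {L : Set S} {e : OpenPartialHomeomorph S HalfPlane},
      (∀ q ∈ e.source, (q ∈ D ↔ (e q).1 0 = 0) ∧ (q ∈ L ↔ (e q).1 1 = 0)) →
      ContinuousOn (fun q => (e q).1 0) e.source ∧ InjOn (fun q => (e q).1 0) (L ∩ e.source) := by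
    intro L e he
    refine ⟨(by fun_prop : Continuous fun y : HalfPlane => y.1 0).comp_continuousOn
      e.continuousOn, fun y hy z hz hyz => e.injOn hy.2 hz.2 (HalfPlane.ext hyz ?_)⟩
    rw [(he y hy.2).2.1 hy.1, (he z hz.2).2.1 hz.1]
  have hfreq : ∀ s : Set ℝ, s ⊆ Ioo a b → (𝓝[s] t).NeBot → 
      ∃ᶠ q in 𝓝 (α t), q ∈ α '' Icc a b ∧ q ∉ D := by
    intro s hs hne
    have h1 : ∀ᶠ x in 𝓝[s] t, α x ∈ α '' Icc a b ∧ α x ∉ D := by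
      filter_upwards [self_mem_nhdsWithin] with x hx
      exact ⟨mem_image_of_mem _ (Ioo_subset_Icc_self (hs hx)), hD x (hs hx)⟩
    exact ((hc t ht).mono (hs.trans Ioo_subset_Icc_self)).frequently h1.frequently
  rcases ht.1.eq_or_lt with rfl | hat
  · obtain ⟨L, hL, hLt⟩ := hpw.1 a ⟨le_rfl, hab⟩
    obtain ⟨e, hpe, he⟩ := hG.boundary L hL _ (hLt.self_of_nhdsWithin self_mem_Ici) ha
    obtain ⟨k1, k2⟩ := hcoord he
    obtain ⟨σ, hσ, h⟩ := exists_branch_right hab hc hi e.open_source hpe k1 k2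
      ((he _ hpe).1.1 ha) hLt
    refine isFlatAt_of_half_branch hpe he hσ h (hfreq _ subset_rfl ?_)
    rw [nhdsWithin_Ioo_eq_nhdsGT hab]; infer_instance
  rcases ht.2.eq_or_lt with rfl | htb
  · obtain ⟨L, hL, hLt⟩ := hpw.2 t ⟨hat, le_rfl⟩
    obtain ⟨e, hpe, he⟩ := hG.boundary L hL _ (hLt.self_of_nhdsWithin self_mem_Iic) hb
    obtain ⟨k1, k2⟩ := hcoord he
    obtain ⟨σ, hσ, h⟩ := exists_branch_left hab hc hi e.open_source hpe k1 k2
      ((he _ hpe).1.1 hb) hLt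
    refine isFlatAt_of_half_branch hpe he hσ h (hfreq _ subset_rfl ?_)
    rw [nhdsWithin_Ioo_eq_nhdsLT hab]; infer_instance
  obtain ⟨M, hM, hMt⟩ := hpw.1 t ⟨hat.le, htb⟩
  obtain ⟨L, hL, hLt⟩ := hpw.2 t ⟨hat, htb.le⟩
  have htL := hLt.self_of_nhdsWithin self_mem_Iic
  have htM := hMt.self_of_nhdsWithin self_mem_Ici
  have htD := hD t ⟨hat, htb⟩
  by_cases hLM : L = M
  · subst hLM
    obtain ⟨e, h1, h2, h3, h4, h5⟩ := hG.exists_coordinate hL htL htD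
    have h6 := eventually_mem_iff_of_same_curve hat htb hc hi e.open_source h1 h4 h5 h2 hLt hMt
    refine isFlatAt_of_line hG.isClosed htD h1 ?_
    filter_upwards [h6, e.open_source.mem_nhds h1] with q hq hqe
    exact hq.trans (h3 q hqe)
  · obtain ⟨e, h1, h2⟩ := hG.cross L hL M hM hLM _ htL htM htD
    have he : ∀ i, ContinuousOn (fun q => e q i) e.source := fun i =>
      (by fun_prop : Continuous fun y : Plane => y i).comp_continuousOn e.continuousOn
    obtain ⟨σ, τ, hσ, hτ, h3⟩ := exists_two_branches hat htb hc hi e.open_source h1 (he 1)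
      (fun y hy z hz hyz => e.injOn hy.2 hz.2
        (Plane.ext (((h2 y hy.2).1.1 hy.1).trans ((h2 z hz.2).1.1 hz.1).symm) hyz))
      ((h2 _ h1).2.1 htM) (he 0)
      (fun y hy z hz hyz => e.injOn hy.2 hz.2
        (Plane.ext hyz (((h2 y hy.2).2.1 hy.1).trans ((h2 z hz.2).2.1 hz.1).symm)))
      ((h2 _ h1).1.1 htL) hLt hMt
    refine isFlatAt_of_corner hG.isClosed htD h1 hσ hτ ?_
    filter_upwards [h3, e.open_source.mem_nhds h1] with q hq hqe
    rw [hq, (h2 q hqe).1, (h2 q hqe).2]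

/-- `q` is the end point of an arc that consists of pieces of curves in `𝓑`, starts in `T` and runs
through `O`. -/
def GridReach (𝓑 : Set (Set S)) (O T : Set S) (q : S) : Prop :=
  ∃ (α : ℝ → S) (b : ℝ), 0 < b ∧ ContinuousOn α (Icc 0 b) ∧ InjOn α (Icc 0 b) ∧
    IsPiecewise 𝓑 α 0 b ∧ α 0 ∈ T ∧ (∀ s ∈ Ioo 0 b, α s ∈ O) ∧ α b = q

/-- `q` and `q'` are joined by a piece of a curve in `𝓑` that runs through `O`. -/
def GridSegment (𝓑 : Set (Set S)) (O : Set S) (q q' : S) : Prop :=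
  ∃ (σ : ℝ → S) (c : ℝ), 0 ≤ c ∧ ContinuousOn σ (Icc 0 c) ∧ InjOn σ (Icc 0 c) ∧
    (∃ L ∈ 𝓑, ∀ t ∈ Icc 0 c, σ t ∈ L) ∧ (∀ t ∈ Icc 0 c, σ t ∈ O) ∧ σ 0 = q ∧ σ c = q'

/-- The new segment is attached at its last point on the old path, and the old path is cut there. So
the result is injective however often the two meet. -/
theorem GridReach.extend {O T : Set S} {q : S} (h : GridReach 𝓑 O T q) (hOT : Disjoint O T)
    {σ : ℝ → S} {c : ℝ} (hc0 : 0 ≤ c) (hσ : ContinuousOn σ (Icc 0 c)) (hσi : InjOn σ (Icc 0 c))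
    {L : Set S} (hL : L ∈ 𝓑) (hσL : ∀ t ∈ Icc 0 c, σ t ∈ L) (hq : q ∈ O)
    (hO : ∀ t ∈ Ico 0 c, σ t ∈ O) (h0 : σ 0 = q) (hcT : σ c ∉ T) :
    GridReach 𝓑 O T (σ c) := by
  obtain ⟨α, b, hb, hα, hαi, hpw, hαT, hαO, rfl⟩ := h
  have hcl : IsClosed (α '' Icc 0 b) := (isCompact_Icc.image_of_continuousOn hα).isClosed
  obtain ⟨t, ⟨ht, s, hs, hst⟩, hmax⟩ :
      ∃ t, IsGreatest (Icc (0 : ℝ) c ∩ σ ⁻¹' (α '' Icc 0 b)) t := by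
    exact (isCompact_Icc.of_isClosed_subset (hσ.preimage_isClosed_of_isClosed isClosed_Icc hcl)
      inter_subset_left).exists_isGreatest ⟨0, ⟨le_rfl, hc0⟩, b, ⟨hb.le, le_rfl⟩, h0.symm⟩
  -- The cut is not at the start of the old path, because `σ` avoids `T`; a positive piece of the
  -- old path remains.
  have hs0 : 0 < s := by
    refine hs.1.lt_of_ne ?_
    rintro rfl
    rcases ht.2.eq_or_lt with rfl | htc
    · exact hcT (hst ▸ hαT)
    · exact disjoint_left.1 hOT (hO t ⟨ht.1, htc⟩) (hst ▸ hαT)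
  have hsub : Icc 0 s ⊆ Icc 0 b := Icc_subset_Icc_right hs.2
  have hsub' : Icc t c ⊆ Icc 0 c := Icc_subset_Icc_left ht.1
  refine ⟨arcJoin α σ s t, s + (c - t), by linarith [ht.2],
    arcJoin_continuousOn hs.1 ht.2 hst (hα.mono hsub) (hσ.mono hsub'),
    arcJoin_injOn (hαi.mono hsub) (hσi.mono hsub') ?_,
    (hpw.mono le_rfl hs.2).arcJoin hst (.of_subset hL fun x hx => hσL x (hsub' hx)), ?_, ?_, ?_⟩
  · intro x hx y hy hxy
    have := hmax ⟨⟨ht.1.trans hy.1.le, hy.2⟩, x, hsub hx, hxy⟩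
    exact absurd this (not_le.2 hy.1)
  · rwa [arcJoin_of_le hs0.le]
  · intro x hx
    rcases lt_or_ge x s with hxs | hxs
    · rw [arcJoin_of_le hxs.le]
      exact hαO x ⟨hx.1, hxs.trans_le hs.2⟩
    · rw [arcJoin_of_ge hst hxs]
      exact hO _ ⟨by linarith [ht.1], by linarith [hx.2]⟩
  · rw [arcJoin_of_ge hst (by linarith [ht.2])]
    congr 1; ring

omit [T2Space S] in
theorem GridSegment.symm {O : Set S} {q q' : S} (h : GridSegment 𝓑 O q q') :
    GridSegment 𝓑 O q' q := by
  obtain ⟨σ, c, hc, h1, h2, ⟨L, hL, h3⟩, h4, h5, h6⟩ := h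
  have hm : MapsTo (fun t : ℝ => c - t) (Icc 0 c) (Icc 0 c) := fun t ht =>
    ⟨by linarith [ht.2], by linarith [ht.1]⟩
  exact ⟨fun t => σ (c - t), c, hc, h1.comp (by fun_prop) hm,
    h2.comp (fun x _ y _ hxy => by simpa using hxy) hm,
    ⟨L, hL, fun t ht => h3 _ (hm ht)⟩, fun t ht => h4 _ (hm ht), by simpa using h6,
    by simpa using h5⟩

theorem GridReach.of_linked {O T : Set S} {q q' : S} (h : GridReach 𝓑 O T q) (hOT : Disjoint O T)
    (hqq' : Relation.ReflTransGen (GridSegment 𝓑 O) q q') : GridReach 𝓑 O T q' := by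
  induction hqq' with
  | refl => exact h
  | tail _ hs ih =>
    obtain ⟨σ, c, hc, h1, h2, ⟨L, hL, h3⟩, h4, h5, h6⟩ := hs
    subst h6
    exact ih.extend hOT hc h1 h2 hL h3 (h5 ▸ h4 0 ⟨le_rfl, hc⟩)
      (fun t ht => h4 t (Ico_subset_Icc_self ht)) h5
      fun hT => disjoint_left.1 hOT (h4 c ⟨hc, le_rfl⟩) hT

omit [T2Space S] in
theorem linked_symm {O : Set S} {q q' : S} (h : Relation.ReflTransGen (GridSegment 𝓑 O) q q') :
    Relation.ReflTransGen (GridSegment 𝓑 O) q' q := by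
  have : Std.Symm (GridSegment 𝓑 O) := ⟨fun _ _ => GridSegment.symm⟩
  exact Relation.ReflTransGen.stdSymm.symm _ _ h

/-- All points of curves in `𝓑` near `p` can be joined by pieces of curves in `𝓑` near `p`. -/
def LinkedAt (𝓑 : Set (Set S)) (D : Set S) (p : S) : Prop :=
  ∀ O, IsOpen O → p ∈ O → ∃ B ∈ 𝓝 p, ∃ h ∈ O, h ∉ D ∧ (∃ L ∈ 𝓑, h ∈ L) ∧
    ∀ q ∈ B, q ∉ D → (∃ L ∈ 𝓑, q ∈ L) → Relation.ReflTransGen (GridSegment 𝓑 (O \ D)) q h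

/-- Near `p` there is a piece of a curve in `𝓑` that starts in the boundary. -/
def BoundarySegmentAt (𝓑 : Set (Set S)) (D : Set S) (p : S) : Prop :=
  ∀ O, IsOpen O → p ∈ O → ∃ (σ : ℝ → S) (c : ℝ), 0 < c ∧ ContinuousOn σ (Icc 0 c) ∧
    InjOn σ (Icc 0 c) ∧ (∃ L ∈ 𝓑, ∀ t ∈ Icc 0 c, σ t ∈ L) ∧ (∀ t ∈ Icc 0 c, σ t ∈ O) ∧ σ 0 ∈ D ∧
    ∀ t ∈ Ioc 0 c, σ t ∉ D

/-- A connected set that joins the boundary circles outside `l` can be replaced by an arc made of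
pieces of curves in `𝓑`. -/
theorem IsGrid.exists_properArc {C₁ C₂ l K : Set S} (h1 : IsClosed C₁) (h2 : IsClosed C₂)
    (hd : Disjoint C₁ C₂) (hG : IsGrid 𝓑 (C₁ ∪ C₂)) (hlink : ∀ p, LinkedAt 𝓑 (C₁ ∪ C₂) p)
    (hbd : ∀ p ∈ C₁ ∪ C₂, BoundarySegmentAt 𝓑 (C₁ ∪ C₂) p) (hl : IsClosed l)
    (hK : IsPreconnected K) (hKl : Disjoint K l) (hK1 : (K ∩ C₁).Nonempty)
    (hK2 : (K ∩ C₂).Nonempty) :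
    ∃ A, IsProperArc C₁ C₂ A ∧ Disjoint A l ∧ (∀ p ∈ A, ∃ L ∈ 𝓑, p ∈ L) ∧
      ∀ p ∈ A, p ∉ C₁ ∪ C₂ → ∀ L ∈ 𝓑, (∀ M ∈ 𝓑, p ∈ M → M = L) →
        ∀ᶠ q in 𝓝 p, q ∈ A ↔ q ∈ L := by
  set D := C₁ ∪ C₂ with hD
  set O := lᶜ with hO
  have hOo : IsOpen O := hl.isOpen_compl
  set T := C₁ ∩ O with hT
  have hDT : Disjoint (O \ D) T := disjoint_left.2 fun q hq hqT => hq.2 (Or.inl hqT.1)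
  set R := GridReach 𝓑 (O \ D) T with hR
  -- The points around which all, respectively none, of the grid points off `D` can be reached from
  -- `C₁`.
  let u : Set S := {p | ∀ᶠ q in 𝓝 p, q ∉ D → (∃ L ∈ 𝓑, q ∈ L) → R q}
  let v : Set S := {p | ∀ᶠ q in 𝓝 p, q ∉ D → (∃ L ∈ 𝓑, q ∈ L) → ¬ R q}
  have huo : IsOpen u := isOpen_iff_mem_nhds.2 fun p hp => eventually_eventually_nhds.2 hp
  have hvo : IsOpen v := isOpen_iff_mem_nhds.2 fun p hp => eventually_eventually_nhds.2 hp
  have huv : Disjoint u v := by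
    rw [disjoint_left]
    intro p hpu hpv
    obtain ⟨W, hW, hWo, hpW⟩ := eventually_nhds_iff.1 (Eventually.and hpu hpv)
    -- Every neighbourhood contains a grid point off `D`, namely the hub of `LinkedAt`; so `u` and
    -- `v` cannot overlap.
    obtain ⟨-, -, h, hhW, hhD, hhL, -⟩ := hlink p W hWo hpW
    exact (hW h hhW).2 hhD hhL ((hW h hhW).1 hhD hhL)
  have hKO : ∀ p ∈ K, p ∈ O := fun p hp => disjoint_left.1 hKl hp
  have hKuv : K ⊆ u ∪ v := by
    intro p hp
    -- All grid points near `p` are linked to one hub inside `O`, so they are reachable together or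
    -- not at all.
    obtain ⟨B, hB, h, -, hhD, hhL, hlk⟩ := hlink p O hOo (hKO p hp)
    by_cases hhR : R h
    · left
      filter_upwards [hB] with q hq hqD hqL
      exact hhR.of_linked hDT (linked_symm (hlk q hq hqD hqL))
    · right
      filter_upwards [hB] with q hq hqD hqL hqR
      exact hhR (hqR.of_linked hDT (hlk q hq hqD hqL))
  have hKu : K ⊆ u := by
    refine hK.subset_left_of_subset_union huo hvo huv hKuv ?_
    obtain ⟨p, hpK, hp1⟩ := hK1
    -- A boundary segment that starts on `C₁` near `p` reaches its own end point, so `p` is not in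
    -- `v`.
    refine ⟨p, hpK, (hKuv hpK).resolve_right fun hpv => ?_⟩
    obtain ⟨W, hW, hWo, hpW⟩ := eventually_nhds_iff.1 hpv
    obtain ⟨σ, c, hc, k1, k2, ⟨L, hL, k3⟩, k4, k5, k6⟩ := hbd p (Or.inl hp1) (W ∩ (O ∩ C₂ᶜ))
      (hWo.inter (hOo.inter h2.isOpen_compl))
      ⟨hpW, hKO p hpK, fun h => disjoint_left.1 hd hp1 h⟩
    have hc' : c ∈ Icc 0 c := ⟨hc.le, le_rfl⟩
    have h0 := k4 0 ⟨le_rfl, hc.le⟩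
    refine hW (σ c) (k4 c hc').1 (k6 c ⟨hc, le_rfl⟩) ⟨L, hL, k3 c hc'⟩
      ⟨σ, c, hc, k1, k2, .of_subset hL k3, ⟨k5.resolve_right h0.2.2, h0.2.1⟩, fun s hs => ?_, rfl⟩
    exact ⟨(k4 s (Ioo_subset_Icc_self hs)).2.1, k6 s ⟨hs.1, hs.2.le⟩⟩
  obtain ⟨p, hpK, hp2⟩ := hK2
  obtain ⟨W, hW, hWo, hpW⟩ := eventually_nhds_iff.1 (show ∀ᶠ q in 𝓝 p, _ from hKu hpK)
  obtain ⟨σ, c, hc, k1, k2, ⟨L, hL, k3⟩, k4, k5, k6⟩ := hbd p (Or.inr hp2) (W ∩ (O ∩ C₁ᶜ))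
    (hWo.inter (hOo.inter h1.isOpen_compl))
    ⟨hpW, hKO p hpK, fun h => disjoint_left.1 hd h hp2⟩
  have hc' : c ∈ Icc 0 c := ⟨hc.le, le_rfl⟩
  have hRc : R (σ c) := hW (σ c) (k4 c hc').1 (k6 c ⟨hc, le_rfl⟩) ⟨L, hL, k3 c hc'⟩
  have hm : MapsTo (fun t : ℝ => c - t) (Icc 0 c) (Icc 0 c) := fun t ht =>
    ⟨by linarith [ht.2], by linarith [ht.1]⟩
  have h0 := k4 0 ⟨le_rfl, hc.le⟩
  -- The boundary segment at `C₂` is run backwards, so that the path ends on `C₂`.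
  have hz := hRc.extend hDT (σ := fun t => σ (c - t)) hc.le (k1.comp (by fun_prop) hm)
    (k2.comp (fun x _ y _ hxy => by simpa using hxy) hm) hL (fun t ht => k3 _ (hm ht))
    ⟨(k4 c hc').2.1, k6 c ⟨hc, le_rfl⟩⟩
    (fun t ht => ⟨(k4 _ (hm (Ico_subset_Icc_self ht))).2.1,
      k6 _ ⟨by linarith [ht.2], by linarith [ht.1]⟩⟩) (by simp)
    (by rw [sub_self]; exact fun h => h0.2.2 h.1)
  simp only [sub_self] at hz
  obtain ⟨α, b, hb, hα, hαi, hpw, hαT, hαO, hαb⟩ := hz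
  have hb2 : α b ∈ C₂ := hαb ▸ k5.resolve_left h0.2.2
  have hDt : ∀ t ∈ Icc 0 b, α t ∉ D → t ∈ Ioo 0 b := fun t ht hn =>
    ⟨ht.1.lt_of_ne (by rintro rfl; exact hn (Or.inl hαT.1)),
      ht.2.lt_of_ne (by rintro rfl; exact hn (Or.inr hb2))⟩
  refine ⟨α '' Icc 0 b, isProperArc_of_param hb hα hαi hαT.1 hb2 (fun t ht => (hαO t ht).2)
    fun p hp => hG.isFlatAt hb hα hαi hpw (Or.inl hαT.1) (Or.inr hb2) (fun t ht => (hαO t ht).2) hp,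
    ?_, ?_, ?_⟩
  · rw [disjoint_left]
    rintro _ ⟨t, ht, rfl⟩
    rcases ht.1.eq_or_lt with rfl | ht0
    · exact hαT.2
    rcases ht.2.eq_or_lt with rfl | htb
    · rw [hαb]; exact h0.2.1
    exact (hαO t ⟨ht0, htb⟩).1
  · rintro _ ⟨t, ht, rfl⟩
    rcases ht.2.eq_or_lt with rfl | htb
    · obtain ⟨L, hL, h⟩ := hpw.2 t ⟨hb, le_rfl⟩
      exact ⟨L, hL, h.self_of_nhdsWithin self_mem_Iic⟩
    · obtain ⟨L, hL, h⟩ := hpw.1 t ⟨ht.1, htb⟩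
      exact ⟨L, hL, h.self_of_nhdsWithin self_mem_Ici⟩
  · rintro _ ⟨t, ht, rfl⟩ hn L hL hu
    exact hG.eventually_mem_iff hα hαi hpw (hDt t ht hn) hn hL hu

end Grid

/-! ### Surfaces given by an equation `z² = f (x, y)` -/

theorem isOpen_box (a b ε : ℝ) : IsOpen {x : ℝ × ℝ | |x.1 - a| < ε ∧ |x.2 - b| < ε} := by
  have h1 : IsOpen {x : ℝ × ℝ | |x.1 - a| < ε} := isOpen_lt (by fun_prop) (by fun_prop)
  have h2 : IsOpen {x : ℝ × ℝ | |x.2 - b| < ε} := isOpen_lt (by fun_prop) (by fun_prop)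
  exact h1.inter h2

/-- The inverse function theorem for two functions on a level set. -/
theorem exists_local_param {F u v : ℝ × ℝ × ℝ → ℝ} {F' u' v' : ℝ × ℝ × ℝ →L[ℝ] ℝ}
    {p : ℝ × ℝ × ℝ} (hF : HasStrictFDerivAt F F' p) (hu : HasStrictFDerivAt u u' p)
    (hv : HasStrictFDerivAt v v' p) (hF0 : F p = 0)
    (hinj : ∀ w, u' w = 0 → v' w = 0 → F' w = 0 → w = 0) {O : Set (ℝ × ℝ × ℝ)} (hO : O ∈ 𝓝 p) :
    ∃ ε > 0, ∃ G : ℝ × ℝ → ℝ × ℝ × ℝ, ContinuousOn G {a | |a.1 - u p| < ε ∧ |a.2 - v p| < ε} ∧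
      (∀ a : ℝ × ℝ, |a.1 - u p| < ε → |a.2 - v p| < ε →
        u (G a) = a.1 ∧ v (G a) = a.2 ∧ F (G a) = 0 ∧ G a ∈ O) ∧
      ∀ᶠ q in 𝓝 p, F q = 0 → G (u q, v q) = q := by
  -- With `F` adjoined to `u` and `v` the derivative becomes invertible; the local inverse
  -- restricted to `F = 0` parametrizes the level set.
  set A : ℝ × ℝ × ℝ →L[ℝ] ℝ × ℝ × ℝ := u'.prod (v'.prod F') with hA
  have hAinj : Function.Injective A.toLinearMap := by
    refine (injective_iff_map_eq_zero _).2 fun w hw => ?_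
    have h1 : (u' w, v' w, F' w) = (0, 0, 0) := hw
    simp only [Prod.mk.injEq] at h1
    exact hinj w h1.1 h1.2.1 h1.2.2
  set B : (ℝ × ℝ × ℝ) ≃L[ℝ] ℝ × ℝ × ℝ :=
    (LinearEquiv.ofInjectiveEndo A.toLinearMap hAinj).toContinuousLinearEquiv with hB
  have hΨ : HasStrictFDerivAt (fun q => (u q, v q, F q)) (B : ℝ × ℝ × ℝ →L[ℝ] ℝ × ℝ × ℝ) p := by
    have hBA : (B : ℝ × ℝ × ℝ →L[ℝ] ℝ × ℝ × ℝ) = A := ContinuousLinearMap.ext fun w => rfl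
    rw [hBA]
    exact hu.prodMk (hv.prodMk hF)
  set e := hΨ.toOpenPartialHomeomorph (fun q => (u q, v q, F q)) with he
  have hec : ∀ q, e q = (u q, v q, F q) := fun q => by
    rw [he, HasStrictFDerivAt.toOpenPartialHomeomorph_coe]
  have hpe : p ∈ e.source := hΨ.mem_toOpenPartialHomeomorph_source
  have hnear : ∀ᶠ y in 𝓝 (e p), y ∈ e.target ∧ e.symm y ∈ O := by
    refine (e.open_target.eventually_mem (e.map_source hpe)).and ?_
    exact (e.symm.continuousAt (e.map_source hpe)).eventually (by simpa [e.left_inv hpe] using hO)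
  obtain ⟨ε, hε, hball⟩ := Metric.eventually_nhds_iff.1 hnear
  have hbox : ∀ a : ℝ × ℝ, |a.1 - u p| < ε → |a.2 - v p| < ε →
      (a.1, a.2, (0 : ℝ)) ∈ e.target ∧ e.symm (a.1, a.2, 0) ∈ O := by
    intro a h1 h2
    refine hball ?_
    rw [hec, hF0]
    simp only [Prod.dist_eq, Real.dist_eq, dist_self, max_lt_iff]
    exact ⟨h1, h2, hε⟩
  refine ⟨ε, hε, fun a => e.symm (a.1, a.2, 0), ?_, ?_, ?_⟩
  · exact e.continuousOn_symm.comp (by fun_prop) fun a ha => (hbox a ha.1 ha.2).1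
  · intro a h1 h2
    have h3 := e.right_inv (hbox a h1 h2).1
    rw [hec] at h3
    simp only [Prod.mk.injEq] at h3
    exact ⟨h3.1, h3.2.1, h3.2.2, (hbox a h1 h2).2⟩
  · filter_upwards [e.open_source.mem_nhds hpe] with q hq hFq
    have := e.left_inv hq
    rwa [hec, hFq] at this

/-- A chart of a level set from a local parametrization. -/
theorem exists_chart_of_param {E X : Type*} [TopologicalSpace E] [TopologicalSpace X] {M : Set E}
    {G : ℝ × ℝ → E} {box : Set (ℝ × ℝ)} (hbox : IsOpen box) (hG : ContinuousOn G box)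
    {toX : M → X} (htoX : Continuous toX) {κ : X → ℝ × ℝ} (hκ : Continuous κ)
    (hmem : ∀ y, κ y ∈ box → G (κ y) ∈ M) (hright : ∀ y (h : κ y ∈ box), toX ⟨_, hmem y h⟩ = y)
    {p : M} (hp : κ (toX p) ∈ box) (hleft : ∀ᶠ q in 𝓝 p, G (κ (toX q)) = q) :
    ∃ e : OpenPartialHomeomorph M X, p ∈ e.source ∧ ∀ q, e q = toX q := by
  classical
  obtain ⟨U, hU, hUo, hpU⟩ := eventually_nhds_iff.1 hleft
  let inv : X → M := fun y => if h : κ y ∈ box then ⟨_, hmem y h⟩ else p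
  have hinv : ∀ y, κ y ∈ box → (inv y : E) = G (κ y) := fun y h => by simp [inv, h]
  have hinv' : ∀ y, κ y ∈ box → toX (inv y) = y := fun y h => by simp [inv, h, hright]
  have hinvc : ContinuousOn inv (κ ⁻¹' box) := by
    rw [Topology.IsInducing.subtypeVal.continuousOn_iff]
    exact (hG.comp hκ.continuousOn fun y hy => hy).congr fun y hy => hinv y hy
  have hlinv : ∀ q ∈ U, κ (toX q) ∈ box → inv (toX q) = q := fun q hq h =>
    Subtype.ext ((hinv _ h).trans (hU q hq))
  refine ⟨{ toFun := toX, invFun := inv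
            source := U ∩ toX ⁻¹' (κ ⁻¹' box)
            target := κ ⁻¹' box ∩ inv ⁻¹' U
            map_source' := fun q hq => ⟨hq.2, ?_⟩
            map_target' := fun y hy => ⟨hy.2, ?_⟩
            left_inv' := fun q hq => hlinv q hq.1 hq.2
            right_inv' := fun y hy => hinv' y hy.1
            open_source := hUo.inter ((hbox.preimage hκ).preimage htoX)
            open_target := hinvc.isOpen_inter_preimage (hbox.preimage hκ) hUo
            continuousOn_toFun := htoX.continuousOn
            continuousOn_invFun := hinvc.mono inter_subset_left }, ⟨hpU, hp⟩, fun q => rfl⟩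
  · rw [mem_preimage, hlinv q hq.1 hq.2]
    exact hq.1
  · rw [mem_preimage, hinv' y hy.1]
    exact hy.1

/-- The surface with equation `z² = f (x, y)` over the region `0 ≤ b (x, y)`. -/
def graphSurface (f b : ℝ × ℝ → ℝ) : Set (ℝ × ℝ × ℝ) :=
  {p | 0 ≤ b (p.1, p.2.1) ∧ p.2.2 ^ 2 = f (p.1, p.2.1)}

section GraphSurface

variable {f b : ℝ × ℝ → ℝ}

/-- The boundary of the surface. -/
def graphBoundary (f b : ℝ × ℝ → ℝ) : Set (graphSurface f b) := {p | b (p.1.1, p.1.2.1) = 0}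

/-- The derivative of `(x, y, z) ↦ h (x, y)`. -/
noncomputable def planarDeriv (h : ℝ × ℝ → ℝ) (p : ℝ × ℝ × ℝ) : ℝ × ℝ × ℝ →L[ℝ] ℝ :=
  (fderiv ℝ h (p.1, p.2.1)).comp ((ContinuousLinearMap.fst ℝ ℝ (ℝ × ℝ)).prod
    ((ContinuousLinearMap.fst ℝ ℝ ℝ).comp (ContinuousLinearMap.snd ℝ ℝ (ℝ × ℝ))))

theorem planarDeriv_apply (h : ℝ × ℝ → ℝ) (p w : ℝ × ℝ × ℝ) :
    planarDeriv h p w = w.1 * fderiv ℝ h (p.1, p.2.1) (1, 0) +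
      w.2.1 * fderiv ℝ h (p.1, p.2.1) (0, 1) := by
  have h1 : ((w.1, w.2.1) : ℝ × ℝ) = w.1 • (1, 0) + w.2.1 • (0, 1) := by simp
  show fderiv ℝ h (p.1, p.2.1) (w.1, w.2.1) = _
  rw [h1, map_add, map_smul, map_smul, smul_eq_mul, smul_eq_mul]

theorem hasStrictFDerivAt_planar {h : ℝ × ℝ → ℝ} (hh : ContDiff ℝ 1 h) (p : ℝ × ℝ × ℝ) :
    HasStrictFDerivAt (fun q : ℝ × ℝ × ℝ => h (q.1, q.2.1)) (planarDeriv h p) p := by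
  have h1 : HasStrictFDerivAt h (fderiv ℝ h (p.1, p.2.1)) (p.1, p.2.1) :=
    hh.contDiffAt.hasStrictFDerivAt one_ne_zero
  exact HasStrictFDerivAt.comp (f := fun q : ℝ × ℝ × ℝ => (q.1, q.2.1)) p h1
    (ContinuousLinearMap.hasStrictFDerivAt ((ContinuousLinearMap.fst ℝ ℝ (ℝ × ℝ)).prod
    ((ContinuousLinearMap.fst ℝ ℝ ℝ).comp (ContinuousLinearMap.snd ℝ ℝ (ℝ × ℝ)))))

/-- The derivative of `(x, y, z) ↦ z`. -/
noncomputable def heightDeriv : ℝ × ℝ × ℝ →L[ℝ] ℝ :=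
  (ContinuousLinearMap.snd ℝ ℝ ℝ).comp (ContinuousLinearMap.snd ℝ ℝ (ℝ × ℝ))

theorem hasStrictFDerivAt_height (p : ℝ × ℝ × ℝ) :
    HasStrictFDerivAt (fun q : ℝ × ℝ × ℝ => q.2.2) heightDeriv p :=
  heightDeriv.hasStrictFDerivAt

theorem hasStrictFDerivAt_equation (hf : ContDiff ℝ 1 f) (p : ℝ × ℝ × ℝ) :
    HasStrictFDerivAt (fun q : ℝ × ℝ × ℝ => q.2.2 ^ 2 - f (q.1, q.2.1))
      ((2 * p.2.2) • heightDeriv - planarDeriv f p) p := by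
  have h1 := ((hasStrictFDerivAt_height p).pow 2).sub (hasStrictFDerivAt_planar hf p)
  have h2 : (2 * p.2.2) • heightDeriv = (2 • p.2.2 ^ (2 - 1)) • heightDeriv := by simp
  rw [h2]
  exact h1

/-- A pair of functions on the surface that are local coordinates at `p`. -/
structure IsCoordinatePair (f : ℝ × ℝ → ℝ) (u v : ℝ × ℝ × ℝ → ℝ) (p : ℝ × ℝ × ℝ) : Prop where
  continuous_fst : Continuous u
  continuous_snd : Continuous v
  exists_param : ∀ O ∈ 𝓝 p, ∃ ε > 0, ∃ G : ℝ × ℝ → ℝ × ℝ × ℝ,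
    ContinuousOn G {a | |a.1 - u p| < ε ∧ |a.2 - v p| < ε} ∧
      (∀ a : ℝ × ℝ, |a.1 - u p| < ε → |a.2 - v p| < ε →
        u (G a) = a.1 ∧ v (G a) = a.2 ∧ (G a).2.2 ^ 2 = f ((G a).1, (G a).2.1) ∧ G a ∈ O) ∧
      ∀ᶠ q in 𝓝 p, q.2.2 ^ 2 = f (q.1, q.2.1) → G (u q, v q) = q

/-- The tangent plane of `z² = f (x, y)` is `2 z dz = df`. The last hypothesis says that `du` and
`dv` are independent on it, so the inverse function theorem applies. -/
theorem isCoordinatePair_of_deriv (hf : ContDiff ℝ 1 f) {u v : ℝ × ℝ × ℝ → ℝ}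
    {u' v' : ℝ × ℝ × ℝ →L[ℝ] ℝ} {p : ℝ × ℝ × ℝ} (huc : Continuous u) (hvc : Continuous v)
    (hp : p.2.2 ^ 2 = f (p.1, p.2.1)) (hu : HasStrictFDerivAt u u' p)
    (hv : HasStrictFDerivAt v v' p)
    (hinj : ∀ w : ℝ × ℝ × ℝ, u' w = 0 → v' w = 0 → 2 * p.2.2 * w.2.2 = planarDeriv f p w → w = 0) :
    IsCoordinatePair f u v p := by
  refine ⟨huc, hvc, fun O hO => ?_⟩
  obtain ⟨ε, hε, G, h1, h2, h3⟩ := exists_local_param (hasStrictFDerivAt_equation hf p) hu hv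
    (sub_eq_zero.2 hp) (fun w k1 k2 k3 => hinj w k1 k2 (by
      simpa [sub_eq_zero, heightDeriv] using k3)) hO
  refine ⟨ε, hε, G, h1, fun a k1 k2 => ?_, h3.mono fun q hq hq' => hq (sub_eq_zero.2 hq')⟩
  obtain ⟨k3, k4, k5, k6⟩ := h2 a k1 k2
  exact ⟨k3, k4, sub_eq_zero.1 k5, k6⟩

theorem IsCoordinatePair.symm {u v : ℝ × ℝ × ℝ → ℝ} {p : ℝ × ℝ × ℝ}
    (h : IsCoordinatePair f u v p) : IsCoordinatePair f v u p := by
  refine ⟨h.continuous_snd, h.continuous_fst, fun O hO => ?_⟩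
  obtain ⟨ε, hε, G, h1, h2, h3⟩ := h.exists_param O hO
  refine ⟨ε, hε, fun a => G a.swap, h1.comp continuous_swap.continuousOn fun a ha => ⟨ha.2, ha.1⟩,
    fun a k1 k2 => ?_, h3⟩
  obtain ⟨k3, k4, k5⟩ := h2 a.swap k2 k1
  exact ⟨k4, k3, k5⟩

/-- Away from the fold `z = 0` each sheet is a graph over the plane. -/
theorem isCoordinatePair_planar (hf : ContDiff ℝ 1 f) {p : ℝ × ℝ × ℝ}
    (hp : p.2.2 ^ 2 = f (p.1, p.2.1)) (hz : p.2.2 ≠ 0) :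
    IsCoordinatePair f (fun q => q.1) (fun q => q.2.1) p := by
  refine isCoordinatePair_of_deriv hf (by fun_prop) (by fun_prop) hp
    (ContinuousLinearMap.fst ℝ ℝ (ℝ × ℝ)).hasStrictFDerivAt
    ((ContinuousLinearMap.fst ℝ ℝ ℝ).comp
      (ContinuousLinearMap.snd ℝ ℝ (ℝ × ℝ))).hasStrictFDerivAt ?_
  rintro ⟨w1, w2, w3⟩ h1 h2 h3
  simp only [planarDeriv_apply, ContinuousLinearMap.comp_apply, ContinuousLinearMap.coe_fst',
    ContinuousLinearMap.coe_snd'] at h1 h2 h3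
  subst h1 h2
  simpa [hz] using h3

/-- On the fold the projection to the plane degenerates, but where `∂f/∂y ≠ 0` the equation
determines `y` from `x` and `z`. -/
theorem isCoordinatePair_fst_height (hf : ContDiff ℝ 1 f) {p : ℝ × ℝ × ℝ}
    (hp : p.2.2 ^ 2 = f (p.1, p.2.1)) (hy : fderiv ℝ f (p.1, p.2.1) (0, 1) ≠ 0) :
    IsCoordinatePair f (fun q => q.1) (fun q => q.2.2) p := by
  refine isCoordinatePair_of_deriv hf (by fun_prop) (by fun_prop) hp
    (ContinuousLinearMap.fst ℝ ℝ (ℝ × ℝ)).hasStrictFDerivAt (hasStrictFDerivAt_height p) ?_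
  rintro ⟨w1, w2, w3⟩ h1 h2 h3
  simp only [planarDeriv_apply, heightDeriv, ContinuousLinearMap.comp_apply,
    ContinuousLinearMap.coe_fst', ContinuousLinearMap.coe_snd'] at h1 h2 h3
  subst h1 h2
  simpa [hy] using h3.symm

theorem isCoordinatePair_snd_height (hf : ContDiff ℝ 1 f) {p : ℝ × ℝ × ℝ}
    (hp : p.2.2 ^ 2 = f (p.1, p.2.1)) (hx : fderiv ℝ f (p.1, p.2.1) (1, 0) ≠ 0) :
    IsCoordinatePair f (fun q => q.2.1) (fun q => q.2.2) p := by
  refine isCoordinatePair_of_deriv hf (by fun_prop) (by fun_prop) hp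
    ((ContinuousLinearMap.fst ℝ ℝ ℝ).comp
      (ContinuousLinearMap.snd ℝ ℝ (ℝ × ℝ))).hasStrictFDerivAt (hasStrictFDerivAt_height p) ?_
  rintro ⟨w1, w2, w3⟩ h1 h2 h3
  simp only [planarDeriv_apply, heightDeriv, ContinuousLinearMap.comp_apply,
    ContinuousLinearMap.coe_fst', ContinuousLinearMap.coe_snd'] at h1 h2 h3
  subst h1 h2
  simpa [hx] using h3.symm

/-- A chart at the boundary needs `b` as a coordinate; where `∂b/∂y ≠ 0` it can take the place of
`y`. -/
theorem isCoordinatePair_boundary_fst (hf : ContDiff ℝ 1 f) (hb : ContDiff ℝ 1 b) {p : ℝ × ℝ × ℝ}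
    (hp : p.2.2 ^ 2 = f (p.1, p.2.1)) (hz : p.2.2 ≠ 0)
    (hy : fderiv ℝ b (p.1, p.2.1) (0, 1) ≠ 0) :
    IsCoordinatePair f (fun q => b (q.1, q.2.1)) (fun q => q.1) p := by
  refine isCoordinatePair_of_deriv hf (hb.continuous.comp (by fun_prop)) (by fun_prop) hp
    (hasStrictFDerivAt_planar hb p) (ContinuousLinearMap.fst ℝ ℝ (ℝ × ℝ)).hasStrictFDerivAt ?_
  rintro ⟨w1, w2, w3⟩ h1 h2 h3
  simp only [planarDeriv_apply, ContinuousLinearMap.coe_fst'] at h1 h2 h3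
  subst h2
  obtain rfl : w2 = 0 := by simpa [hy] using h1
  simpa [hz] using h3

theorem isCoordinatePair_boundary_snd (hf : ContDiff ℝ 1 f) (hb : ContDiff ℝ 1 b) {p : ℝ × ℝ × ℝ}
    (hp : p.2.2 ^ 2 = f (p.1, p.2.1)) (hz : p.2.2 ≠ 0)
    (hx : fderiv ℝ b (p.1, p.2.1) (1, 0) ≠ 0) :
    IsCoordinatePair f (fun q => b (q.1, q.2.1)) (fun q => q.2.1) p := by
  refine isCoordinatePair_of_deriv hf (hb.continuous.comp (by fun_prop)) (by fun_prop) hp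
    (hasStrictFDerivAt_planar hb p) ((ContinuousLinearMap.fst ℝ ℝ ℝ).comp
      (ContinuousLinearMap.snd ℝ ℝ (ℝ × ℝ))).hasStrictFDerivAt ?_
  rintro ⟨w1, w2, w3⟩ h1 h2 h3
  simp only [planarDeriv_apply, ContinuousLinearMap.comp_apply, ContinuousLinearMap.coe_fst',
    ContinuousLinearMap.coe_snd'] at h1 h2 h3
  subst h2
  obtain rfl : w1 = 0 := by simpa [hx] using h1
  simpa [hz] using h3

/-- Local coordinates give a chart at an interior point. -/
theorem IsCoordinatePair.exists_chart (hb : Continuous b) {u v : ℝ × ℝ × ℝ → ℝ}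
    {p : graphSurface f b} (h : IsCoordinatePair f u v p.1) (hp : p ∉ graphBoundary f b) :
    ∃ e : OpenPartialHomeomorph (graphSurface f b) Plane, p ∈ e.source ∧
      ∀ q, e q 0 = u q.1 - u p.1 ∧ e q 1 = v q.1 - v p.1 := by
  have hbp : 0 < b (p.1.1, p.1.2.1) := p.2.1.lt_of_ne (Ne.symm hp)
  have hO : {q : ℝ × ℝ × ℝ | 0 < b (q.1, q.2.1)} ∈ 𝓝 p.1 :=
    (isOpen_lt continuous_const (hb.comp (by fun_prop))).mem_nhds hbp
  obtain ⟨ε, hε, G, h1, h2, h3⟩ := h.exists_param _ hO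
  have huc := h.continuous_fst
  have hvc := h.continuous_snd
  obtain ⟨e, hpe, he⟩ := exists_chart_of_param (M := graphSurface f b) (p := p)
    (box := {a : ℝ × ℝ | |a.1 - u p.1| < ε ∧ |a.2 - v p.1| < ε})
    (isOpen_box _ _ _) h1
    (toX := fun q => (!₂[u q.1 - u p.1, v q.1 - v p.1] : Plane))
    (by
      refine (PiLp.continuous_toLp 2 _).comp (continuous_pi fun i => ?_)
      fin_cases i <;> simp <;> fun_prop)
    (κ := fun y => (y 0 + u p.1, y 1 + v p.1)) (by fun_prop)
    (fun y hy => ⟨(h2 _ hy.1 hy.2).2.2.2.le, (h2 _ hy.1 hy.2).2.2.1⟩)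
    (fun y hy => Plane.ext (by simp [(h2 _ hy.1 hy.2).1]) (by simp [(h2 _ hy.1 hy.2).2.1]))
    (by simpa using hε)
    (by
      filter_upwards [continuous_subtype_val.continuousAt.eventually h3] with q hq
      simpa using hq q.2.2)
  exact ⟨e, hpe, fun q => by simp [he]⟩

/-- Local coordinates give a chart at a boundary point. -/
theorem IsCoordinatePair.exists_boundary_chart {v : ℝ × ℝ × ℝ → ℝ}
    {p : graphSurface f b} (h : IsCoordinatePair f (fun q => b (q.1, q.2.1)) v p.1)
    (hp : p ∈ graphBoundary f b) :
    ∃ e : OpenPartialHomeomorph (graphSurface f b) HalfPlane, p ∈ e.source ∧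
      ∀ q, (e q).1 0 = b (q.1.1, q.1.2.1) ∧ (e q).1 1 = v q.1 - v p.1 := by
  have hbp : b (p.1.1, p.1.2.1) = 0 := hp
  obtain ⟨ε, hε, G, h1, h2, h3⟩ := h.exists_param univ univ_mem
  have hbc := h.continuous_fst
  have hvc := h.continuous_snd
  obtain ⟨e, hpe, he⟩ := exists_chart_of_param (M := graphSurface f b) (p := p)
    (box := {a : ℝ × ℝ | |a.1 - b (p.1.1, p.1.2.1)| < ε ∧ |a.2 - v p.1| < ε})
    (isOpen_box _ _ _) h1
    (toX := fun q => (⟨!₂[b (q.1.1, q.1.2.1), v q.1 - v p.1], by simpa using q.2.1⟩ : HalfPlane))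
    (by
      refine Continuous.subtype_mk
        ((PiLp.continuous_toLp 2 _).comp (continuous_pi fun i => ?_)) _
      fin_cases i
      · exact hbc.comp continuous_subtype_val
      · simp; fun_prop)
    (κ := fun y => (y.1 0, y.1 1 + v p.1)) (by fun_prop)
    (fun y hy => ⟨by rw [(h2 _ hy.1 hy.2).1]; exact y.2, (h2 _ hy.1 hy.2).2.2.1⟩)
    (fun y hy => HalfPlane.ext (by simp [(h2 _ hy.1 hy.2).1]) (by simp [(h2 _ hy.1 hy.2).2.1]))
    (by simpa using hε)
    (by
      filter_upwards [continuous_subtype_val.continuousAt.eventually h3] with q hq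
      simpa using hq q.2.2)
  exact ⟨e, hpe, fun q => by simp [he]⟩

end GraphSurface

/-! ### The grid cut out by coordinate lines -/

theorem gridSegment_of_curve {S : Type*} [TopologicalSpace S] {𝓑 : Set (Set S)} {O L : Set S}
    {s : ℝ → S} {I : Set ℝ} (hI : I.OrdConnected) (hs : ContinuousOn s I) (hi : InjOn s I)
    (hL : L ∈ 𝓑) (hsL : ∀ x ∈ I, s x ∈ L) (hO : ∀ x ∈ I, s x ∈ O) {x y : ℝ} (hx : x ∈ I)
    (hy : y ∈ I) : GridSegment 𝓑 O (s x) (s y) := by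
  rcases eq_or_ne x y with rfl | hxy
  · refine ⟨fun _ => s x, 0, le_rfl, continuousOn_const, ?_, ⟨L, hL, fun _ _ => hsL x hx⟩,
      fun _ _ => hO x hx, rfl, rfl⟩
    rw [Icc_self]
    exact injOn_singleton _ _
  · have hm : MapsTo (fun t : ℝ => x + t * (y - x)) (Icc 0 1) I := by
      intro t ht
      have hc : Convex ℝ I := hI.convex
      have := hc hx hy (sub_nonneg.2 ht.2) ht.1 (by ring)
      convert this using 1
      simp only [smul_eq_mul]; ring
    refine ⟨fun t => s (x + t * (y - x)), 1, zero_le_one, hs.comp (by fun_prop) hm,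
      hi.comp (fun t _ t' _ h => ?_) hm, ⟨L, hL, fun t ht => hsL _ (hm ht)⟩,
      fun t ht => hO _ (hm ht), by simp, by simp⟩
    exact mul_right_cancel₀ (sub_ne_zero.2 hxy.symm) (add_left_cancel h)

theorem ordConnected_abs_sub_lt (a ε : ℝ) : OrdConnected {x : ℝ | |x - a| < ε} := by
  have : {x : ℝ | |x - a| < ε} = Metric.ball a ε := by
    ext; simp [Real.dist_eq]
  rw [this, Real.ball_eq_Ioo]
  exact ordConnected_Ioo

theorem Dense.exists_abs_sub_lt {X : Set ℝ} (hX : Dense X) (a : ℝ) {ε : ℝ} (hε : 0 < ε) :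
    ∃ c ∈ X, |c - a| < ε := by
  obtain ⟨c, hc, h⟩ := hX.exists_dist_lt a hε
  exact ⟨c, hc, by rwa [dist_comm, Real.dist_eq] at h⟩

/-- The conditions under which the lines `x = c`, `c ∈ X`, and `y = d`, `d ∈ Y`, cut out a grid on
the surface `z² = f (x, y)`, `0 ≤ b (x, y)`. -/
structure IsGridSurface (f b : ℝ × ℝ → ℝ) (X Y : Set ℝ) : Prop where
  contDiff_f : ContDiff ℝ 1 f
  contDiff_b : ContDiff ℝ 1 b
  ne_zero_of_boundary : ∀ a, b a = 0 → f a ≠ 0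
  fold_fst : ∀ a, f a = 0 → 0 ≤ b a → a.1 ∈ X → fderiv ℝ f a (0, 1) ≠ 0
  fold_snd : ∀ a, f a = 0 → 0 ≤ b a → a.2 ∈ Y → fderiv ℝ f a (1, 0) ≠ 0
  boundary_fst : ∀ a, b a = 0 → a.1 ∈ X → fderiv ℝ b a (0, 1) ≠ 0
  boundary_snd : ∀ a, b a = 0 → a.2 ∈ Y → fderiv ℝ b a (1, 0) ≠ 0
  cross : ∀ a, a.1 ∈ X → a.2 ∈ Y → f a ≠ 0
  fold : ∀ a, f a = 0 → 0 ≤ b a → fderiv ℝ f a (1, 0) ≠ 0 ∨ fderiv ℝ f a (0, 1) ≠ 0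
  boundary : ∀ a, b a = 0 → fderiv ℝ b a (1, 0) ≠ 0 ∨ fderiv ℝ b a (0, 1) ≠ 0
  dense_fst : Dense X
  dense_snd : Dense Y

/-- The curves cut out on the surface by the lines `x = c`, `c ∈ X`, and `y = d`, `d ∈ Y`. -/
def gridCurves (f b : ℝ × ℝ → ℝ) (X Y : Set ℝ) : Set (Set (graphSurface f b)) :=
  {L | (∃ c ∈ X, L = {q | q.1.1 = c}) ∨ ∃ d ∈ Y, L = {q | q.1.2.1 = d}}

section GridSurface

variable {f b : ℝ × ℝ → ℝ} {X Y : Set ℝ}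

theorem fst_mem_gridCurves {c : ℝ} (hc : c ∈ X) :
    {q : graphSurface f b | q.1.1 = c} ∈ gridCurves f b X Y := Or.inl ⟨c, hc, rfl⟩

theorem snd_mem_gridCurves {d : ℝ} (hd : d ∈ Y) :
    {q : graphSurface f b | q.1.2.1 = d} ∈ gridCurves f b X Y := Or.inr ⟨d, hd, rfl⟩

theorem exists_mem_gridCurves_iff {q : graphSurface f b} :
    (∃ L ∈ gridCurves f b X Y, q ∈ L) ↔ q.1.1 ∈ X ∨ q.1.2.1 ∈ Y := by
  constructor
  · rintro ⟨L, ⟨c, hc, rfl⟩ | ⟨c, hc, rfl⟩, hq⟩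
    · exact Or.inl ((show q.1.1 = c from hq) ▸ hc)
    · exact Or.inr ((show q.1.2.1 = c from hq) ▸ hc)
  · rintro (h | h)
    · exact ⟨_, fst_mem_gridCurves h, rfl⟩
    · exact ⟨_, snd_mem_gridCurves h, rfl⟩

theorem height_ne_zero {q : graphSurface f b} (h : f (q.1.1, q.1.2.1) ≠ 0) : q.1.2.2 ≠ 0 := by
  intro h0
  have := q.2.2
  rw [h0] at this
  exact h (by simpa using this.symm)

theorem graph_eq_zero {q : graphSurface f b} (h : q.1.2.2 = 0) : f (q.1.1, q.1.2.1) = 0 := by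
  have := q.2.2
  rw [h] at this
  simpa using this.symm

theorem isClosed_graphBoundary (hb : Continuous b) : IsClosed (graphBoundary f b) :=
  isClosed_eq (hb.comp (by fun_prop)) continuous_const

/-- The coordinate `x` or `y` that is constant on a grid curve is completed to local coordinates by
the other one off the fold, by `z` on the fold and by `b` at the boundary. Curves of the two
families cross only off the fold, where `(x, y)` is a chart. -/
theorem IsGridSurface.isGrid (h : IsGridSurface f b X Y) :
    IsGrid (gridCurves f b X Y) (graphBoundary f b) where
  isClosed := isClosed_graphBoundary h.contDiff_b.continuous
  line := by
    rintro L (⟨c, hc, rfl⟩ | ⟨c, hc, rfl⟩) p hp hpD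
    · have hp : p.1.1 = c := hp
      subst hp
      obtain ⟨v, hv⟩ : ∃ v, IsCoordinatePair f (fun q => q.1) v p.1 := by
        by_cases hz : p.1.2.2 = 0
        · exact ⟨_, isCoordinatePair_fst_height h.contDiff_f p.2.2
            (h.fold_fst _ (graph_eq_zero hz) p.2.1 hc)⟩
        · exact ⟨_, isCoordinatePair_planar h.contDiff_f p.2.2 hz⟩
      obtain ⟨e, hpe, he⟩ := hv.exists_chart h.contDiff_b.continuous hpD
      exact ⟨e, hpe, by simp [he], fun q _ => by simp [he, sub_eq_zero]⟩
    · have hp : p.1.2.1 = c := hp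
      subst hp
      obtain ⟨v, hv⟩ : ∃ v, IsCoordinatePair f (fun q => q.2.1) v p.1 := by
        by_cases hz : p.1.2.2 = 0
        · exact ⟨_, isCoordinatePair_snd_height h.contDiff_f p.2.2
            (h.fold_snd _ (graph_eq_zero hz) p.2.1 hc)⟩
        · exact ⟨_, (isCoordinatePair_planar h.contDiff_f p.2.2 hz).symm⟩
      obtain ⟨e, hpe, he⟩ := hv.exists_chart h.contDiff_b.continuous hpD
      exact ⟨e, hpe, by simp [he], fun q _ => by simp [he, sub_eq_zero]⟩
  cross := by
    have key : ∀ p : graphSurface f b, p.1.1 ∈ X → p.1.2.1 ∈ Y → p ∉ graphBoundary f b →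
        IsCoordinatePair f (fun q => q.1) (fun q => q.2.1) p.1 := fun p hx hy _ =>
      isCoordinatePair_planar h.contDiff_f p.2.2 (height_ne_zero (h.cross _ hx hy))
    rintro L (⟨c, hc, rfl⟩ | ⟨c, hc, rfl⟩) M (⟨d, hd, rfl⟩ | ⟨d, hd, rfl⟩) hLM p hp hp' hpD
    · have hp : p.1.1 = c := hp
      have hp' : p.1.1 = d := hp'
      exact absurd (by rw [← hp, ← hp']) hLM
    · have hp : p.1.1 = c := hp
      have hp' : p.1.2.1 = d := hp'
      subst hp hp'
      obtain ⟨e, hpe, he⟩ := (key p hc hd hpD).exists_chart h.contDiff_b.continuous hpD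
      exact ⟨e, hpe, fun q _ => by simp [he, sub_eq_zero]⟩
    · have hp : p.1.2.1 = c := hp
      have hp' : p.1.1 = d := hp'
      subst hp hp'
      obtain ⟨e, hpe, he⟩ := (key p hd hc hpD).symm.exists_chart h.contDiff_b.continuous hpD
      exact ⟨e, hpe, fun q _ => by simp [he, sub_eq_zero]⟩
    · have hp : p.1.2.1 = c := hp
      have hp' : p.1.2.1 = d := hp'
      exact absurd (by rw [← hp, ← hp']) hLM
  boundary := by
    rintro L (⟨c, hc, rfl⟩ | ⟨c, hc, rfl⟩) p hp hpD
    · have hp : p.1.1 = c := hp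
      subst hp
      obtain ⟨e, hpe, he⟩ := (isCoordinatePair_boundary_fst h.contDiff_f h.contDiff_b p.2.2
        (height_ne_zero (h.ne_zero_of_boundary _ hpD))
        (h.boundary_fst _ hpD hc)).exists_boundary_chart hpD
      exact ⟨e, hpe, fun q _ => by simp [he, sub_eq_zero, graphBoundary]⟩
    · have hp : p.1.2.1 = c := hp
      subst hp
      obtain ⟨e, hpe, he⟩ := (isCoordinatePair_boundary_snd h.contDiff_f h.contDiff_b p.2.2
        (height_ne_zero (h.ne_zero_of_boundary _ hpD))
        (h.boundary_snd _ hpD hc)).exists_boundary_chart hpD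
      exact ⟨e, hpe, fun q _ => by simp [he, sub_eq_zero, graphBoundary]⟩

/-- The piece of the curve `y = d` over an interval around `x₀`, in one of the two sheets. -/
theorem exists_section (hf : Continuous f) (hb : Continuous b) {x₀ d ζ : ℝ} (hζ : ζ * ζ = 1)
    (h1 : 0 < f (x₀, d)) (h2 : 0 < b (x₀, d)) {V : Set (ℝ × ℝ × ℝ)}
    (hV : V ∈ 𝓝 (x₀, d, ζ * √(f (x₀, d)))) :
    ∃ δ > 0, ∃ s : ℝ → graphSurface f b, ContinuousOn s {a | |a - x₀| < δ} ∧
      ∀ a, |a - x₀| < δ → (s a).1 = (a, d, ζ * √(f (a, d))) ∧ s a ∉ graphBoundary f b ∧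
        (s a).1 ∈ V := by
  classical
  have hc : Continuous fun a : ℝ => (a, d, ζ * √(f (a, d))) := by fun_prop
  have hnear : ∀ᶠ a in 𝓝 x₀, 0 < f (a, d) ∧ 0 < b (a, d) ∧ (a, d, ζ * √(f (a, d))) ∈ V := by
    have k1 : Continuous fun a : ℝ => f (a, d) := by fun_prop
    have k2 : Continuous fun a : ℝ => b (a, d) := by fun_prop
    exact (k1.continuousAt.eventually (lt_mem_nhds h1)).and
      ((k2.continuousAt.eventually (lt_mem_nhds h2)).and (hc.continuousAt.eventually hV))
  obtain ⟨δ, hδ, hball⟩ := Metric.eventually_nhds_iff.1 hnear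
  have hmem : ∀ a, |a - x₀| < δ → (a, d, ζ * √(f (a, d))) ∈ graphSurface f b := fun a ha => by
    obtain ⟨k1, k2, -⟩ := hball (by rwa [Real.dist_eq])
    refine ⟨k2.le, ?_⟩
    show (ζ * √(f (a, d))) ^ 2 = f (a, d)
    rw [mul_pow, Real.sq_sqrt k1.le, sq, hζ, one_mul]
  let s : ℝ → graphSurface f b := fun a =>
    if h : |a - x₀| < δ then ⟨_, hmem a h⟩ else ⟨_, hmem x₀ (by simpa using hδ)⟩
  have hs : ∀ a, |a - x₀| < δ → (s a).1 = (a, d, ζ * √(f (a, d))) := fun a ha => by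
    simp only [s, dif_pos ha]
  refine ⟨δ, hδ, s, ?_, fun a ha => ⟨hs a ha, ?_, ?_⟩⟩
  · rw [Topology.IsInducing.subtypeVal.continuousOn_iff]
    exact hc.continuousOn.congr fun a ha => hs a ha
  · intro hcon
    have hcon : b ((s a).1.1, (s a).1.2.1) = 0 := hcon
    rw [hs a ha] at hcon
    exact (hball (by rwa [Real.dist_eq])).2.1.ne' hcon
  · rw [hs a ha]
    exact (hball (by rwa [Real.dist_eq])).2.2

theorem exists_sign (q : graphSurface f b) :
    ∃ ζ : ℝ, ζ * ζ = 1 ∧ q.1.2.2 = ζ * √(f (q.1.1, q.1.2.1)) := by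
  rw [← q.2.2, Real.sqrt_sq_eq_abs]
  rcases le_total 0 q.1.2.2 with h | h
  · exact ⟨1, by norm_num, by rw [abs_of_nonneg h, one_mul]⟩
  · exact ⟨-1, by norm_num, by rw [abs_of_nonpos h]; ring⟩

/-- A point on a curve `y = d` can be moved along the curve to a curve `x = c`. -/
theorem IsGridSurface.exists_linked_fst (h : IsGridSurface f b X Y) {q : graphSurface f b}
    (hqD : q ∉ graphBoundary f b) (hq : q.1.2.1 ∈ Y) {O : Set (graphSurface f b)} (hO : IsOpen O)
    (hqO : q ∈ O) : ∃ q' ∈ O, q' ∉ graphBoundary f b ∧ q'.1.1 ∈ X ∧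
      Relation.ReflTransGen (GridSegment (gridCurves f b X Y) (O \ graphBoundary f b)) q q' := by
  obtain ⟨V, hV, rfl⟩ := isOpen_induced_iff.1 hO
  have hreg : ∀ q : graphSurface f b, q ∉ graphBoundary f b → q.1.2.1 ∈ Y → q.1 ∈ V →
      q.1.2.2 ≠ 0 → ∃ q' : graphSurface f b, q'.1 ∈ V ∧ q' ∉ graphBoundary f b ∧ q'.1.1 ∈ X ∧
      GridSegment (gridCurves f b X Y) (Subtype.val ⁻¹' V \ graphBoundary f b) q q' := by
    intro q hqD hq hqV hz
    obtain ⟨ζ, hζ, hqζ⟩ := exists_sign q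
    have hqe : q.1 = (q.1.1, q.1.2.1, ζ * √(f (q.1.1, q.1.2.1))) := by rw [← hqζ]
    obtain ⟨δ, hδ, s, hs, hsa⟩ := exists_section (x₀ := q.1.1) (d := q.1.2.1)
      h.contDiff_f.continuous h.contDiff_b.continuous hζ
      (by rw [← q.2.2]; positivity) (q.2.1.lt_of_ne (Ne.symm hqD)) (hV.mem_nhds (hqe ▸ hqV))
    have h0 : q.1.1 ∈ {a : ℝ | |a - q.1.1| < δ} := by simpa using hδ
    have hsq : s q.1.1 = q := Subtype.ext ((hsa _ h0).1.trans hqe.symm)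
    obtain ⟨c, hc, hcδ⟩ := h.dense_fst.exists_abs_sub_lt q.1.1 hδ
    refine ⟨s c, (hsa c hcδ).2.2, (hsa c hcδ).2.1, by rwa [(hsa c hcδ).1], ?_⟩
    have := gridSegment_of_curve (ordConnected_abs_sub_lt q.1.1 δ) hs
      (fun x hx y hy hxy => by
        have := congrArg (fun r : graphSurface f b => r.1.1) hxy
        simpa [(hsa x hx).1, (hsa y hy).1] using this)
      (snd_mem_gridCurves (X := X) hq) (fun x hx => by
        show (s x).1.2.1 = _
        rw [(hsa x hx).1])
      (O := Subtype.val ⁻¹' V \ graphBoundary f b)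
      (fun x hx => ⟨(hsa x hx).2.2, (hsa x hx).2.1⟩) h0 hcδ
    rwa [hsq] at this
  -- On the fold `y` and `z` are coordinates: the curve is followed up to height `ε / 2`, and from
  -- there on it is a graph over the `x`-axis.
  by_cases hz : q.1.2.2 = 0
  · have hpair := isCoordinatePair_snd_height h.contDiff_f q.2.2
      (h.fold_snd _ (graph_eq_zero hz) q.2.1 hq)
    have hb' : IsOpen {r : ℝ × ℝ × ℝ | 0 < b (r.1, r.2.1)} :=
      isOpen_lt continuous_const (h.contDiff_b.continuous.comp (by fun_prop))
    obtain ⟨ε, hε, G, hG, hGa, hGq⟩ := hpair.exists_param _ ((hV.inter hb').mem_nhds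
      ⟨hqO, q.2.1.lt_of_ne (Ne.symm hqD)⟩)
    simp only [hz, sub_zero] at hG hGa
    have hd : |q.1.2.1 - q.1.2.1| < ε := by simpa using hε
    let s : ℝ → graphSurface f b := fun t => if ht : |t| < ε then
      ⟨G (q.1.2.1, t), (hGa (q.1.2.1, t) hd ht).2.2.2.2.le, (hGa (q.1.2.1, t) hd ht).2.2.1⟩ else q
    have hs : ∀ t, |t| < ε → (s t).1 = G (q.1.2.1, t) := fun t ht => by simp only [s, dif_pos ht]
    have hsc : ContinuousOn s {t | |t - 0| < ε} := by
      rw [Topology.IsInducing.subtypeVal.continuousOn_iff]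
      refine ContinuousOn.congr (f := fun t => G (q.1.2.1, t)) ?_ fun t ht =>
        hs t (by simpa using ht)
      exact hG.comp (by fun_prop) fun t ht => ⟨hd, by simpa using ht⟩
    have hsD : ∀ t, |t| < ε → s t ∉ graphBoundary f b := fun t ht hcon => by
      have hcon : b ((s t).1.1, (s t).1.2.1) = 0 := hcon
      rw [hs t ht] at hcon
      exact (hGa (q.1.2.1, t) hd ht).2.2.2.2.ne' hcon
    have h0 : |(0 : ℝ)| < ε := by simpa using hε
    have hε2 : |ε / 2| < ε := by rw [abs_of_pos (by positivity)]; linarith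
    have hs0 : s 0 = q := by
      refine Subtype.ext ?_
      rw [hs 0 h0]
      have := hGq.self_of_nhds q.2.2
      rwa [hz] at this
    have hsy : ∀ t, |t| < ε → (s t).1.2.1 = q.1.2.1 := fun t ht => by
      rw [hs t ht]; exact (hGa (q.1.2.1, t) hd ht).1
    have hsz : ∀ t, |t| < ε → (s t).1.2.2 = t := fun t ht => by
      rw [hs t ht]; exact (hGa (q.1.2.1, t) hd ht).2.1
    have hsV : ∀ t, |t| < ε → (s t).1 ∈ V := fun t ht => by
      rw [hs t ht]; exact (hGa (q.1.2.1, t) hd ht).2.2.2.1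
    have hseg := gridSegment_of_curve (ordConnected_abs_sub_lt 0 ε) hsc
      (fun x hx y hy hxy => by
        simp only [sub_zero, mem_ofPred_eq] at hx hy
        rw [← hsz x hx, hxy, hsz y hy])
      (snd_mem_gridCurves (X := X) hq) (fun x hx => hsy x (by simpa using hx))
      (O := Subtype.val ⁻¹' V \ graphBoundary f b)
      (fun x hx => ⟨hsV x (by simpa using hx), hsD x (by simpa using hx)⟩)
      (x := 0) (y := ε / 2) (by simpa using h0) (by simpa using hε2)
    rw [hs0] at hseg
    obtain ⟨q', k1, k2, k3, k4⟩ := hreg (s (ε / 2)) (hsD _ hε2) (by rwa [hsy _ hε2]) (hsV _ hε2)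
      (by rw [hsz _ hε2]; positivity)
    exact ⟨q', k1, k2, k3, .tail (.single hseg) k4⟩
  · obtain ⟨q', k1, k2, k3, k4⟩ := hreg q hqD hq hqO hz
    exact ⟨q', k1, k2, k3, .single k4⟩

end GridSurface

theorem exists_lift_subtype {E : Type*} [TopologicalSpace E] {M : Set E} (p : M) {g : ℝ → E}
    {I : Set ℝ} (hg : ContinuousOn g I) (hM : ∀ t ∈ I, g t ∈ M) :
    ∃ s : ℝ → M, ContinuousOn s I ∧ ∀ t ∈ I, (s t : E) = g t := by
  classical
  have hs : ∀ t ∈ I, ((if h : g t ∈ M then ⟨g t, h⟩ else p : M) : E) = g t := fun t ht => by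
    rw [dif_pos (hM t ht)]
  refine ⟨fun t => if h : g t ∈ M then ⟨g t, h⟩ else p, ?_, hs⟩
  rw [Topology.IsInducing.subtypeVal.continuousOn_iff]
  exact hg.congr hs

theorem GridSegment.mono {S : Type*} [TopologicalSpace S] {𝓑 : Set (Set S)} {O O' : Set S}
    (hO : O ⊆ O') {q q' : S} (h : GridSegment 𝓑 O q q') : GridSegment 𝓑 O' q q' := by
  obtain ⟨σ, c, hc, h1, h2, h3, h4, h5⟩ := h
  exact ⟨σ, c, hc, h1, h2, h3, fun t ht => hO (h4 t ht), h5⟩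

/-! ### Local connectivity of the grid -/

section GridSurface

variable {f b : ℝ × ℝ → ℝ} {X Y : Set ℝ}

/-- In the coordinates `x` and `w` the interior is `w ∈ W` with `W` an interval, so every curve `x =
c` is connected near `p`. One curve `y = d` close to `p`, in a suitable sheet, crosses all of them
and links them to a hub. A point on another curve `y = d'` is first moved to a curve `x = c`. -/
theorem IsGridSurface.linkedAt_of_pair (h : IsGridSurface f b X Y) {p : graphSurface f b}
    {w : ℝ × ℝ × ℝ → ℝ} (hw : IsCoordinatePair f (fun q => q.1) w p.1) {W : Set ℝ}
    (hWc : W.OrdConnected)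
    (hW : ∀ᶠ r in 𝓝 p.1, r.2.2 ^ 2 = f (r.1, r.2.1) → (0 < b (r.1, r.2.1) ↔ w r ∈ W))
    (hacc : ∃ᶠ d in 𝓝 p.1.2.1, 0 < f (p.1.1, d) ∧ 0 < b (p.1.1, d)) :
    LinkedAt (gridCurves f b X Y) (graphBoundary f b) p := by
  intro O hO hpO
  obtain ⟨V, hV, rfl⟩ := isOpen_induced_iff.1 hO
  have hfc := h.contDiff_f.continuous
  have hbc := h.contDiff_b.continuous
  have hwc := hw.continuous_snd
  obtain ⟨ε, hε, G, hG, hGa, hGq⟩ := hw.exists_param _ (inter_mem (hV.mem_nhds hpO) hW)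
  have hNev : ∀ᶠ r in 𝓝 p.1, r ∈ V ∧ |r.1 - p.1.1| < ε ∧ |w r - w p.1| < ε ∧
      (r.2.2 ^ 2 = f (r.1, r.2.1) → (0 < b (r.1, r.2.1) ↔ w r ∈ W)) ∧
      (r.2.2 ^ 2 = f (r.1, r.2.1) → G (r.1, w r) = r) := by
    have k1 : IsOpen {r : ℝ × ℝ × ℝ | |r.1 - p.1.1| < ε} := isOpen_lt (by fun_prop) (by fun_prop)
    have k2 : IsOpen {r : ℝ × ℝ × ℝ | |w r - w p.1| < ε} := isOpen_lt (by fun_prop) (by fun_prop)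
    exact (hV.eventually_mem hpO).and ((k1.eventually_mem (by simpa using hε)).and
      ((k2.eventually_mem (by simpa using hε)).and (hW.and hGq)))
  obtain ⟨N, hN, hNo, hpN⟩ := eventually_nhds_iff.1 hNev
  obtain ⟨ζ, hζ, hpζ⟩ := exists_sign p
  -- By `hacc` some level has an interior point of positive `f` over `x = p.1.1`, close to `p`; this
  -- is an open condition, so a level in the dense set `Y` can be taken.
  obtain ⟨d, hdY, hd1, hd2, hdN⟩ : ∃ d ∈ Y, 0 < f (p.1.1, d) ∧ 0 < b (p.1.1, d) ∧
      (p.1.1, d, ζ * √(f (p.1.1, d))) ∈ N := by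
    have hc : Continuous fun d : ℝ => (p.1.1, d, ζ * √(f (p.1.1, d))) := by fun_prop
    have k1 : IsOpen {d : ℝ | 0 < f (p.1.1, d)} := isOpen_lt (by fun_prop) (by fun_prop)
    have k2 : IsOpen {d : ℝ | 0 < b (p.1.1, d)} := isOpen_lt (by fun_prop) (by fun_prop)
    have hpe : (p.1.1, p.1.2.1, ζ * √(f (p.1.1, p.1.2.1))) ∈ N := by rwa [← hpζ]
    obtain ⟨d₀, hd₀, hd₀N⟩ := (hacc.and_eventually
      (hc.continuousAt.eventually (hNo.mem_nhds hpe))).exists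
    obtain ⟨d, ⟨h1, h2, h3⟩, hdY⟩ := h.dense_snd.inter_open_nonempty _
      (k1.inter (k2.inter (hNo.preimage hc))) ⟨d₀, hd₀.1, hd₀.2, hd₀N⟩
    exact ⟨d, hdY, h1, h2, h3⟩
  obtain ⟨δ, hδ, s, hsc, hs⟩ := exists_section hfc hbc hζ hd1 hd2 (hNo.mem_nhds hdN)
  obtain ⟨c, hcX, hcδ⟩ := h.dense_fst.exists_abs_sub_lt p.1.1 hδ
  set B : Set (graphSurface f b) := Subtype.val ⁻¹' (N ∩ {r | |r.1 - p.1.1| < δ}) with hB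
  have hBo : IsOpen B := by
    have k1 : IsOpen {r : ℝ × ℝ × ℝ | |r.1 - p.1.1| < δ} := isOpen_lt (by fun_prop) (by fun_prop)
    exact (hNo.inter k1).preimage continuous_subtype_val
  have hBV : B ⊆ Subtype.val ⁻¹' V := fun q hq => (hN q.1 hq.1).1
  have hpos : ∀ q : graphSurface f b, q ∉ graphBoundary f b → 0 < b (q.1.1, q.1.2.1) :=
    fun q hq => q.2.1.lt_of_ne (Ne.symm hq)
  have hhub : ∀ q ∈ B, q ∉ graphBoundary f b → q.1.1 ∈ X →
      Relation.ReflTransGen (GridSegment (gridCurves f b X Y)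
        (Subtype.val ⁻¹' V \ graphBoundary f b)) q (s c) := by
    intro q hq hqD hqX
    have hqδ : |q.1.1 - p.1.1| < δ := hq.2
    obtain ⟨-, hqε, hqw, hqW, hqG⟩ := hN q.1 hq.1
    obtain ⟨hs1, hsD, hsN⟩ := hs q.1.1 hqδ
    obtain ⟨-, -, hsw, hsW, hsG⟩ := hN _ hsN
    have hsx : (s q.1.1).1.1 = q.1.1 := by rw [hs1]
    set I : Set ℝ := {t | |t - w p.1| < ε} ∩ W with hI
    have hGI : ∀ t ∈ I, 0 < b ((G (q.1.1, t)).1, (G (q.1.1, t)).2.1) := fun t ht => by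
      obtain ⟨-, k2, k3, k4⟩ := hGa (q.1.1, t) hqε ht.1
      refine (k4.2 k3).2 ?_
      rw [k2]
      exact ht.2
    obtain ⟨σ, hσ, hσG⟩ := exists_lift_subtype (M := graphSurface f b) p
      (g := fun t => G (q.1.1, t)) (I := I)
      (hG.comp (by fun_prop) fun t ht => ⟨hqε, ht.1⟩)
      fun t ht => ⟨(hGI t ht).le, (hGa (q.1.1, t) hqε ht.1).2.2.1⟩
    have hσq : σ (w q.1) = q :=
      Subtype.ext ((hσG _ ⟨hqw, (hqW q.2.2).1 (hpos q hqD)⟩).trans (hqG q.2.2))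
    have hσs : σ (w (s q.1.1).1) = s q.1.1 := by
      refine Subtype.ext ((hσG _ ⟨hsw, (hsW (s _).2.2).1 (hpos _ hsD)⟩).trans ?_)
      have := hsG (s _).2.2
      rwa [hsx] at this
    have hseg := gridSegment_of_curve ((ordConnected_abs_sub_lt (w p.1) ε).inter hWc) hσ
      (fun x hx y hy hxy => by
        have := congrArg (fun r : graphSurface f b => w r.1) hxy
        simp only [hσG x hx, hσG y hy] at this
        rwa [(hGa (q.1.1, x) hqε hx.1).2.1, (hGa (q.1.1, y) hqε hy.1).2.1] at this)
      (fst_mem_gridCurves (Y := Y) hqX) (fun x hx => by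
        show (σ x).1.1 = _
        rw [hσG x hx]
        exact (hGa (q.1.1, x) hqε hx.1).1)
      (O := Subtype.val ⁻¹' V \ graphBoundary f b)
      (fun x hx => ⟨by
        show (σ x).1 ∈ V
        rw [hσG x hx]
        exact (hGa (q.1.1, x) hqε hx.1).2.2.2.1, fun hcon => by
        have hcon : b ((σ x).1.1, (σ x).1.2.1) = 0 := hcon
        rw [hσG x hx] at hcon
        exact (hGI x hx).ne' hcon⟩)
      ⟨hqw, (hqW q.2.2).1 (hpos q hqD)⟩ ⟨hsw, (hsW (s _).2.2).1 (hpos _ hsD)⟩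
    rw [hσq, hσs] at hseg
    refine .tail (.single hseg) (gridSegment_of_curve (ordConnected_abs_sub_lt p.1.1 δ) hsc
      (fun x hx y hy hxy => ?_) (snd_mem_gridCurves (X := X) hdY) (fun x hx => ?_)
      (O := Subtype.val ⁻¹' V \ graphBoundary f b)
      (fun x hx => ⟨(hN _ (hs x hx).2.2).1, (hs x hx).2.1⟩) hqδ hcδ)
    · have := congrArg (fun r : graphSurface f b => r.1.1) hxy
      simpa [(hs x hx).1, (hs y hy).1] using this
    · show (s x).1.2.1 = _
      rw [(hs x hx).1]
  refine ⟨B, hBo.mem_nhds (show p ∈ B from ⟨hpN, by simpa using hδ⟩), s c,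
    (hN _ (hs c hcδ).2.2).1, (hs c hcδ).2.1,
    ⟨_, snd_mem_gridCurves hdY, ?_⟩, fun q hq hqD hqL => ?_⟩
  · show (s c).1.2.1 = _
    rw [(hs c hcδ).1]
  · rcases exists_mem_gridCurves_iff.1 hqL with hqX | hqY
    · exact hhub q hq hqD hqX
    · obtain ⟨q', h1, h2, h3, h4⟩ := h.exists_linked_fst hqD hqY hBo hq
      exact (Relation.ReflTransGen.mono
        (fun _ _ => GridSegment.mono (sdiff_subset_sdiff_left hBV)) _ _ h4).trans (hhub q' h1 h2 h3)

/-- A function with a nonzero partial derivative takes positive values near each of its zeros. -/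
theorem frequently_pos_of_fderiv {φ : ℝ × ℝ → ℝ} (hφ : ContDiff ℝ 1 φ) {a c : ℝ}
    (h0 : φ (a, c) = 0) (h1 : fderiv ℝ φ (a, c) (0, 1) ≠ 0) : ∃ᶠ d in 𝓝 c, 0 < φ (a, d) := by
  intro hcon
  have hd : HasDerivAt (fun d => φ (a, d)) (fderiv ℝ φ (a, c) (0, 1)) c :=
    HasFDerivAt.comp_hasDerivAt (f := fun d : ℝ => (a, d)) c
      (hφ.differentiable one_ne_zero (a, c)).hasFDerivAt
      ((hasDerivAt_const c a).prodMk (hasDerivAt_id c))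
  have hm : IsLocalMax (fun d => φ (a, d)) c := by
    filter_upwards [hcon] with d hd
    rw [h0]
    exact not_lt.1 hd
  exact h1 (hm.hasDerivAt_eq_zero hd)

/-- The function that completes `x` to coordinates is `b` at the boundary, `z` on the fold and `y`
elsewhere. -/
theorem IsGridSurface.linkedAt_fst (h : IsGridSurface f b X Y) {p : graphSurface f b}
    (hpf : f (p.1.1, p.1.2.1) = 0 → fderiv ℝ f (p.1.1, p.1.2.1) (0, 1) ≠ 0)
    (hpb : b (p.1.1, p.1.2.1) = 0 → fderiv ℝ b (p.1.1, p.1.2.1) (0, 1) ≠ 0) :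
    LinkedAt (gridCurves f b X Y) (graphBoundary f b) p := by
  have hfc := h.contDiff_f.continuous
  have hbc := h.contDiff_b.continuous
  have hev : ∀ {φ : ℝ × ℝ → ℝ}, Continuous φ → 0 < φ (p.1.1, p.1.2.1) →
      ∀ᶠ d in 𝓝 p.1.2.1, 0 < φ (p.1.1, d) := fun {φ} hφ hpos => by
    have k1 : Continuous fun d : ℝ => φ (p.1.1, d) := by fun_prop
    exact k1.continuousAt.eventually (lt_mem_nhds hpos)
  by_cases hbp : b (p.1.1, p.1.2.1) = 0
  · have hf0 := h.ne_zero_of_boundary _ hbp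
    have hfpos : 0 < f (p.1.1, p.1.2.1) :=
      lt_of_le_of_ne (p.2.2 ▸ sq_nonneg _) hf0.symm
    exact h.linkedAt_of_pair (isCoordinatePair_boundary_fst h.contDiff_f h.contDiff_b p.2.2
      (height_ne_zero hf0) (hpb hbp)).symm (W := Ioi 0) ordConnected_Ioi
      (.of_forall fun r _ => Iff.rfl)
      (((frequently_pos_of_fderiv h.contDiff_b hbp (hpb hbp)).and_eventually
        (hev hfc hfpos)).mono fun d hd => hd.symm)
  · have hbpos : 0 < b (p.1.1, p.1.2.1) := p.2.1.lt_of_ne (Ne.symm hbp)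
    have hbo : IsOpen {r : ℝ × ℝ × ℝ | 0 < b (r.1, r.2.1)} :=
      isOpen_lt continuous_const (hbc.comp (by fun_prop))
    have hW : ∀ w : ℝ × ℝ × ℝ → ℝ, ∀ᶠ r in 𝓝 p.1, r.2.2 ^ 2 = f (r.1, r.2.1) →
        (0 < b (r.1, r.2.1) ↔ w r ∈ univ) := fun w => by
      filter_upwards [hbo.mem_nhds hbpos] with r hr _
      exact iff_of_true hr (mem_univ _)
    by_cases hz : f (p.1.1, p.1.2.1) = 0
    · exact h.linkedAt_of_pair (isCoordinatePair_fst_height h.contDiff_f p.2.2 (hpf hz))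
        ordConnected_univ (hW _) ((frequently_pos_of_fderiv h.contDiff_f hz (hpf hz)).and_eventually
          (hev hbc hbpos))
    · have hfpos : 0 < f (p.1.1, p.1.2.1) := lt_of_le_of_ne (p.2.2 ▸ sq_nonneg _) (Ne.symm hz)
      exact h.linkedAt_of_pair (isCoordinatePair_planar h.contDiff_f p.2.2 (height_ne_zero hz))
        ordConnected_univ (hW _) ((hev hfc hfpos).and (hev hbc hbpos)).frequently

/-! ### Exchanging the coordinates -/

theorem fderiv_comp_swap {φ : ℝ × ℝ → ℝ} (hφ : ContDiff ℝ 1 φ) (a w : ℝ × ℝ) :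
    fderiv ℝ (φ ∘ Prod.swap) a w = fderiv ℝ φ a.swap w.swap := by
  have h1 : HasFDerivAt (Prod.swap : ℝ × ℝ → ℝ × ℝ)
      (ContinuousLinearEquiv.prodComm ℝ ℝ ℝ : ℝ × ℝ →L[ℝ] ℝ × ℝ) a :=
    (ContinuousLinearEquiv.prodComm ℝ ℝ ℝ : ℝ × ℝ →L[ℝ] ℝ × ℝ).hasFDerivAt
  rw [((hφ.differentiable one_ne_zero a.swap).hasFDerivAt.comp a h1).fderiv]
  rfl

theorem IsGridSurface.swap (h : IsGridSurface f b X Y) :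
    IsGridSurface (f ∘ Prod.swap) (b ∘ Prod.swap) Y X where
  contDiff_f := h.contDiff_f.comp (contDiff_snd.prodMk contDiff_fst)
  contDiff_b := h.contDiff_b.comp (contDiff_snd.prodMk contDiff_fst)
  ne_zero_of_boundary a := h.ne_zero_of_boundary a.swap
  fold_fst a h1 h2 h3 := by
    rw [fderiv_comp_swap h.contDiff_f]; exact h.fold_snd a.swap h1 h2 h3
  fold_snd a h1 h2 h3 := by
    rw [fderiv_comp_swap h.contDiff_f]; exact h.fold_fst a.swap h1 h2 h3
  boundary_fst a h1 h2 := by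
    rw [fderiv_comp_swap h.contDiff_b]; exact h.boundary_snd a.swap h1 h2
  boundary_snd a h1 h2 := by
    rw [fderiv_comp_swap h.contDiff_b]; exact h.boundary_fst a.swap h1 h2
  cross a h1 h2 := h.cross a.swap h2 h1
  fold a h1 h2 := by
    rw [fderiv_comp_swap h.contDiff_f, fderiv_comp_swap h.contDiff_f]
    exact (h.fold a.swap h1 h2).symm
  boundary a h1 := by
    rw [fderiv_comp_swap h.contDiff_b, fderiv_comp_swap h.contDiff_b]
    exact (h.boundary a.swap h1).symm
  dense_fst := h.dense_snd
  dense_snd := h.dense_fst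

/-- The surface with the first two coordinates exchanged. -/
def graphSurfaceSwap (f b : ℝ × ℝ → ℝ) :
    graphSurface f b ≃ₜ graphSurface (f ∘ Prod.swap) (b ∘ Prod.swap) where
  toFun p := ⟨(p.1.2.1, p.1.1, p.1.2.2), p.2⟩
  invFun p := ⟨(p.1.2.1, p.1.1, p.1.2.2), p.2⟩
  left_inv _ := rfl
  right_inv _ := rfl
  continuous_toFun := by fun_prop
  continuous_invFun := by fun_prop

theorem GridSegment.map {S T : Type*} [TopologicalSpace S] [TopologicalSpace T] (h : S ≃ₜ T)
    {𝓑 : Set (Set S)} {𝓑' : Set (Set T)} (h𝓑 : ∀ L ∈ 𝓑, h '' L ∈ 𝓑') {O : Set S} {O' : Set T}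
    (hO : MapsTo h O O') {q q' : S} (hq : GridSegment 𝓑 O q q') :
    GridSegment 𝓑' O' (h q) (h q') := by
  obtain ⟨σ, c, hc, h1, h2, ⟨L, hL, h3⟩, h4, rfl, rfl⟩ := hq
  exact ⟨h ∘ σ, c, hc, h.continuous.comp_continuousOn h1, h.injective.comp_injOn h2,
    ⟨_, h𝓑 L hL, fun t ht => mem_image_of_mem h (h3 t ht)⟩, fun t ht => hO (h4 t ht), rfl, rfl⟩

theorem LinkedAt.map {S T : Type*} [TopologicalSpace S] [TopologicalSpace T] (h : S ≃ₜ T)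
    {𝓑 : Set (Set S)} {𝓑' : Set (Set T)} (h𝓑 : ∀ L ∈ 𝓑, h '' L ∈ 𝓑')
    (h𝓑' : ∀ L ∈ 𝓑', h.symm '' L ∈ 𝓑) {D : Set S} {p : S} (hp : LinkedAt 𝓑 D p) :
    LinkedAt 𝓑' (h '' D) (h p) := by
  intro O hO hpO
  obtain ⟨B, hB, q, hqO, hqD, ⟨L, hL, hqL⟩, hlink⟩ := hp _ (hO.preimage h.continuous) hpO
  refine ⟨h '' B, h.isOpenMap.image_mem_nhds hB, h q, hqO, by simpa using hqD,
    ⟨_, h𝓑 L hL, mem_image_of_mem h hqL⟩, ?_⟩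
  rintro _ ⟨r, hr, rfl⟩ hrD ⟨M, hM, hrM⟩
  refine (hlink r hr (fun hrD' => hrD (mem_image_of_mem h hrD'))
    ⟨_, h𝓑' M hM, h r, hrM, by simp⟩).lift h fun x y hxy => hxy.map h h𝓑 ?_
  exact fun x hx => ⟨hx.1, by simpa using hx.2⟩

/-- Fold and boundary do not meet, so at `p` at most one of the two derivative conditions matters.
If its `y`-derivative vanishes, its `x`-derivative does not, and exchanging the coordinates reduces
to the previous case. -/
theorem IsGridSurface.linkedAt (h : IsGridSurface f b X Y) (p : graphSurface f b) :
    LinkedAt (gridCurves f b X Y) (graphBoundary f b) p := by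
  by_cases hfst : (f (p.1.1, p.1.2.1) = 0 → fderiv ℝ f (p.1.1, p.1.2.1) (0, 1) ≠ 0) ∧
      (b (p.1.1, p.1.2.1) = 0 → fderiv ℝ b (p.1.1, p.1.2.1) (0, 1) ≠ 0)
  · exact h.linkedAt_fst hfst.1 hfst.2
  have hsnd : (f (p.1.1, p.1.2.1) = 0 → fderiv ℝ f (p.1.1, p.1.2.1) (1, 0) ≠ 0) ∧
      (b (p.1.1, p.1.2.1) = 0 → fderiv ℝ b (p.1.1, p.1.2.1) (1, 0) ≠ 0) := by
    have h1 := h.fold (p.1.1, p.1.2.1)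
    have h2 := h.boundary (p.1.1, p.1.2.1)
    have h3 := h.ne_zero_of_boundary (p.1.1, p.1.2.1)
    have h4 := p.2.1
    tauto
  have key : LinkedAt (gridCurves (f ∘ Prod.swap) (b ∘ Prod.swap) Y X)
      (graphBoundary (f ∘ Prod.swap) (b ∘ Prod.swap)) (graphSurfaceSwap f b p) := by
    refine h.swap.linkedAt_fst (fun h1 => ?_) fun h1 => ?_
    · rw [fderiv_comp_swap h.contDiff_f]; exact hsnd.1 h1
    · rw [fderiv_comp_swap h.contDiff_b]; exact hsnd.2 h1
  have := key.map (graphSurfaceSwap f b).symm (𝓑' := gridCurves f b X Y) ?_ ?_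
  · rw [Homeomorph.symm_apply_apply] at this
    convert this using 1
    rw [Homeomorph.image_symm]
    rfl
  · rintro L (⟨c, hc, rfl⟩ | ⟨c, hc, rfl⟩) <;> rw [Homeomorph.image_symm]
    · exact Or.inr ⟨c, hc, rfl⟩
    · exact Or.inl ⟨c, hc, rfl⟩
  · rintro L (⟨c, hc, rfl⟩ | ⟨c, hc, rfl⟩) <;> rw [Homeomorph.symm_symm, ← Homeomorph.preimage_symm]
    · exact Or.inr ⟨c, hc, rfl⟩
    · exact Or.inl ⟨c, hc, rfl⟩

/-- In the coordinates `(b, v)` the segment is `v = c` with `b` running from `0` to `ε / 2`, for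
some `c ∈ Z` close to `v p`. -/
theorem boundarySegmentAt_of_pair {𝓑 : Set (Set (graphSurface f b))} {p : graphSurface f b}
    (hp : p ∈ graphBoundary f b) {v : ℝ × ℝ × ℝ → ℝ} {Z : Set ℝ} (hZ : Dense Z)
    (h : IsCoordinatePair f (fun q => b (q.1, q.2.1)) v p.1)
    (h𝓑 : ∀ c ∈ Z, {q : graphSurface f b | v q.1 = c} ∈ 𝓑) :
    BoundarySegmentAt 𝓑 (graphBoundary f b) p := by
  intro O hO hpO
  obtain ⟨V, hV, rfl⟩ := isOpen_induced_iff.1 hO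
  obtain ⟨ε, hε, G, hG, hGa, -⟩ := h.exists_param _ (hV.mem_nhds hpO)
  have hbp : b (p.1.1, p.1.2.1) = 0 := hp
  simp only [hbp, sub_zero] at hG hGa
  obtain ⟨c, hc, hcε⟩ := hZ.exists_abs_sub_lt (v p.1) hε
  have ht : ∀ t ∈ Icc 0 (ε / 2), |t| < ε := fun t ht => by
    rw [abs_of_nonneg ht.1]; linarith [ht.2]
  obtain ⟨σ, hσ, hσG⟩ := exists_lift_subtype (M := graphSurface f b) p
    (g := fun t => G (t, c)) (I := Icc 0 (ε / 2))
    (hG.comp (by fun_prop) fun t k => ⟨ht t k, hcε⟩)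
    fun t k => ⟨(hGa (t, c) (ht t k) hcε).1.symm ▸ k.1, (hGa (t, c) (ht t k) hcε).2.2.1⟩
  have hσb : ∀ t ∈ Icc 0 (ε / 2), b ((σ t).1.1, (σ t).1.2.1) = t := fun t k => by
    rw [hσG t k]; exact (hGa (t, c) (ht t k) hcε).1
  refine ⟨σ, ε / 2, by positivity, hσ, fun x hx y hy hxy => ?_, ⟨_, h𝓑 c hc, fun t k => ?_⟩,
    fun t k => ?_, hσb 0 ⟨le_rfl, by positivity⟩, fun t k hcon => ?_⟩
  · rw [← hσb x hx, hxy, hσb y hy]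
  · show v (σ t).1 = c
    rw [hσG t k]; exact (hGa (t, c) (ht t k) hcε).2.1
  · show (σ t).1 ∈ V
    rw [hσG t k]; exact (hGa (t, c) (ht t k) hcε).2.2.2
  · exact k.1.ne' ((hσb t ⟨k.1.le, k.2⟩).symm.trans hcon)

theorem IsGridSurface.boundarySegmentAt (h : IsGridSurface f b X Y) {p : graphSurface f b}
    (hp : p ∈ graphBoundary f b) :
    BoundarySegmentAt (gridCurves f b X Y) (graphBoundary f b) p := by
  have hz : p.1.2.2 ≠ 0 := height_ne_zero (h.ne_zero_of_boundary _ hp)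
  rcases h.boundary _ hp with h1 | h1
  · exact boundarySegmentAt_of_pair hp h.dense_snd
      (isCoordinatePair_boundary_snd h.contDiff_f h.contDiff_b p.2.2 hz h1)
      fun c hc => snd_mem_gridCurves hc
  · exact boundarySegmentAt_of_pair hp h.dense_fst
      (isCoordinatePair_boundary_fst h.contDiff_f h.contDiff_b p.2.2 hz h1)
      fun c hc => fst_mem_gridCurves hc

end GridSurface

/-! ### The standard surface -/

/-- The function whose graph in `z²` is the standard surface. -/
noncomputable def standardHeight (g : ℕ) (a : ℝ × ℝ) : ℝ :=
  ((3 * (g : ℝ) + 2) ^ 2 - (a.1 ^ 2 + a.2 ^ 2)) *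
    ∏ j ∈ Finset.Icc 1 g, ((a.1 - 3 * (j : ℝ)) ^ 2 + a.2 ^ 2 - 1)

/-- The function that vanishes on the boundary of the standard surface. -/
def standardBound (a : ℝ × ℝ) : ℝ := a.1 ^ 2 + a.2 ^ 2 - 1

theorem graphSurface_standard (g : ℕ) :
    graphSurface (standardHeight g) standardBound = standardSurface g := by
  ext p
  simp [graphSurface, standardSurface, standardHeight, standardBound]

theorem contDiff_standardHeight (g : ℕ) : ContDiff ℝ 1 (standardHeight g) := by
  refine ContDiff.mul (by fun_prop) (contDiff_prod fun j _ => by fun_prop)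

theorem contDiff_standardBound : ContDiff ℝ 1 standardBound := by
  unfold standardBound
  fun_prop

theorem le_of_mem_disc {x y : ℝ} {j : ℕ} (h : (x - 3 * (j : ℝ)) ^ 2 + y ^ 2 ≤ 1) :
    x ^ 2 + y ^ 2 ≤ (3 * (j : ℝ) + 1) ^ 2 := by
  have h1 : x - 3 * (j : ℝ) ≤ 1 := by nlinarith [sq_nonneg y, sq_nonneg (x - 3 * (j : ℝ) - 1)]
  have h2 : (0 : ℝ) ≤ j := j.cast_nonneg
  nlinarith

theorem abs_sub_le_of_mem_disc {x y : ℝ} {j : ℕ} (h : (x - 3 * (j : ℝ)) ^ 2 + y ^ 2 ≤ 1) :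
    |x - 3 * (j : ℝ)| ≤ 1 := by
  rw [← sq_le_one_iff_abs_le_one]
  linarith [sq_nonneg y]

/-- Distinct centres are at least `3` apart, more than the sum of two radii. The index `0` stands
for the disc inside the boundary circle. -/
theorem discs_disjoint {x y : ℝ} {i j : ℕ} (hi : (x - 3 * (i : ℝ)) ^ 2 + y ^ 2 ≤ 1)
    (hj : (x - 3 * (j : ℝ)) ^ 2 + y ^ 2 ≤ 1) : i = j := by
  have h1 := abs_le.1 (abs_sub_le_of_mem_disc hi)
  have h2 := abs_le.1 (abs_sub_le_of_mem_disc hj)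
  have h3 : ((i : ℤ) : ℝ) < ((j + 1 : ℤ) : ℝ) := by push_cast; linarith
  have h4 : ((j : ℤ) : ℝ) < ((i + 1 : ℤ) : ℝ) := by push_cast; linarith
  rw [Int.cast_lt] at h3 h4
  omega

theorem lt_outer_radius {x y : ℝ} {g j : ℕ} (hj : j ≤ g)
    (h : (x - 3 * (j : ℝ)) ^ 2 + y ^ 2 ≤ 1) : x ^ 2 + y ^ 2 < (3 * (g : ℝ) + 2) ^ 2 := by
  refine (le_of_mem_disc h).trans_lt ?_
  have h1 : (j : ℝ) ≤ g := by exact_mod_cast hj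
  have h2 : (0 : ℝ) ≤ j := j.cast_nonneg
  nlinarith

theorem hasFDerivAt_circle (c R ε : ℝ) (a : ℝ × ℝ) :
    HasFDerivAt (fun a : ℝ × ℝ => ε * ((a.1 - c) ^ 2 + a.2 ^ 2 - R))
      (ε • ((2 * (a.1 - c)) • ContinuousLinearMap.fst ℝ ℝ ℝ +
        (2 * a.2) • ContinuousLinearMap.snd ℝ ℝ ℝ)) a := by
  have h1 : HasFDerivAt (fun a : ℝ × ℝ => a.1 - c) (ContinuousLinearMap.fst ℝ ℝ ℝ) a :=
    (ContinuousLinearMap.fst ℝ ℝ ℝ).hasFDerivAt.sub_const c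
  have h2 : HasFDerivAt (fun a : ℝ × ℝ => a.2) (ContinuousLinearMap.snd ℝ ℝ ℝ) a :=
    (ContinuousLinearMap.snd ℝ ℝ ℝ).hasFDerivAt
  have := (((h1.pow 2).add (h2.pow 2)).sub_const R).const_mul ε
  refine this.congr_fderiv ?_
  simp

/-- If a circle equation is a simple factor of a function, it determines the derivative of the
function on the circle. -/
theorem exists_fderiv_of_circle_factor {φ ψ : ℝ × ℝ → ℝ} {c R ε : ℝ} (hε : ε ≠ 0)
    (hψ : ContDiff ℝ 1 ψ)
    (hφ : ∀ a, φ a = ε * ((a.1 - c) ^ 2 + a.2 ^ 2 - R) * ψ a) {a : ℝ × ℝ}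
    (ha : (a.1 - c) ^ 2 + a.2 ^ 2 = R) (hψa : ψ a ≠ 0) :
    ∃ w ≠ 0, fderiv ℝ φ a (1, 0) = w * (a.1 - c) ∧ fderiv ℝ φ a (0, 1) = w * a.2 := by
  refine ⟨2 * ε * ψ a, by positivity, ?_⟩
  have h1 := (hasFDerivAt_circle c R ε a).mul (hψ.differentiable one_ne_zero a).hasFDerivAt
  have h2 : φ = (fun a => ε * ((a.1 - c) ^ 2 + a.2 ^ 2 - R)) * ψ := funext hφ
  rw [← h2] at h1
  rw [h1.fderiv]
  constructor
  · simp [ha]; ring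
  · simp [ha]; ring

/-- The zero set of the height function consists of circles with integral centres and radii, on
which its gradient is radial. -/
theorem exists_circle_of_standardHeight_eq_zero {g : ℕ} {a : ℝ × ℝ} (ha : standardHeight g a = 0) :
    ∃ c R : ℕ, 0 < R ∧ (a.1 - c) ^ 2 + a.2 ^ 2 = (R : ℝ) ^ 2 ∧ ∃ w ≠ 0,
      fderiv ℝ (standardHeight g) a (1, 0) = w * (a.1 - c) ∧
      fderiv ℝ (standardHeight g) a (0, 1) = w * a.2 := by
  rcases mul_eq_zero.1 ha with h | h
  -- The outer circle. The other factors do not vanish on it, because the unit discs lie strictly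
  -- inside.
  · refine ⟨0, 3 * g + 2, by omega, by push_cast; linarith, ?_⟩
    refine exists_fderiv_of_circle_factor (R := (3 * (g : ℝ) + 2) ^ 2) (ε := -1) (by norm_num)
      (contDiff_prod fun j _ => by fun_prop :
        ContDiff ℝ 1 fun a : ℝ × ℝ => ∏ j ∈ Finset.Icc 1 g, ((a.1 - 3 * (j : ℝ)) ^ 2 + a.2 ^ 2 - 1))
      (fun a => ?_) (by push_cast; linarith) ?_
    · rw [standardHeight]; push_cast; ring
    · refine Finset.prod_ne_zero_iff.2 fun j hj h0 => ?_
      have := lt_outer_radius (Finset.mem_Icc.1 hj).2 (sub_eq_zero.1 h0).le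
      linarith
  · obtain ⟨i, hi, h0⟩ := Finset.prod_eq_zero_iff.1 h
    -- The circle around one hole. The other factors do not vanish on it, because the closed unit
    -- discs are disjoint and lie strictly inside the outer circle.
    refine ⟨3 * i, 1, one_pos, by push_cast; linarith, ?_⟩
    refine exists_fderiv_of_circle_factor (R := 1) (ε := 1) one_ne_zero
      (((by fun_prop : ContDiff ℝ 1 fun a : ℝ × ℝ =>
          (3 * (g : ℝ) + 2) ^ 2 - (a.1 ^ 2 + a.2 ^ 2))).mul
        (contDiff_prod fun j _ => by fun_prop : ContDiff ℝ 1 fun a : ℝ × ℝ =>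
          ∏ j ∈ (Finset.Icc 1 g).erase i, ((a.1 - 3 * (j : ℝ)) ^ 2 + a.2 ^ 2 - 1)))
      (fun a => ?_) (by push_cast; linarith) (mul_ne_zero ?_ ?_)
    · rw [standardHeight, ← Finset.mul_prod_erase _ _ hi]
      push_cast; ring
    · have := lt_outer_radius (Finset.mem_Icc.1 hi).2 (sub_eq_zero.1 h0).le
      exact (sub_pos.2 this).ne'
    · refine Finset.prod_ne_zero_iff.2 fun j hj hj0 => (Finset.mem_erase.1 hj).1 ?_
      exact discs_disjoint (sub_eq_zero.1 hj0).le (sub_eq_zero.1 h0).le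

theorem fderiv_standardBound {a : ℝ × ℝ} (ha : standardBound a = 0) :
    ∃ w ≠ 0, fderiv ℝ standardBound a (1, 0) = w * a.1 ∧
      fderiv ℝ standardBound a (0, 1) = w * a.2 := by
  have := exists_fderiv_of_circle_factor (φ := standardBound) (ψ := 1) (c := 0) (R := 1) (ε := 1)
    one_ne_zero contDiff_const (fun a => by simp [standardBound]) (a := a)
    (by simpa [standardBound, sub_eq_zero] using ha) one_ne_zero
  simpa using this

/-- The rational numbers that are not integers. -/
def gridAbscissas : Set ℝ := range ((↑) : ℚ → ℝ) ∩ (range ((↑) : ℤ → ℝ))ᶜ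

/-- The real numbers with irrational square. -/
def gridOrdinates : Set ℝ := {d | Irrational (d ^ 2)}

theorem dense_gridAbscissas : Dense gridAbscissas :=
  Rat.denseRange_cast.inter_of_isOpen_right ((countable_range _).dense_compl ℝ)
    Int.isClosedEmbedding_coe_real.isClosed_range.isOpen_compl

theorem dense_gridOrdinates : Dense gridOrdinates := by
  -- Only the countably many numbers `±√q` with `q` rational have to be avoided.
  have h : (range (fun q : ℚ => √(q : ℝ)) ∪ range fun q : ℚ => -√(q : ℝ))ᶜ ⊆ gridOrdinates := by
    rintro d hd ⟨q, hq⟩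
    refine hd ?_
    rcases le_total 0 d with h | h
    · exact Or.inl ⟨q, by simp only [hq, Real.sqrt_sq h]⟩
    · exact Or.inr ⟨q, by simp only [hq, Real.sqrt_sq_eq_abs, abs_of_nonpos h, neg_neg]⟩
  exact (((countable_range _).union (countable_range _)).dense_compl ℝ).mono h

/-- At `y = 0` the circle has the integral abscissas `c ± R`. -/
theorem snd_ne_zero_of_circle {x y : ℝ} {c R : ℕ} (hx : x ∈ gridAbscissas)
    (h : (x - c) ^ 2 + y ^ 2 = (R : ℝ) ^ 2) : y ≠ 0 := by
  rintro rfl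
  have h1 : (x - c) ^ 2 = (R : ℝ) ^ 2 := by simpa using h
  rcases sq_eq_sq_iff_eq_or_eq_neg.1 h1 with h2 | h2
  · exact hx.2 ⟨c + R, by push_cast; linarith⟩
  · exact hx.2 ⟨c - R, by push_cast; linarith⟩

/-- At `x = c` the circle has `y² = R²`, which is rational. -/
theorem fst_ne_of_circle {x y : ℝ} {c R : ℕ} (hy : y ∈ gridOrdinates)
    (h : (x - c) ^ 2 + y ^ 2 = (R : ℝ) ^ 2) : x - c ≠ 0 := by
  intro h0
  rw [h0] at h
  exact hy ⟨(R : ℚ) ^ 2, by push_cast; linarith⟩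

/-- Folds and boundary lie over circles with integral centres and radii, along which the gradient is
radial and nonzero. Tangency of a grid line to such a circle would force an integral abscissa or a
rational `y²`, and a crossing of two grid lines on a fold would make `y² = R² - (x - c)²` rational.
-/
theorem isGridSurface_standard (g : ℕ) :
    IsGridSurface (standardHeight g) standardBound gridAbscissas gridOrdinates where
  contDiff_f := contDiff_standardHeight g
  contDiff_b := contDiff_standardBound
  ne_zero_of_boundary a ha h0 := by
    have ha : (a.1 - 3 * ((0 : ℕ) : ℝ)) ^ 2 + a.2 ^ 2 ≤ 1 := by
      simpa using (sub_eq_zero.1 ha).le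
    rcases mul_eq_zero.1 h0 with h | h
    · exact (sub_pos.2 (lt_outer_radius (Nat.zero_le g) ha)).ne' h
    · obtain ⟨i, hi, h0⟩ := Finset.prod_eq_zero_iff.1 h
      have := discs_disjoint ha (sub_eq_zero.1 h0).le
      have := (Finset.mem_Icc.1 hi).1
      omega
  fold_fst a ha _ hX := by
    obtain ⟨c, R, -, h, w, hw, -, h2⟩ := exists_circle_of_standardHeight_eq_zero ha
    rw [h2]
    exact mul_ne_zero hw (snd_ne_zero_of_circle hX h)
  fold_snd a ha _ hY := by
    obtain ⟨c, R, -, h, w, hw, h1, -⟩ := exists_circle_of_standardHeight_eq_zero ha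
    rw [h1]
    exact mul_ne_zero hw (fst_ne_of_circle hY h)
  boundary_fst a ha hX := by
    obtain ⟨w, hw, -, h2⟩ := fderiv_standardBound ha
    rw [h2]
    exact mul_ne_zero hw (snd_ne_zero_of_circle (c := 0) (R := 1) hX
      (by simpa [standardBound, sub_eq_zero] using ha))
  boundary_snd a ha hY := by
    obtain ⟨w, hw, h1, -⟩ := fderiv_standardBound ha
    rw [h1]
    refine mul_ne_zero hw ?_
    simpa using fst_ne_of_circle (c := 0) (R := 1) (x := a.1) hY
      (by simpa [standardBound, sub_eq_zero] using ha)
  cross a hX hY h0 := by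
    obtain ⟨c, R, -, h, -⟩ := exists_circle_of_standardHeight_eq_zero h0
    obtain ⟨q, hq⟩ := hX.1
    exact hY ⟨(R : ℚ) ^ 2 - (q - c) ^ 2, by push_cast; rw [hq]; linarith⟩
  fold a ha _ := by
    obtain ⟨c, R, hR, h, w, hw, h1, h2⟩ := exists_circle_of_standardHeight_eq_zero ha
    rw [h1, h2]
    by_contra! hcon
    have k1 : a.1 - c = 0 := by simpa [hw] using hcon.1
    have k2 : a.2 = 0 := by simpa [hw] using hcon.2
    rw [k1, k2] at h
    have : (0 : ℝ) < (R : ℝ) ^ 2 := by positivity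
    linarith
  boundary a ha := by
    obtain ⟨w, hw, h1, h2⟩ := fderiv_standardBound ha
    rw [h1, h2]
    by_contra! hcon
    have k1 : a.1 = 0 := by simpa [hw] using hcon.1
    have k2 : a.2 = 0 := by simpa [hw] using hcon.2
    simp [standardBound, k1, k2] at ha
  dense_fst := dense_gridAbscissas
  dense_snd := dense_gridOrdinates

/-- The surface is closed and is covered by the graphs of `√f` and `-√f` over a square. Where `f` is
negative, the default value `0` of the root only adds superfluous points to the compact cover. -/
theorem isCompact_graphSurface {f b : ℝ × ℝ → ℝ} (hf : Continuous f) (hb : Continuous b) {R : ℝ}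
    (hR : ∀ a : ℝ × ℝ, 0 ≤ f a → a.1 ^ 2 + a.2 ^ 2 ≤ R ^ 2) : IsCompact (graphSurface f b) := by
  have h1 : IsClosed (graphSurface f b) :=
    (isClosed_le continuous_const (hb.comp (by fun_prop : Continuous fun p : ℝ × ℝ × ℝ =>
      (p.1, p.2.1)))).inter (isClosed_eq (by fun_prop) (hf.comp (by fun_prop : Continuous
      fun p : ℝ × ℝ × ℝ => (p.1, p.2.1))))
  have h2 : ∀ ζ : ℝ, IsCompact ((fun a : ℝ × ℝ => (a.1, a.2, ζ * √(f a))) ''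
      (Icc (-|R|) |R| ×ˢ Icc (-|R|) |R|)) := fun ζ =>
    (isCompact_Icc.prod isCompact_Icc).image (by fun_prop)
  refine ((h2 1).union (h2 (-1))).of_isClosed_subset h1 fun p hp => ?_
  obtain ⟨ζ, hζ, hz⟩ := exists_sign ⟨p, hp⟩
  have h3 := hR (p.1, p.2.1) (hp.2 ▸ sq_nonneg _)
  have h4 : (p.1, p.2.1) ∈ Icc (-|R|) |R| ×ˢ Icc (-|R|) |R| := by
    refine ⟨abs_le.1 (sq_le_sq.1 ?_), abs_le.1 (sq_le_sq.1 ?_)⟩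
    · nlinarith [sq_nonneg p.2.1]
    · nlinarith [sq_nonneg p.1]
  have h5 : (p.1, p.2.1, ζ * √(f (p.1, p.2.1))) = p := by
    rw [← hz]
  rcases mul_self_eq_one_iff.1 hζ with rfl | rfl
  · exact Or.inl ⟨_, h4, h5⟩
  · exact Or.inr ⟨_, h4, h5⟩

theorem standardHeight_bound {g : ℕ} {a : ℝ × ℝ} (h : 0 ≤ standardHeight g a) :
    a.1 ^ 2 + a.2 ^ 2 ≤ (3 * (g : ℝ) + 2) ^ 2 := by
  by_contra! hcon
  refine absurd h (not_le.2 (mul_neg_of_neg_of_pos (by linarith) (Finset.prod_pos fun j hj => ?_)))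
  by_contra! h0
  have := lt_outer_radius (Finset.mem_Icc.1 hj).2 (sub_nonpos.1 h0)
  linarith

instance compactSpace_standard (g : ℕ) :
    CompactSpace (graphSurface (standardHeight g) standardBound) :=
  isCompact_iff_compactSpace.1 (isCompact_graphSurface (contDiff_standardHeight g).continuous
    contDiff_standardBound.continuous fun _ => standardHeight_bound)

/-- Transversality charts isolate the common points, and the intersection is compact. -/
theorem IntersectTransversely.finite {S : Type*} [TopologicalSpace S] [T2Space S] {C₁ C₂ : Set S}
    {l m : ProperArc C₁ C₂} (h : IntersectTransversely l m) : (l.1 ∩ m.1).Finite := by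
  have hiso : ∀ p ∈ l.1 ∩ m.1, ∃ U ∈ 𝓝 p, (l.1 ∩ m.1) ∩ U ⊆ {p} := by
    intro p hp
    obtain ⟨-, e, hpe, he⟩ := h p hp
    refine ⟨e.source, e.open_source.mem_nhds hpe, fun q hq => e.injOn hq.2 hpe (Plane.ext ?_ ?_)⟩
    · rw [(he q hq.2).1.1 hq.1.1, (he p hpe).1.1 hp.1]
    · rw [(he q hq.2).2.1 hq.1.2, (he p hpe).2.1 hp.2]
  choose! U hU hUs using hiso
  obtain ⟨t, ht, hcov⟩ := (l.2.isCompact.inter m.2.isCompact).elim_nhds_subcover U hU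
  refine t.finite_toSet.subset fun q hq => ?_
  obtain ⟨p, hp, hqp⟩ := mem_iUnion₂.1 (hcov hq)
  rw [show q = p from hUs p (ht p hp) ⟨hq, hqp⟩]
  exact hp

section GraphSurface

variable {f b : ℝ × ℝ → ℝ}

/-- The part of the boundary in the upper sheet. -/
def upperBoundary (f b : ℝ × ℝ → ℝ) : Set (graphSurface f b) :=
  {p | p ∈ graphBoundary f b ∧ 0 < p.1.2.2}

/-- The part of the boundary in the lower sheet. -/
def lowerBoundary (f b : ℝ × ℝ → ℝ) : Set (graphSurface f b) :=
  {p | p ∈ graphBoundary f b ∧ p.1.2.2 < 0}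

theorem disjoint_upperBoundary_lowerBoundary :
    Disjoint (upperBoundary f b) (lowerBoundary f b) :=
  disjoint_left.2 fun _ hp hp' => lt_asymm hp.2 hp'.2

theorem upperBoundary_union_lowerBoundary (h : ∀ a, b a = 0 → f a ≠ 0) :
    upperBoundary f b ∪ lowerBoundary f b = graphBoundary f b := by
  ext p
  refine ⟨fun hp => hp.elim And.left And.left, fun hp => ?_⟩
  exact (height_ne_zero (h _ hp)).gt_or_lt.imp (⟨hp, ·⟩) (⟨hp, ·⟩)

theorem isClosed_upperBoundary (hb : Continuous b) (h : ∀ a, b a = 0 → f a ≠ 0) :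
    IsClosed (upperBoundary f b) := by
  have h1 : upperBoundary f b = graphBoundary f b ∩ {p | 0 ≤ p.1.2.2} := by
    ext p
    exact ⟨fun hp => ⟨hp.1, hp.2.le⟩, fun hp =>
      ⟨hp.1, lt_of_le_of_ne hp.2 (height_ne_zero (h _ hp.1)).symm⟩⟩
  have h2 : IsClosed {p : graphSurface f b | 0 ≤ p.1.2.2} := isClosed_le (by fun_prop) (by fun_prop)
  exact h1 ▸ (isClosed_graphBoundary hb).inter h2

theorem isClosed_lowerBoundary (hb : Continuous b) (h : ∀ a, b a = 0 → f a ≠ 0) :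
    IsClosed (lowerBoundary f b) := by
  have h1 : lowerBoundary f b = graphBoundary f b ∩ {p | p.1.2.2 ≤ 0} := by
    ext p
    exact ⟨fun hp => ⟨hp.1, hp.2.le⟩, fun hp =>
      ⟨hp.1, lt_of_le_of_ne hp.2 (height_ne_zero (h _ hp.1))⟩⟩
  have h2 : IsClosed {p : graphSurface f b | p.1.2.2 ≤ 0} := isClosed_le (by fun_prop) (by fun_prop)
  exact h1 ▸ (isClosed_graphBoundary hb).inter h2

end GraphSurface

/-! ### The meridian -/

section Standard

variable {g : ℕ}

/-- The arc that the negative half of the first coordinate axis cuts out on the standard surface. -/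
def meridian (g : ℕ) : Set (graphSurface (standardHeight g) standardBound) :=
  {p | p.1.2.1 = 0 ∧ p.1.1 < 0}

theorem eventually_mem_meridian_iff {p : graphSurface (standardHeight g) standardBound}
    (hp : p ∈ meridian g) : ∀ᶠ q in 𝓝 p, q ∈ meridian g ↔ q.1.2.1 = 0 := by
  have h1 : IsOpen {q : graphSurface (standardHeight g) standardBound | q.1.1 < 0} :=
    isOpen_lt (by fun_prop) (by fun_prop)
  filter_upwards [h1.mem_nhds hp.2] with q hq
  exact and_iff_left hq

/-- On folds and boundary the gradient is radial and nonzero, so over the axis `y = 0` its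
`y`-component vanishes and its `x`-component does not. Hence `y` can be completed to local
coordinates at every point. -/
theorem isFlatAt_meridian {p : graphSurface (standardHeight g) standardBound}
    (hp : p ∈ meridian g) :
    IsFlatAt (graphBoundary (standardHeight g) standardBound) (meridian g) p := by
  have hG := isGridSurface_standard g
  by_cases hpD : p ∈ graphBoundary (standardHeight g) standardBound
  · have h1 : fderiv ℝ standardBound (p.1.1, p.1.2.1) (1, 0) ≠ 0 := by
      obtain ⟨w, -, -, h2⟩ := fderiv_standardBound hpD
      exact (hG.boundary _ hpD).resolve_right (not_not.2 (h2.trans (by simp [hp.1])))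
    obtain ⟨e, hpe, he⟩ := (isCoordinatePair_boundary_snd hG.contDiff_f hG.contDiff_b p.2.2
      (height_ne_zero (hG.ne_zero_of_boundary _ hpD)) h1).exists_boundary_chart hpD
    refine IsFlatAt.congr
      (A := {q : graphSurface (standardHeight g) standardBound | q.1.2.1 = 0})
      ⟨e, hpe, fun q _ => ?_⟩
      (eventually_mem_meridian_iff hp)
    simp [he, hp.1, graphBoundary]
  · obtain ⟨v, hv⟩ : ∃ v, IsCoordinatePair (standardHeight g) (fun q => q.2.1) v p.1 := by
      by_cases hz : p.1.2.2 = 0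
      · refine ⟨_, isCoordinatePair_snd_height hG.contDiff_f p.2.2 ?_⟩
        obtain ⟨c, R, -, -, w, -, -, h2⟩ :=
          exists_circle_of_standardHeight_eq_zero (graph_eq_zero hz)
        exact (hG.fold _ (graph_eq_zero hz) p.2.1).resolve_right
          (not_not.2 (h2.trans (by simp [hp.1])))
      · exact ⟨_, (isCoordinatePair_planar hG.contDiff_f p.2.2 hz).symm⟩
    obtain ⟨e, hpe, he⟩ := hv.exists_chart hG.contDiff_b.continuous hpD
    refine isFlatAt_of_line (isClosed_graphBoundary hG.contDiff_b.continuous) hpD hpe ?_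
    filter_upwards [eventually_mem_meridian_iff hp] with q hq
    simp [hq, he, hp.1]

theorem standardHeight_eq_of_axis (x : ℝ) : standardHeight g (x, 0) =
    ((3 * (g : ℝ) + 2) ^ 2 - x ^ 2) * ∏ j ∈ Finset.Icc 1 g, ((x - 3 * (j : ℝ)) ^ 2 - 1) := by
  simp [standardHeight]

theorem standardHeight_axis_pos {x : ℝ} (h1 : -(3 * (g : ℝ) + 2) < x) (h2 : x < 0) :
    0 < standardHeight g (x, 0) := by
  rw [standardHeight_eq_of_axis]
  refine mul_pos (by nlinarith) (Finset.prod_pos fun j hj => ?_)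
  have : (1 : ℝ) ≤ j := by exact_mod_cast (Finset.mem_Icc.1 hj).1
  nlinarith

theorem standardHeight_axis_end : standardHeight g (-(3 * (g : ℝ) + 2), 0) = 0 := by
  rw [standardHeight_eq_of_axis]
  ring

/-- The arc runs in the upper sheet from `x = -1` to the outer fold at `x = -R`, where `R = 3 g +
2`, and returns in the lower sheet. No hole lies over the negative axis. -/
theorem isProperArc_meridian (g : ℕ) : IsProperArc (upperBoundary (standardHeight g) standardBound)
    (lowerBoundary (standardHeight g) standardBound) (meridian g) := by
  have hG := isGridSurface_standard g
  have hfc := hG.contDiff_f.continuous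
  obtain ⟨R, hR⟩ : ∃ R : ℝ, R = 3 * (g : ℝ) + 2 := ⟨_, rfl⟩
  have hR2 : 2 ≤ R := by have : (0 : ℝ) ≤ g := g.cast_nonneg; linarith
  have hpos : ∀ x, -R < x → x < 0 → 0 < standardHeight g (x, 0) := fun x h =>
    standardHeight_axis_pos (hR ▸ h)
  have hend : standardHeight g (-R, 0) = 0 := by rw [hR, standardHeight_axis_end]
  -- The time `s = 0` is the passage through the fold; negative times lie in the upper sheet,
  -- positive ones in the lower sheet.
  obtain ⟨x, hx⟩ : ∃ x : ℝ → ℝ, x = fun s => -R + (R - 1) * |s| := ⟨_, rfl⟩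
  have hxc : Continuous x := by rw [hx]; fun_prop
  have hx0 : x 0 = -R := by simp [hx]
  have hx1 : ∀ s ∈ Icc (-1 : ℝ) 1, x s ≤ -1 := fun s hs => by
    have := abs_le.2 hs
    simp only [hx]; nlinarith
  have hxR : ∀ s, s ≠ 0 → -R < x s := fun s hs => by
    have := abs_pos.2 hs
    simp only [hx]; nlinarith
  have hxf : ∀ s ∈ Icc (-1 : ℝ) 1, s ≠ 0 → 0 < standardHeight g (x s, 0) := fun s hs h0 =>
    hpos _ (hxR s h0) (by linarith [hx1 s hs])
  have hxf' : ∀ s ∈ Icc (-1 : ℝ) 1, 0 ≤ standardHeight g (x s, 0) := fun s hs => by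
    rcases eq_or_ne s 0 with rfl | h0
    · rw [hx0, hend]
    · exact (hxf s hs h0).le
  obtain ⟨z, hz⟩ : ∃ z : ℝ → ℝ, z = fun s =>
    if s ≤ 0 then √(standardHeight g (x s, 0)) else -√(standardHeight g (x s, 0)) := ⟨_, rfl⟩
  have hzc : Continuous z := by
    have h1 : Continuous fun s => √(standardHeight g (x s, 0)) := by fun_prop
    rw [hz]
    refine h1.if_le h1.neg continuous_id continuous_const ?_
    intro s (hs : s = 0)
    rw [hs, hx0, hend]
    simp
  have hz1 : ∀ s ∈ Icc (-1 : ℝ) 1, s < 0 → 0 < z s := fun s hs h0 => by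
    simp only [hz, if_pos h0.le]
    exact Real.sqrt_pos.2 (hxf s hs h0.ne)
  have hz2 : ∀ s ∈ Icc (-1 : ℝ) 1, 0 < s → z s < 0 := fun s hs h0 => by
    simp only [hz, if_neg h0.not_ge]
    exact neg_neg_of_pos (Real.sqrt_pos.2 (hxf s hs h0.ne'))
  have hzsq : ∀ s ∈ Icc (-1 : ℝ) 1, z s ^ 2 = standardHeight g (x s, 0) := fun s hs => by
    simp only [hz]
    split_ifs
    · exact Real.sq_sqrt (hxf' s hs)
    · rw [neg_sq]; exact Real.sq_sqrt (hxf' s hs)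
  have hmem : ∀ s ∈ Icc (-1 : ℝ) 1,
      (x s, (0 : ℝ), z s) ∈ graphSurface (standardHeight g) standardBound := fun s hs => by
    refine ⟨?_, hzsq s hs⟩
    have := hx1 s hs
    simp only [standardBound]; nlinarith
  have h1 : (1 : ℝ) ∈ Icc (-1 : ℝ) 1 := ⟨by norm_num, le_rfl⟩
  have h1' : (-1 : ℝ) ∈ Icc (-1 : ℝ) 1 := ⟨le_rfl, by norm_num⟩
  obtain ⟨α, hα, hαγ⟩ := exists_lift_subtype ⟨_, hmem 1 h1⟩
    (g := fun s => (x s, (0 : ℝ), z s)) (I := Icc (-1) 1) (by fun_prop) hmem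
  have himage : α '' Icc (-1) 1 = meridian g := by
    apply Subset.antisymm
    · rintro _ ⟨s, hs, rfl⟩
      simp only [meridian, mem_ofPred_eq, hαγ s hs, true_and]
      linarith [hx1 s hs]
    · rintro p ⟨hpy, hpx⟩
      have hb : 0 ≤ standardBound (p.1.1, p.1.2.1) := p.2.1
      have hf : p.1.2.2 ^ 2 = standardHeight g (p.1.1, p.1.2.1) := p.2.2
      have hle := standardHeight_bound (hf ▸ sq_nonneg _)
      rw [hpy] at hf
      simp only [standardBound, hpy, ← hR] at hb hle
      have k1 : p.1.1 ≤ -1 := by nlinarith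
      have k2 : -R ≤ p.1.1 := by nlinarith
      obtain ⟨τ, hτ⟩ : ∃ τ, τ = (p.1.1 + R) / (R - 1) := ⟨_, rfl⟩
      have hτ0 : 0 ≤ τ := hτ ▸ div_nonneg (by linarith) (by linarith)
      have hτ1 : τ ≤ 1 := hτ ▸ (div_le_one (by linarith)).2 (by linarith)
      have hxτ : -R + (R - 1) * τ = p.1.1 := by
        rw [hτ, mul_div_cancel₀ _ (by linarith)]; ring
      rcases le_or_gt 0 p.1.2.2 with hp0 | hp0
      · have hs : -τ ∈ Icc (-1 : ℝ) 1 := ⟨by linarith, by linarith⟩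
        have hxs : x (-τ) = p.1.1 := by simp only [hx, abs_neg, abs_of_nonneg hτ0, hxτ]
        refine ⟨-τ, hs, Subtype.ext ?_⟩
        rw [hαγ _ hs, hxs, ← hpy]
        simp only [hz, if_pos (neg_nonpos.2 hτ0), hxs, ← hf, Real.sqrt_sq hp0]
      · have hs : τ ∈ Icc (-1 : ℝ) 1 := ⟨by linarith, by linarith⟩
        have hxs : x τ = p.1.1 := by simp only [hx, abs_of_nonneg hτ0, hxτ]
        have hτ0' : 0 < τ := by
          refine hτ0.lt_of_ne ?_
          rintro rfl
          rw [← hxs, hx0, hend] at hf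
          exact hp0.ne (by simpa using hf)
        refine ⟨τ, hs, Subtype.ext ?_⟩
        rw [hαγ _ hs, hxs, ← hpy]
        simp only [hz, if_neg hτ0'.not_ge, hxs, ← hf, Real.sqrt_sq_eq_abs, abs_of_neg hp0, neg_neg]
  have hx_end : ∀ s, |s| = 1 → standardBound (x s, 0) = 0 := fun s hs => by
    simp only [hx, hs, standardBound]; ring
  rw [← himage]
  refine isProperArc_of_param (by norm_num) hα ?_ ⟨?_, ?_⟩ ⟨?_, ?_⟩ ?_ ?_
  · intro s hs t ht hst
    have hst' := congrArg Subtype.val hst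
    rw [hαγ s hs, hαγ t ht] at hst'
    simp only [Prod.mk.injEq, true_and] at hst'
    have habs : |s| = |t| := by
      have := hst'.1
      simp only [hx] at this
      have hne : R - 1 ≠ 0 := by linarith
      exact mul_left_cancel₀ hne (add_left_cancel this)
    rcases abs_eq_abs.1 habs with h | h
    · exact h
    · rcases lt_trichotomy s 0 with h0 | h0 | h0
      · have := hz1 s hs h0
        have := hz2 t ht (by linarith)
        linarith [hst'.2]
      · linarith
      · have := hz2 s hs h0
        have := hz1 t ht (by linarith)
        linarith [hst'.2]
  · show standardBound ((α (-1)).1.1, (α (-1)).1.2.1) = 0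
    rw [hαγ _ h1']
    exact hx_end _ (by simp)
  · rw [hαγ _ h1']
    exact hz1 _ h1' (by norm_num)
  · show standardBound ((α 1).1.1, (α 1).1.2.1) = 0
    rw [hαγ _ h1]
    exact hx_end _ (by simp)
  · rw [hαγ _ h1]
    exact hz2 _ h1 (by norm_num)
  · intro s hs hcon
    rw [upperBoundary_union_lowerBoundary hG.ne_zero_of_boundary] at hcon
    have hcon : standardBound ((α s).1.1, (α s).1.2.1) = 0 := hcon
    rw [hαγ s (Ioo_subset_Icc_self hs)] at hcon
    have h2 := abs_lt.2 hs
    have h3 : x s < -1 := by simp only [hx]; nlinarith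
    simp only [standardBound] at hcon
    nlinarith
  · rw [himage, upperBoundary_union_lowerBoundary hG.ne_zero_of_boundary]
    exact fun p hp => isFlatAt_meridian hp

/-- Every arc on the standard surface is disjoint from an arc that is transverse to the meridian. -/
theorem exists_disjoint_transverse_meridian
    (l : ProperArc (upperBoundary (standardHeight g) standardBound)
      (lowerBoundary (standardHeight g) standardBound)) :
    ∃ a : ProperArc (upperBoundary (standardHeight g) standardBound)
      (lowerBoundary (standardHeight g) standardBound), Disjoint l.1 a.1 ∧
      IntersectTransversely a ⟨_, isProperArc_meridian g⟩ := by
  have hG := isGridSurface_standard g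
  have hD := upperBoundary_union_lowerBoundary hG.ne_zero_of_boundary
  have h1 := isClosed_upperBoundary hG.contDiff_b.continuous hG.ne_zero_of_boundary
  have h2 := isClosed_lowerBoundary hG.contDiff_b.continuous hG.ne_zero_of_boundary
  obtain ⟨B, hB, hBl⟩ := l.2.exists_disjoint h1 h2 disjoint_upperBoundary_lowerBoundary
  obtain ⟨β, hβ, rfl, hβ0, hβ1, -⟩ := hB.1
  -- The pushed-off copy of `l` serves only as a connected set that joins the two circles outside
  -- `l`.
  obtain ⟨a, ha, hal, hagrid, haline⟩ := IsGrid.exists_properArc h1 h2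
    disjoint_upperBoundary_lowerBoundary (hD ▸ hG.isGrid) (hD ▸ hG.linkedAt)
    (fun p hp => hD ▸ hG.boundarySegmentAt (hD ▸ hp)) l.2.isCompact.isClosed
    (isPreconnected_range hβ.continuous) hBl ⟨_, mem_range_self 0, hβ0⟩ ⟨_, mem_range_self 1, hβ1⟩
  refine ⟨⟨a, ha⟩, hal.symm, ?_⟩
  rintro p ⟨hpa, hpm⟩
  have hpm : p ∈ meridian g := hpm
  -- The meridian lies over `y = 0`, and `0` is not a grid ordinate. So `a` meets it only on curves
  -- `x = c`, which pass over the axis away from folds and boundary.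
  have hpY : p.1.2.1 ∉ gridOrdinates := by
    rw [hpm.1]
    exact fun h => h ⟨0, by simp⟩
  have hpX : p.1.1 ∈ gridAbscissas :=
    (exists_mem_gridCurves_iff.1 (hagrid p hpa)).resolve_right hpY
  have hpD : p ∉ graphBoundary (standardHeight g) standardBound := fun h => by
    obtain ⟨w, -, -, h3⟩ := fderiv_standardBound h
    exact hG.boundary_fst _ h hpX (h3.trans (by simp [hpm.1]))
  have hpz : p.1.2.2 ≠ 0 := fun h => by
    obtain ⟨c, R, -, -, w, -, -, h3⟩ := exists_circle_of_standardHeight_eq_zero (graph_eq_zero h)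
    exact hG.fold_fst _ (graph_eq_zero h) p.2.1 hpX (h3.trans (by simp [hpm.1]))
  -- No other grid curve passes through `p`, so near `p` the arc `a` is the curve `x = c`, and the
  -- planar coordinates show transversality.
  have hline := haline p hpa (hD ▸ hpD) _ (fst_mem_gridCurves hpX) (by
    rintro M (⟨c, -, rfl⟩ | ⟨d, hd, rfl⟩) hpM
    · rw [show p.1.1 = c from hpM]
    · exact absurd ((show p.1.2.1 = d from hpM) ▸ hd) hpY)
  obtain ⟨e, hpe, he⟩ :=
    (isCoordinatePair_planar hG.contDiff_f p.2.2 hpz).exists_chart hG.contDiff_b.continuous hpD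
  obtain ⟨U, hU, hUo, hpU⟩ :=
    eventually_nhds_iff.1 (hline.and (eventually_mem_meridian_iff hpm))
  refine ⟨hD ▸ hpD, e.restrOpen U hUo, ⟨hpe, hpU⟩, fun q hq => ?_⟩
  constructor
  · rw [show (e.restrOpen U hUo) q = e q from rfl, (he q).1, sub_eq_zero]
    exact (hU q hq.2).1
  · rw [show (e.restrOpen U hUo) q = e q from rfl, (he q).2, hpm.1, sub_zero]
    exact (hU q hq.2).2

end Standard

/-! ### Transfer to an arbitrary two-holed surface -/

theorem IntersectTransversely.image {S T : Type*} [TopologicalSpace S] [TopologicalSpace T]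
    {C₁ C₂ : Set S} {D₁ D₂ : Set T} (h : S ≃ₜ T) (h1 : ∀ q, h q ∈ D₁ ↔ q ∈ C₁)
    (h2 : ∀ q, h q ∈ D₂ ↔ q ∈ C₂) {l m : ProperArc C₁ C₂} (hlm : IntersectTransversely l m) :
    IntersectTransversely (⟨h '' l.1, l.2.image h h1 h2⟩ : ProperArc D₁ D₂)
      ⟨h '' m.1, m.2.image h h1 h2⟩ := by
  rintro _ ⟨⟨p, hpl, rfl⟩, hpm⟩
  have hpm : p ∈ m.1 := (h.injective.mem_set_image).1 hpm
  obtain ⟨hpC, e, hpe, he⟩ := hlm p ⟨hpl, hpm⟩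
  refine ⟨fun hp => hpC (hp.imp (h1 p).1 (h2 p).1), h.symm.transOpenPartialHomeomorph e,
    by simpa using hpe, fun q hq => ?_⟩
  obtain ⟨q, rfl⟩ := h.surjective q
  have hq : q ∈ e.source := by simpa using hq
  have := he q hq
  simpa [h.injective.mem_set_image] using this

theorem theorem2p2 (g : ℕ) {S : Type*} [TopologicalSpace S] (C₁ C₂ : Set S)
    (hS : IsTwoHoledSurface g S C₁ C₂) :
    (arcComplex C₁ C₂).oneSkeleton.Connected ∧
    ∀ (v w : ArcClass C₁ C₂) (l m : ProperArc C₁ C₂), l.toClass = v → m.toClass = w →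
      IntersectTransversely l m → ∀ k : ℕ, (l.1 ∩ m.1).encard = k →
        (arcComplex C₁ C₂).oneSkeleton.edist v w ≤ k + 1 := by
  obtain ⟨φ, hφ1, hφ2⟩ := hS
  let ψ : S ≃ₜ graphSurface (standardHeight g) standardBound :=
    φ.trans (Homeomorph.setCongr (graphSurface_standard g).symm)
  have hψ1 : ∀ q, ψ q ∈ upperBoundary (standardHeight g) standardBound ↔ q ∈ C₁ := fun q => by
    rw [← φ.injective.mem_set_image (s := C₁), hφ1]
    -- The circles are defined by `x² + y² = 1`, the graph boundary by `x² + y² - 1 = 0`.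
    exact and_congr_left' sub_eq_zero
  have hψ2 : ∀ q, ψ q ∈ lowerBoundary (standardHeight g) standardBound ↔ q ∈ C₂ := fun q => by
    rw [← φ.injective.mem_set_image (s := C₂), hφ2]
    exact and_congr_left' sub_eq_zero
  have hψ1' : ∀ q, ψ.symm q ∈ C₁ ↔ q ∈ upperBoundary (standardHeight g) standardBound := fun q => by
    rw [← hψ1, ψ.apply_symm_apply]
  have hψ2' : ∀ q, ψ.symm q ∈ C₂ ↔ q ∈ lowerBoundary (standardHeight g) standardBound := fun q => by
    rw [← hψ2, ψ.apply_symm_apply]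
  have hG := isGridSurface_standard g
  have : CompactSpace S := ψ.symm.compactSpace
  have : T2Space S := ψ.symm.t2Space
  have h1 : IsClosed C₁ := by
    rw [show C₁ = ψ ⁻¹' upperBoundary (standardHeight g) standardBound from
      Set.ext fun q => (hψ1 q).symm]
    exact (isClosed_upperBoundary hG.contDiff_b.continuous hG.ne_zero_of_boundary).preimage
      ψ.continuous
  have h2 : IsClosed C₂ := by
    rw [show C₂ = ψ ⁻¹' lowerBoundary (standardHeight g) standardBound from
      Set.ext fun q => (hψ2 q).symm]
    exact (isClosed_lowerBoundary hG.contDiff_b.continuous hG.ne_zero_of_boundary).preimage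
      ψ.continuous
  have hd : Disjoint C₁ C₂ := disjoint_left.2 fun q hq hq' =>
    disjoint_left.1 disjoint_upperBoundary_lowerBoundary ((hψ1 q).2 hq) ((hψ2 q).2 hq')
  constructor
  · refine oneSkeleton_connected h1 h2 hd
      ⟨_, (isProperArc_meridian g).image ψ.symm hψ1' hψ2'⟩ fun l => ?_
    obtain ⟨a, hal, ha⟩ := exists_disjoint_transverse_meridian (g := g) ⟨_, l.2.image ψ hψ1 hψ2⟩
    have ht := ha.image ψ.symm hψ1' hψ2'
    refine ⟨⟨_, a.2.image ψ.symm hψ1' hψ2'⟩, disjoint_left.2 ?_, ht, ht.finite⟩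
    rintro _ hl ⟨q, hq, rfl⟩
    exact disjoint_left.1 hal ⟨_, hl, ψ.apply_symm_apply q⟩ hq
  · rintro _ _ l m rfl rfl ht k hk
    exact edist_toClass_le h1 h2 hd k l m ht (finite_of_encard_eq_coe hk)
      (by rw [ncard, hk, ENat.toNat_natCast])
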